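/- Let $F/\mathbf F_q$ be an algebraic function field of one variable of genus $g$, and let $Q,P_1,\dots,P_n$ be distinct places of degree one; put $D=P_1+\dots+P_n$, $\mathcal L(\infty Q)=\bigcup_{i}\mathcal L(iQ)$ and, for a divisor $G$, $\mathcal L(-G+\infty Q)=\bigcup_i\mathcal L(-G+iQ)$. Let the Weierstrass semigroup $H(Q)$ be generated by positive integers $a_1,\dots,a_t$ ($t\ge 1$) and let $x_1,\dots,x_t\in F$ have pole divisors $(x_i)_\infty=a_iQ$. For $0\le j<a_1$ let $b_j=\min\{s\in H(Q): s\equiv j \pmod{a_1}\}$, and let $y_j=x_1^{e_1}\cdots x_t^{e_t}$, where $(e_1,\dots,e_t)\in\mathbf N_0^t$ is, among the vectors with $\sum_i a_ie_i=b_j$, the one that is lexicographically largest (then $e_1=0$). Thus $y_0,\dots,y_{a_1-1}$ is a basis of $\mathcal L(\infty Q)$ over $\mathbf F_q[x_1]$. Assume that there is $f\in\mathcal L(\infty Q)$ with zero divisor $(f)_0=D$, and that $f\in\mathbf F_q[x_1]$. Let $u\ge 0$ and $0\le m\le \ell$ be integers, let $\vec r\in\mathbf F_q^n$, and let $h\in\mathcal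 L(\infty Q)$ satisfy $h(P_i)=r_i$ for all $i$ and $-v_Q(h)\le n+2g-1$. Let $I_{\vec r,m,\ell}$ be the set of all $A(Z)\in\mathcal L(\infty Q)[Z]$ with $\deg_Z A\le \ell$ that have multiplicity (at least) $m$ at every $(P_i,r_i)$, i.e. if $A(Z+r_i)=\sum_k c_kZ^k$ then $v_{P_i}(c_k)\ge m-k$ for all $k$. Put $\eta_{i,j}=f^iy_j$ and $N=a_1(\ell+1)$. Identify $\{A\in \mathcal L(\infty Q)[Z]:\deg_ZA\le \ell\}$ with $\mathbf F_q[x_1]^{N}$ through the basis $\mathbf e_{1+j+ka_1}=y_jZ^k$ ($0\le j<a_1$, $0\le k\le \ell$), and order the monomials $x_1^i\mathbf e_{1+j+ka_1}=x_1^iy_jZ^k$ by the weight $-i\,v_Q(x_1)-v_Q(y_j)+ku$, ties being broken by the index of the basis vector (the larger index is the larger monomial). Let $$g_{1+j+ka_1}=\begin{cases}(Z-h)^{k}\,\eta_{m-k,j}, & 0\le k\le m,\\ Z^{k-m}(Z-h)^m\,\eta_{0,j}, & m<k\le \ell.\end{cases}$$ *Algorithm G* (Lee–O'Sullivan). Its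 input is a list $g_1,\dots,g_N\in\mathbf F_q[x_1]^N$, $g_s=(g_{s1},\dots,g_{sN})$, such that the last nonzero coordinate of $g_s$ is the $s$-th one for every $s$. For $r=1,\dots,N$ in turn, repeat the following until the leading term of $g_r$ lies in coordinate $r$: let $s$ be the coordinate in which the leading term of $g_r$ lies, $d=\deg g_{rs}-\deg g_{ss}$ and $c=\mathrm{lc}(g_{rs})\,\mathrm{lc}(g_{ss})^{-1}$; if $d\ge 0$ replace $g_r$ by $g_r-c\,x_1^{d}g_s$; if $d<0$ replace simultaneously $g_s$ by $g_r$ and $g_r$ by $x_1^{-d}g_r-c\,g_s$. The output is the final list $g_1,\dots,g_N$. Multiplications are counted in $\mathbf F_q$: one for each computation of $c$, and $\deg p+1$ for each multiplication of a nonzero coordinate $p$ of $g_s$ by $c$. Proposition. For $0\le i\le m$ and $0\le j<a_1$, the element $\eta_{i,j}$ has the least pole order at $Q$ among the nonzero elements of $\mathcal L(-iD+\infty Q)$ whose pole order at $Q$ is congruent to $j$ modulo $a_1$. The elements $g_1,\dots,g_N$ have unique coordinate vectors in $\mathbf F_q[x_1]^N$, and the last nonzero coordinate of $g_s$ is the $s$-th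 one. Algorithm G, run on them with the above order, terminates, its output is a minimal Gröbner basis (up to scaling its elements by nonzero constants) of $I_{\vec r,m,\ell}$ as an $\mathbf F_q[x_1]$-module, and it uses at most $$\Bigl[\max_{0\le j<a_1}\{-v_Q(y_j)\}+m(n+2g-1)+u(\ell-m)\Bigr]^2a_1^{-1}\sum_{i=1}^{a_1(\ell+1)}i^2$$ multiplications. -/

import Mathlib

/-!
Dividing by `f ^ i` carries `L(-iD + ∞Q)` into `L(∞Q)`, which gives the minimal pole orders. Write
`f = φ(x₁)`. An element of `I_{r,m,ℓ}` whose last nonzero coordinate belongs to `y_j Z ^ k` has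
its leading `Z`-coefficient in `L(-(m - k)D + ∞Q)`, so this coordinate is divisible by
`φ ^ (m - k)`, the diagonal entry of the corresponding generator. Hence the generators, which are
triangular, span `I_{r,m,ℓ}`. Every step of Algorithm G preserves the span, and rows whose leading
terms lie in pairwise distinct coordinates form a minimal Gröbner basis.

To count multiplications, call the excess of row `r` the weight of its leading monomial minus that
of the leading monomial of its diagonal entry. During the stage of row `r` the diagonal entry is
never cancelled, and the excess never increases and drops each time a pivot is used again. The
pivot determines the residue of the excess modulo `a₁`, so it is used at most `⌈E / a₁⌉` times if
the excess is at most `E` at the beginning; for the row of `y_j Z ^ k` one can take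
`E = min(k, m) · max(n + 2g - 1 - u, 0)`. The cost of a step is governed by the degree of the
leading term of its pivot row, and the sum of these degrees over the rows `≤ r` never changes
(with the degree of the diagonal entry taken for row `r`). Summing over the stages proves the
bound; for `a₁ ≥ 2` crude estimates suffice, while `a₁ = 1` needs a more careful count.
-/

open Polynomial IntermediateField

noncomputable section

namespace AGInterp

section Curves

variable {K F : Type*} [Field K] [Field F] [Algebra K F]

/-- `F / K` is an algebraic function field of one variable: a finite extension of `K(x)` for
some `x` transcendental over `K`. -/
def IsFunctionField (K F : Type*) [Field K] [Field F] [Algebra K F] : Prop :=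
  ∃ x : F, Transcendental K x ∧ FiniteDimensional K⟮x⟯ F

/-- A place of `F / K`, given by its normalized discrete valuation. -/
@[ext] structure Place (K F : Type*) [Field K] [Field F] [Algebra K F] where
  /-- the valuation `v_P`, with `v_P 0 = ⊤` -/
  val : AddValuation F (WithTop ℤ)
  /-- `v_P` is trivial on the nonzero constants -/
  val_const : ∀ c : K, c ≠ 0 → val (algebraMap K F c) = 0
  /-- `v_P` is normalized: its value group is `ℤ` -/
  normalized : ∃ x : F, val x = ((1 : ℤ) : WithTop ℤ)

namespace Place

theorem val_const_nonneg (P : Place K F) (c : K) : 0 ≤ P.val (algebraMap K F c) := by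
  by_cases h : c = 0
  · simp [h]
  · rw [P.val_const c h]

/-- The valuation ring of `P`, as a `K`-linear subspace of `F`. -/
def valRing (P : Place K F) : Submodule K F where
  carrier := {x | 0 ≤ P.val x}
  zero_mem' := by simp
  add_mem' := fun {x y} hx hy => le_trans (le_min hx hy) (P.val.map_add x y)
  smul_mem' := fun c x hx => by
    simp only [Set.mem_ofPred_eq, Algebra.smul_def, AddValuation.map_mul] at *
    exact add_nonneg (P.val_const_nonneg c) hx

/-- The maximal ideal of the valuation ring of `P`, as a `K`-linear subspace of `F`. -/
def maxIdeal (P : Place K F) : Submodule K F where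
  carrier := {x | 0 < P.val x}
  zero_mem' := by simp
  add_mem' := fun {x y} hx hy => lt_of_lt_of_le (lt_min hx hy) (P.val.map_add x y)
  smul_mem' := fun c x hx => by
    simp only [Set.mem_ofPred_eq, Algebra.smul_def, AddValuation.map_mul] at *
    exact lt_of_lt_of_le hx (le_add_of_nonneg_left (P.val_const_nonneg c))

/-- The degree of `P`: the `K`-dimension of its residue field. -/
def degree (P : Place K F) : ℕ :=
  Module.finrank K (P.valRing ⧸ P.maxIdeal.submoduleOf P.valRing)

end Place

/-- The group of divisors. -/
abbrev Divisor (K F : Type*) [Field K] [Field F] [Algebra K F] : Type _ := Place K F →₀ ℤ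

/-- The degree of a divisor. -/
def divDegree (A : Divisor K F) : ℤ := A.sum fun P c => c * (P.degree : ℤ)

/-- The Riemann–Roch space `L(A)`. -/
def rrSpace (A : Divisor K F) : Submodule K F where
  carrier := {x | ∀ P : Place K F, ((-(A P) : ℤ) : WithTop ℤ) ≤ P.val x}
  zero_mem' := fun P => by simp
  add_mem' := fun {x y} hx hy P => le_trans (le_min (hx P) (hy P)) (P.val.map_add x y)
  smul_mem' := fun c x hx P => by
    rw [Algebra.smul_def, AddValuation.map_mul]
    exact le_trans (hx P) (le_add_of_nonneg_left (P.val_const_nonneg c))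

/-- The genus: the supremum of `deg A - dim L(A) + 1` over all divisors `A`. Truncating negative
values at `0` is harmless, because `A = 0` contributes the value `0` when `K` is the full constant
field, as it is as soon as there is a place of degree one. -/
def genus (K F : Type*) [Field K] [Field F] [Algebra K F] : ℕ∞ :=
  ⨆ A : Divisor K F,
    (((divDegree A - (Module.finrank K (rrSpace A) : ℤ) + 1).toNat : ℕ) : ℕ∞)

/-- `L(G + ∞Q)`, the union of the spaces `L(G + iQ)`. -/
def poleSpace (G : Divisor K F) (Q : Place K F) : Set F :=
  ⋃ i : ℕ, (rrSpace (G + Finsupp.single Q (i : ℤ)) : Set F)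

/-- `L(∞Q)`. -/
def regularAway (Q : Place K F) : Set F := poleSpace 0 Q

/-- The pole order `-v_Q(x)` of a nonzero `x`. -/
def poleOrder (Q : Place K F) (x : F) : ℤ := -((Q.val x).untopD 0)

/-- The pole divisor of `x` is `A`. -/
def HasPoleDivisor (x : F) (A : Divisor K F) : Prop :=
  ∀ P : Place K F, min (P.val x) 0 = ((-(A P) : ℤ) : WithTop ℤ)

/-- The zero divisor of `x` is `A`. -/
def HasZeroDivisor (x : F) (A : Divisor K F) : Prop :=
  ∀ P : Place K F, max (P.val x) 0 = ((A P : ℤ) : WithTop ℤ)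

/-- The Weierstrass semigroup `H(Q)`: the pole orders of the nonzero elements of `L(∞Q)`. -/
def weierstrass (Q : Place K F) : Set ℕ :=
  {s | ∃ x ∈ regularAway Q, Q.val x = ((-(s : ℤ) : ℤ) : WithTop ℤ)}

/-- The weighted degree of an exponent vector. -/
def wdeg {t : ℕ} (a : Fin t → ℕ) (e : Fin t → ℕ) : ℕ := ∑ i, a i * e i

/-- `e ≺ e'`: smaller weighted degree, or the same one and at the first index where they differ
the entry of `e` is the larger one. -/
def MonPrec {t : ℕ} (a : Fin t → ℕ) (e e' : Fin t → ℕ) : Prop :=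
  wdeg a e < wdeg a e' ∨
    (wdeg a e = wdeg a e' ∧ ∃ i, (∀ j, j < i → e j = e' j) ∧ e' i < e i)

/-- `e` is the `≺`-minimum among the exponent vectors of weighted degree `s`. -/
def IsMinExponent {t : ℕ} (a : Fin t → ℕ) (s : ℕ) (e : Fin t → ℕ) : Prop :=
  wdeg a e = s ∧ ∀ e', wdeg a e' = s → e' = e ∨ MonPrec a e e'

open Classical in
/-- The `≺`-minimal exponent vector of weighted degree `s` (`0` if there is none). -/
def minExponent {t : ℕ} (a : Fin t → ℕ) (s : ℕ) : Fin t → ℕ :=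
  if h : ∃ e, IsMinExponent a s e then h.choose else 0

/-- `b_j`, the least element of `H(Q)` that is congruent to `j` modulo `a₁`. -/
def residueMin (Q : Place K F) (a₁ j : ℕ) : ℕ := sInf {s | s ∈ weierstrass Q ∧ s ≡ j [MOD a₁]}

/-- The module basis element `y_j` of `L(∞Q)` over `K[x₁]`; here `a₁ = a 0` and `x₁ = x 0`. -/
def basisElt (Q : Place K F) {t : ℕ} (a : Fin (t + 1) → ℕ) (x : Fin (t + 1) → F) (j : ℕ) : F :=
  ∏ i, x i ^ minExponent a (residueMin Q (a 0) j) i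

/-- `η` is an element of `L(G + ∞Q)` whose pole order at `Q` is the least one among the nonzero
elements of `L(G + ∞Q)` with pole order congruent to `j` modulo `a₁`. -/
def IsMinPole (G : Divisor K F) (Q : Place K F) (a₁ j : ℕ) (η : F) : Prop :=
  η ∈ poleSpace G Q ∧ η ≠ 0 ∧ poleOrder Q η ≡ j [ZMOD a₁] ∧
    ∀ ζ ∈ poleSpace G Q, ζ ≠ 0 → poleOrder Q ζ ≡ j [ZMOD a₁] → poleOrder Q η ≤ poleOrder Q ζ

/-- `q(Z)` has multiplicity (at least) `m` at `(P, r)`: writing `q(Z + r) = ∑ c_t Z ^ t`, every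
`c_t` vanishes at `P` to order at least `m - t`. -/
def HasMultiplicity (q : F[X]) (P : Place K F) (r : K) (m : ℕ) : Prop :=
  ∀ t : ℕ, (((m : ℤ) - (t : ℤ) : ℤ) : WithTop ℤ) ≤
    P.val ((q.comp (X + C (algebraMap K F r))).coeff t)

/-- `I_{r,m,ℓ}`: the polynomials in `L(∞Q)[Z]` of `Z`-degree at most `ℓ` that have multiplicity
`m` at all `(P_i, r_i)`. -/
def interpolationModule (Q : Place K F) {n : ℕ} (P : Fin n → Place K F) (r : Fin n → K)
    (m ℓ : ℕ) : Set F[X] :=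
  {q | q.natDegree ≤ ℓ ∧ (∀ t, q.coeff t ∈ regularAway Q) ∧
    ∀ i, HasMultiplicity q (P i) (r i) m}

/-- The generators of the interpolation module, in the order in which they are fed to the
algorithm: number `j + k a₁` (counting from zero) is `(Z - h) ^ k η_{m-k,j}` if `k ≤ m`, and
`Z ^ (k - m) (Z - h) ^ m η_{0,j}` if `k > m`. -/
def generator (a₁ m : ℕ) (η : ℕ → ℕ → F) (h : F) (r : ℕ) : F[X] :=
  if r / a₁ ≤ m then (X - C h) ^ (r / a₁) * C (η (m - r / a₁) (r % a₁))
  else X ^ (r / a₁ - m) * (X - C h) ^ m * C (η 0 (r % a₁))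

/-- The element of `L(∞Q)[Z]` with coordinate vector `p` with respect to the basis in which basis
element number `j + k a₁` (counting from zero) is `y_j Z ^ k`. -/
def ofCoords (a₁ : ℕ) (x₁ : F) (y : ℕ → F) {N : ℕ} (p : Fin N → K[X]) : F[X] :=
  ∑ r : Fin N, C (aeval x₁ (p r) * y (r.1 % a₁)) * X ^ (r.1 / a₁)

end Curves

section AlgorithmG

variable {K : Type*} [Field K] {N : ℕ}

/-- The monomial `x ^ e · e_i` of `K[x] ^ N` is written `(e, i)`. The order: by weight
`e u_x + u_i`, ties broken by the index of the basis vector. -/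
def MonLT (ux : ℤ) (w : Fin N → ℤ) (p q : ℕ × Fin N) : Prop :=
  p.1 * ux + w p.2 < q.1 * ux + w q.2 ∨
    (p.1 * ux + w p.2 = q.1 * ux + w q.2 ∧ p.2 < q.2)

/-- `p` is the leading monomial of the vector `v`. -/
def IsLeadMon (ux : ℤ) (w : Fin N → ℤ) (v : Fin N → K[X]) (p : ℕ × Fin N) : Prop :=
  (v p.2).coeff p.1 ≠ 0 ∧ ∀ q : ℕ × Fin N, (v q.2).coeff q.1 ≠ 0 → q = p ∨ MonLT ux w q p

/-- Divisibility of monomials of `K[x] ^ N`. -/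
def MonDvd (p q : ℕ × Fin N) : Prop := p.2 = q.2 ∧ p.1 ≤ q.1

/-- The rows of `B` form a minimal Gröbner basis of `S` (up to scaling the rows): they are nonzero
elements of `S`, the leading monomial of every nonzero element of `S` is divisible by the leading
monomial of a row, and no leading monomial of a row divides that of another row. -/
def IsMinimalGroebnerBasis (ux : ℤ) (w : Fin N → ℤ) (S : Set (Fin N → K[X]))
    (B : Fin N → Fin N → K[X]) : Prop :=
  (∀ i, B i ∈ S ∧ B i ≠ 0) ∧
  (∀ v ∈ S, v ≠ 0 → ∃ i p q, IsLeadMon ux w (B i) p ∧ IsLeadMon ux w v q ∧ MonDvd p q) ∧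
  (∀ i j p q, i ≠ j → IsLeadMon ux w (B i) p → IsLeadMon ux w (B j) q → ¬ MonDvd p q)

/-- `ind v = i`: the last nonzero coordinate of `v` is number `i`. -/
def HasInd (v : Fin N → K[X]) (i : Fin N) : Prop := v i ≠ 0 ∧ ∀ j, i < j → v j = 0

open Classical in
/-- The index of the leading monomial of `v` (the default value `d` if `v = 0`). -/
def leadIndex (ux : ℤ) (w : Fin N → ℤ) (v : Fin N → K[X]) (d : Fin N) : Fin N :=
  if h : ∃ p, IsLeadMon ux w v p then h.choose.2 else d

open Classical in
/-- The number of multiplications in `K` used to multiply the vector `v` by a scalar: one for each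
coefficient, up to the degree, of each nonzero coordinate. -/
def scaleCost (v : Fin N → K[X]) : ℕ := ∑ i, if v i = 0 then 0 else (v i).natDegree + 1

/-- A state of Algorithm G: the current vectors `g_1, …, g_N`, the current index `r` (counting
from zero) and the number of multiplications in `K` performed so far. -/
structure GState (K : Type*) [Field K] (N : ℕ) where
  rows : Fin N → Fin N → K[X]
  idx : ℕ
  mults : ℕ

open Classical in
/-- One step of Algorithm G. If `r` is out of range, the algorithm has stopped. Otherwise let `s`
be the index of the leading term of `g_r`. If `s = r`, go on to the next `r`. If `s ≠ r`, put
`d = deg g_{rs} - deg g_{ss}` and `c = lc g_{rs} / lc g_{ss}` (counted as one multiplication);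
if `d ≥ 0`, replace `g_r` by `g_r - c x ^ d g_s`; if `d < 0`, replace simultaneously `g_s` by `g_r`
and `g_r` by `x ^ (-d) g_r - c g_s`. -/
def algGStep (ux : ℤ) (w : Fin N → ℤ) (σ : GState K N) : GState K N :=
  if hr : σ.idx < N then
    let r : Fin N := ⟨σ.idx, hr⟩
    let gr := σ.rows r
    let s := leadIndex ux w gr r
    let gs := σ.rows s
    if s = r then { σ with idx := σ.idx + 1 }
    else
      let c : K := (gr s).leadingCoeff * ((gs s).leadingCoeff)⁻¹
      { rows :=
          if (gs s).natDegree ≤ (gr s).natDegree then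
            Function.update σ.rows r
              (gr - (C c * X ^ ((gr s).natDegree - (gs s).natDegree) : K[X]) • gs)
          else
            Function.update (Function.update σ.rows s gr) r
              ((X ^ ((gs s).natDegree - (gr s).natDegree) : K[X]) • gr - (C c : K[X]) • gs)
        idx := σ.idx
        mults := σ.mults + (1 + scaleCost gs) }
  else σ

/-- Algorithm G, run with weights `ux`, `w` on the vectors `g`, stops after finitely many steps in
the final state `τ`. -/
def AlgGHaltsWith (ux : ℤ) (w : Fin N → ℤ) (g : Fin N → Fin N → K[X]) (τ : GState K N) : Prop :=
  N ≤ τ.idx ∧ ∃ T : ℕ, (algGStep ux w)^[T] { rows := g, idx := 0, mults := 0 } = τ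

end AlgorithmG

end AGInterp

end

namespace AGInterp

section MonomialOrder

variable {K : Type*} [Field K] {N : ℕ} {ux : ℤ} {w : Fin N → ℤ}

/-- The weight of a monomial of `K[x] ^ N`. -/
def monWeight (ux : ℤ) (w : Fin N → ℤ) (p : ℕ × Fin N) : ℤ := p.1 * ux + w p.2

/-- The position of a monomial in the order `MonLT`, as an element of a linear order. -/
def monKey (ux : ℤ) (w : Fin N → ℤ) (p : ℕ × Fin N) : ℤ ×ₗ Fin N := toLex (monWeight ux w p, p.2)

theorem monLT_iff_monKey_lt {p q : ℕ × Fin N} :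
    MonLT ux w p q ↔ monKey ux w p < monKey ux w q :=
  (Prod.Lex.toLex_lt_toLex (x := (monWeight ux w p, p.2)) (y := (monWeight ux w q, q.2))).symm

theorem monKey_injective (hux : 0 < ux) (w : Fin N → ℤ) : Function.Injective (monKey ux w) := by
  intro p q h
  obtain ⟨hweight, hindex⟩ := Prod.ext_iff.mp (toLex_inj.mp h)
  simp only [monWeight] at hweight hindex
  rw [hindex, add_left_inj, mul_left_inj' hux.ne'] at hweight
  exact Prod.ext (by exact_mod_cast hweight) hindex

theorem monWeight_add (d e : ℕ) (i : Fin N) :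
    monWeight ux w (d + e, i) = monWeight ux w (d, i) + e * ux := by
  simp only [monWeight]; push_cast; ring

theorem monKey_add_le_monKey_add (hux : 0 < ux) {p q : ℕ × Fin N} {d e : ℕ} (hde : d ≤ e)
    (h : monKey ux w p ≤ monKey ux w q) :
    monKey ux w (p.1 + d, p.2) ≤ monKey ux w (q.1 + e, q.2) := by
  have hmul : (d : ℤ) * ux ≤ e * ux := by gcongr
  simp only [monKey, Prod.Lex.toLex_le_toLex, monWeight_add] at h ⊢
  obtain h | ⟨h, hi⟩ := h
  · exact Or.inl (by linarith)
  · obtain hlt | heq := hmul.lt_or_eq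
    · exact Or.inl (by linarith)
    · exact Or.inr ⟨by rw [h, heq], hi⟩

theorem isLeadMon_iff (hux : 0 < ux) {v : Fin N → K[X]} {p : ℕ × Fin N} :
    IsLeadMon ux w v p ↔ (v p.2).coeff p.1 ≠ 0 ∧
      ∀ q : ℕ × Fin N, (v q.2).coeff q.1 ≠ 0 → monKey ux w q ≤ monKey ux w p := by
  refine and_congr_right fun _ => forall₂_congr fun q _ => ?_
  rw [monLT_iff_monKey_lt, le_iff_lt_or_eq, (monKey_injective hux w).eq_iff, or_comm]

theorem IsLeadMon.ne_zero {v : Fin N → K[X]} {p : ℕ × Fin N} (hp : IsLeadMon ux w v p) :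
    v ≠ 0 := by
  rintro rfl
  exact hp.1 (by simp)

theorem IsLeadMon.unique (hux : 0 < ux) {v : Fin N → K[X]} {p q : ℕ × Fin N}
    (hp : IsLeadMon ux w v p) (hq : IsLeadMon ux w v q) : p = q := by
  rw [isLeadMon_iff hux] at hp hq
  exact monKey_injective hux w (le_antisymm (hq.2 _ hp.1) (hp.2 _ hq.1))

theorem exists_isLeadMon (hux : 0 < ux) (w : Fin N → ℤ) {v : Fin N → K[X]} (hv : v ≠ 0) :
    ∃ p, IsLeadMon ux w v p := by
  classical
  let S : Finset (ℕ × Fin N) := Finset.univ.biUnion fun i => (v i).support.image fun d => (d, i)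
  have hS : ∀ p, p ∈ S ↔ (v p.2).coeff p.1 ≠ 0 := by
    rintro ⟨d, i⟩
    simp [S]
  obtain ⟨i, hi⟩ := Function.ne_iff.mp hv
  have hne : S.Nonempty := ⟨((v i).natDegree, i), (hS _).mpr (leadingCoeff_ne_zero.mpr hi)⟩
  obtain ⟨p, hp, hmax⟩ := S.exists_max_image (monKey ux w) hne
  exact ⟨p, (isLeadMon_iff hux).mpr ⟨(hS p).mp hp, fun q hq => hmax q ((hS q).mpr hq)⟩⟩

theorem leadIndex_eq (hux : 0 < ux) {v : Fin N → K[X]} {p : ℕ × Fin N} (hp : IsLeadMon ux w v p)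
    (d : Fin N) : leadIndex ux w v d = p.2 := by
  have h : ∃ p, IsLeadMon ux w v p := ⟨p, hp⟩
  rw [leadIndex, dif_pos h, h.choose_spec.unique hux hp]

theorem IsLeadMon.natDegree_eq (hux : 0 < ux) {v : Fin N → K[X]} {p : ℕ × Fin N}
    (hp : IsLeadMon ux w v p) : (v p.2).natDegree = p.1 := by
  rw [isLeadMon_iff hux] at hp
  refine le_antisymm (natDegree_le_iff_coeff_eq_zero.mpr fun d hd => ?_)
    (le_natDegree_of_ne_zero hp.1)
  by_contra hne
  have hle : monKey ux w (p.1, p.2) ≤ monKey ux w (d, p.2) := by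
    simpa using monKey_add_le_monKey_add (w := w) (p := (0, p.2)) hux hd.le le_rfl
  have := monKey_injective hux w (le_antisymm hle (hp.2 (d, p.2) hne))
  exact hd.ne (Prod.ext_iff.mp this).1

theorem IsLeadMon.smul (hux : 0 < ux) {v : Fin N → K[X]} {p : ℕ × Fin N}
    (hp : IsLeadMon ux w v p) {a : K[X]} (ha : a ≠ 0) :
    IsLeadMon ux w (a • v) (p.1 + a.natDegree, p.2) := by
  refine (isLeadMon_iff hux).mpr ⟨?_, fun q hq => ?_⟩
  · have hlead : (a * v p.2).coeff (p.1 + a.natDegree) = a.leadingCoeff * (v p.2).coeff p.1 := by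
      conv_lhs => rw [← hp.natDegree_eq hux, add_comm, coeff_mul_degree_add_degree]
      rw [leadingCoeff, leadingCoeff, hp.natDegree_eq hux]
    rw [Pi.smul_apply, smul_eq_mul, hlead]
    exact mul_ne_zero (leadingCoeff_ne_zero.mpr ha) hp.1
  · rw [Pi.smul_apply, smul_eq_mul, coeff_mul] at hq
    obtain ⟨⟨d, e⟩, hde, hprod⟩ := Finset.exists_ne_zero_of_sum_ne_zero hq
    have hkey := ((isLeadMon_iff hux).mp hp).2 (e, q.2) (right_ne_zero_of_mul hprod)
    have hd : d ≤ a.natDegree := le_natDegree_of_ne_zero (left_ne_zero_of_mul hprod)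
    have hq1 : (e + d, q.2) = q :=
      Prod.ext ((add_comm e d).trans (Finset.HasAntidiagonal.mem_antidiagonal.mp hde)) rfl
    exact hq1 ▸ monKey_add_le_monKey_add hux hd hkey

theorem IsLeadMon.monKey_lt_of_sub (hux : 0 < ux) {v v' : Fin N → K[X]} {p q : ℕ × Fin N}
    (hv : IsLeadMon ux w v p) (hv' : IsLeadMon ux w v' p)
    (hcoeff : (v p.2).coeff p.1 = (v' p.2).coeff p.1) (hq : ((v - v') q.2).coeff q.1 ≠ 0) :
    monKey ux w q < monKey ux w p := by
  rw [isLeadMon_iff hux] at hv hv'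
  rw [Pi.sub_apply, coeff_sub] at hq
  refine lt_of_le_of_ne ?_ fun h => hq ?_
  · by_contra hgt
    exact hq (by rw [by_contra fun h => hgt (hv.2 q h), by_contra fun h => hgt (hv'.2 q h),
      sub_zero])
  · rw [monKey_injective hux w h, hcoeff, sub_self]

/-- The leading terms of the summands lie in different coordinates, so the largest one survives. -/
theorem exists_isLeadMon_of_mem_span (hux : 0 < ux) {B : Fin N → Fin N → K[X]} {S : Set (Fin N)}
    {D : Fin N → ℕ} (hB : ∀ i ∈ S, IsLeadMon ux w (B i) (D i, i)) {v : Fin N → K[X]}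
    (hv : v ∈ Submodule.span K[X] (B '' S)) (hv0 : v ≠ 0) :
    ∃ i ∈ S, ∃ e, D i ≤ e ∧ IsLeadMon ux w v (e, i) := by
  classical
  obtain ⟨c, hc, rfl⟩ := (Finsupp.mem_span_image_iff_linearCombination K[X]).mp hv
  have hlead : ∀ i ∈ c.support, IsLeadMon ux w (c i • B i) (D i + (c i).natDegree, i) :=
    fun i hi => (hB i (hc hi)).smul hux (Finsupp.mem_support_iff.mp hi)
  have hne : c.support.Nonempty :=
    Finsupp.support_nonempty_iff.mpr fun h => hv0 (by rw [h, map_zero])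
  obtain ⟨i, hi, hmax⟩ := c.support.exists_max_image
    (fun i => monKey ux w (D i + (c i).natDegree, i)) hne
  refine ⟨i, hc hi, D i + (c i).natDegree, Nat.le_add_right _ _,
    (isLeadMon_iff hux).mpr ⟨?_, fun q hq => ?_⟩⟩
  · rw [Finsupp.linearCombination_apply, Finsupp.sum, Finset.sum_apply, finsetSum_coeff,
      Finset.sum_eq_single_of_mem i hi]
    · exact (hlead i hi).1
    · intro j hj hji
      by_contra hcoeff
      have hle := ((isLeadMon_iff hux).mp (hlead j hj)).2 (_, i) hcoeff
      have := monKey_injective hux w (le_antisymm hle (hmax j hj))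
      exact hji (Prod.ext_iff.mp this).2.symm
  · rw [Finsupp.linearCombination_apply, Finsupp.sum, Finset.sum_apply, finsetSum_coeff] at hq
    obtain ⟨j, hj, hjq⟩ := Finset.exists_ne_zero_of_sum_ne_zero hq
    exact (((isLeadMon_iff hux).mp (hlead j hj)).2 q hjq).trans (hmax j hj)

theorem isMinimalGroebnerBasis_span_range (hux : 0 < ux) {B : Fin N → Fin N → K[X]}
    {D : Fin N → ℕ} (hB : ∀ i, IsLeadMon ux w (B i) (D i, i)) :
    IsMinimalGroebnerBasis ux w (Submodule.span K[X] (Set.range B) : Set (Fin N → K[X])) B := by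
  refine ⟨fun i => ⟨Submodule.subset_span ⟨i, rfl⟩, (hB i).ne_zero⟩, fun v hv hv0 => ?_, ?_⟩
  · rw [SetLike.mem_coe, ← Set.image_univ] at hv
    obtain ⟨i, -, e, he, hlead⟩ := exists_isLeadMon_of_mem_span hux (fun i _ => hB i) hv hv0
    exact ⟨i, _, _, hB i, hlead, rfl, he⟩
  · intro i j p q hij hp hq hdvd
    rw [hp.unique hux (hB i), hq.unique hux (hB j)] at hdvd
    exact hij hdvd.1

end MonomialOrder

section AlgorithmG

variable {K : Type*} [Field K] {N : ℕ} {ux : ℤ} {w : Fin N → ℤ}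

theorem algGStep_of_lead_eq (hux : 0 < ux) {ρ : Fin N → Fin N → K[X]} {r : Fin N} {μ d : ℕ}
    (hr : IsLeadMon ux w (ρ r) (d, r)) : algGStep ux w ⟨ρ, r, μ⟩ = ⟨ρ, r + 1, μ⟩ := by
  simp only [algGStep, r.2, ↓reduceDIte, Fin.eta, leadIndex_eq hux hr, ↓reduceIte]

/-- The rows after row `r`, with leading monomial `x ^ P · e_s`, has been reduced by row `s`, with
leading monomial `x ^ D · e_s`. The two cases of the algorithm differ in which of the truncated
differences `D - P` and `P - D` vanishes. -/
noncomputable def reduceRows (ρ : Fin N → Fin N → K[X]) (r s : Fin N) (P D : ℕ) (c : K) :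
    Fin N → Fin N → K[X] :=
  Function.update (Function.update ρ s (if D ≤ P then ρ s else ρ r)) r
    ((X ^ (D - P) : K[X]) • ρ r - (C c * X ^ (P - D) : K[X]) • ρ s)

theorem reduceRows_self (ρ : Fin N → Fin N → K[X]) (r s : Fin N) (P D : ℕ) (c : K) :
    reduceRows ρ r s P D c r = (X ^ (D - P) : K[X]) • ρ r - (C c * X ^ (P - D) : K[X]) • ρ s :=
  Function.update_self ..

theorem reduceRows_pivot (ρ : Fin N → Fin N → K[X]) {r s : Fin N} (hsr : s ≠ r) (P D : ℕ) (c : K) :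
    reduceRows ρ r s P D c s = if D ≤ P then ρ s else ρ r := by
  rw [reduceRows, Function.update_of_ne hsr, Function.update_self]

theorem reduceRows_of_ne (ρ : Fin N → Fin N → K[X]) {r s i : Fin N} (hr : i ≠ r) (hs : i ≠ s)
    (P D : ℕ) (c : K) : reduceRows ρ r s P D c i = ρ i := by
  rw [reduceRows, Function.update_of_ne hr, Function.update_of_ne hs]

theorem reduceRows_eq_or (ρ : Fin N → Fin N → K[X]) (D : Fin N → ℕ) {r s i : Fin N} (P : ℕ) (c : K)
    (hi : i ≠ r) :
    (reduceRows ρ r s P (D s) c i = ρ i ∧ Function.update D s (min P (D s)) i = D i) ∨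
      (i = s ∧ P < D s ∧ reduceRows ρ r s P (D s) c i = ρ r ∧
        Function.update D s (min P (D s)) i = P) := by
  obtain rfl | his := eq_or_ne i s
  · rw [reduceRows_pivot ρ hi, Function.update_self]
    obtain h | h := le_or_gt (D i) P
    · exact Or.inl ⟨if_pos h, min_eq_right h⟩
    · exact Or.inr ⟨rfl, h, if_neg h.not_ge, min_eq_left h.le⟩
  · exact Or.inl ⟨reduceRows_of_ne ρ hi his P (D s) c, Function.update_of_ne his ..⟩

open Classical in
theorem algGStep_of_lead_ne (hux : 0 < ux) {ρ : Fin N → Fin N → K[X]} {r s : Fin N}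
    {μ P D : ℕ} (hr : IsLeadMon ux w (ρ r) (P, s)) (hsr : s ≠ r)
    (hs : IsLeadMon ux w (ρ s) (D, s)) :
    ∃ c : K, c ≠ 0 ∧ c * (ρ s s).coeff D = (ρ r s).coeff P ∧
      algGStep ux w ⟨ρ, r, μ⟩ = ⟨reduceRows ρ r s P D c, r, μ + (1 + scaleCost (ρ s))⟩ := by
  have hrP : (ρ r s).natDegree = P := hr.natDegree_eq hux
  have hsD : (ρ s s).natDegree = D := hs.natDegree_eq hux
  refine ⟨(ρ r s).coeff P * ((ρ s s).coeff D)⁻¹, mul_ne_zero hr.1 (inv_ne_zero hs.1),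
    inv_mul_cancel_right₀ hs.1 _, ?_⟩
  simp only [algGStep, r.2, ↓reduceDIte, Fin.eta, leadIndex_eq hux hr, hsr, ↓reduceIte,
    leadingCoeff, hrP, hsD, reduceRows]
  split_ifs with h
  · rw [Nat.sub_eq_zero_of_le h, pow_zero, one_smul, Function.update_eq_self]
  · rw [Nat.sub_eq_zero_of_le (not_le.mp h).le, pow_zero, mul_one]

theorem span_reduceRows (ρ : Fin N → Fin N → K[X]) {r s : Fin N} (hsr : s < r) (P D : ℕ) {c : K}
    (hc : c ≠ 0) : Submodule.span K[X] (reduceRows ρ r s P D c '' Set.Iic r) =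
      Submodule.span K[X] (ρ '' Set.Iic r) := by
  have hmem (ρ : Fin N → Fin N → K[X]) (i : Fin N) (hi : i ≤ r) :
      ρ i ∈ Submodule.span K[X] (ρ '' Set.Iic r) := Submodule.subset_span ⟨i, hi, rfl⟩
  refine Submodule.span_eq_span (Set.forall_mem_image.mpr fun i hi => ?_)
    (Set.forall_mem_image.mpr fun i hi => ?_)
  · obtain rfl | hir := eq_or_ne i r
    · rw [reduceRows_self]
      exact sub_mem (Submodule.smul_mem _ _ (hmem ρ i le_rfl))
        (Submodule.smul_mem _ _ (hmem ρ s hsr.le))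
    obtain rfl | his := eq_or_ne i s
    · rw [reduceRows_pivot ρ hir]
      split_ifs
      exacts [hmem ρ i hi, hmem ρ r le_rfl]
    · rw [reduceRows_of_ne ρ hir his]
      exact hmem ρ i hi
  · have hr := hmem (reduceRows ρ r s P D c) r le_rfl
    have hs := hmem (reduceRows ρ r s P D c) s hsr.le
    rw [reduceRows_self] at hr
    rw [reduceRows_pivot ρ hsr.ne] at hs
    obtain ⟨hρr, hρs⟩ : ρ r ∈ Submodule.span K[X] (reduceRows ρ r s P D c '' Set.Iic r) ∧
        ρ s ∈ Submodule.span K[X] (reduceRows ρ r s P D c '' Set.Iic r) := by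
      split_ifs at hs with h
      · rw [Nat.sub_eq_zero_of_le h, pow_zero, one_smul] at hr
        exact ⟨(Submodule.sub_mem_iff_left _ (Submodule.smul_mem _ _ hs)).mp hr, hs⟩
      · rw [Nat.sub_eq_zero_of_le (not_le.mp h).le, pow_zero, mul_one] at hr
        have hcs := (Submodule.sub_mem_iff_right _ (Submodule.smul_mem _ _ hs)).mp hr
        refine ⟨hs, ?_⟩
        simpa only [smul_smul, ← C_mul, inv_mul_cancel₀ hc, C_1, one_smul] using
          Submodule.smul_mem _ (C c⁻¹) hcs
    obtain rfl | hir := eq_or_ne i r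
    · exact hρr
    obtain rfl | his := eq_or_ne i s
    · exact hρs
    · have := hmem (reduceRows ρ r s P D c) i hi
      rwa [reduceRows_of_ne ρ hir his] at this

/-- The position of the monomial `p` in the order `MonLT`, relative to `x ^ δ · e_r`. -/
def relKey (ux : ℤ) (w : Fin N → ℤ) (r : Fin N) (δ : ℕ) (p : ℕ × Fin N) : ℤ ×ₗ Fin N :=
  toLex (monWeight ux w p - monWeight ux w (δ, r), p.2)

theorem relKey_lt_relKey_iff {r : Fin N} {δ : ℕ} {p q : ℕ × Fin N} :
    relKey ux w r δ p < relKey ux w r δ q ↔ monKey ux w p < monKey ux w q := by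
  simp only [relKey, monKey, Prod.Lex.toLex_lt_toLex, sub_lt_sub_iff_right, sub_left_inj]

theorem relKey_add_add (r s : Fin N) (δ d e : ℕ) :
    relKey ux w r (δ + e) (d + e, s) = relKey ux w r δ (d, s) := by
  simp only [relKey, monWeight_add, add_sub_add_right_eq_sub]

theorem relKey_antitone (hux : 0 < ux) (r : Fin N) (p : ℕ × Fin N) :
    Antitone fun δ => relKey ux w r δ p := by
  intro d e hde
  have : (d : ℤ) * ux ≤ e * ux := by gcongr
  simp only [relKey, Prod.Lex.toLex_le_toLex, monWeight, le_refl, and_true]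
  exact (lt_or_eq_of_le (by linarith))

theorem add_lt_add_of_relKey_lt (hux : 0 < ux) {r s : Fin N} {δ d P D : ℕ}
    (h : relKey ux w r δ (P, s) < relKey ux w r d (D, s)) : P + d < D + δ := by
  simp only [relKey, Prod.Lex.toLex_lt_toLex, monWeight, lt_irrefl, and_false, or_false] at h
  have : ((P + d : ℕ) : ℤ) * ux < (D + δ : ℕ) * ux := by push_cast; linarith
  exact_mod_cast lt_of_mul_lt_mul_right this hux.le

/-- What holds during the stage of Algorithm G that treats row `r`: the rows `i < r` have leading
monomials `x ^ (D i) · e_i` and the row `r` has the leading monomial `p`. The field `cross` is the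
heart of the matter: it keeps the `r`-th coordinate of row `r` from being cancelled. At the
beginning of the stage, `D₀` holds the degrees `D` and `δ₀` the degree of the diagonal entry. -/
structure StageInv (ux : ℤ) (w : Fin N → ℤ) (r : Fin N) (V : Submodule K[X] (Fin N → K[X]))
    (D₀ : Fin N → ℕ) (δ₀ : ℕ) (ρ : Fin N → Fin N → K[X]) (D : Fin N → ℕ) (p : ℕ × Fin N) :
    Prop where
  lead : ∀ i < r, IsLeadMon ux w (ρ i) (D i, i)
  supp : ∀ i ≤ r, ∀ j, r < j → ρ i j = 0
  span_eq : Submodule.span K[X] (ρ '' Set.Iic r) = V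
  diag_ne : ρ r r ≠ 0
  diag : IsLeadMon ux w (ρ r) p
  cross : ∀ i < r, ∀ d, (ρ i r).coeff d ≠ 0 →
    relKey ux w r (ρ r r).natDegree p < relKey ux w r d (D i, i)
  drop : ∀ i < r, D i ≤ D₀ i ∧ (ρ i r ≠ 0 → D i < D₀ i)
  degree : ∑ i ∈ Finset.Iio r, D i + (ρ r r).natDegree = ∑ i ∈ Finset.Iio r, D₀ i + δ₀

namespace StageInv

variable {r : Fin N} {V : Submodule K[X] (Fin N → K[X])} {D₀ : Fin N → ℕ} {δ₀ : ℕ}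
  {ρ : Fin N → Fin N → K[X]} {D : Fin N → ℕ} {p : ℕ × Fin N}

theorem le_of_diag (hI : StageInv ux w r V D₀ δ₀ ρ D p) : p.2 ≤ r := by
  by_contra h
  exact hI.diag.1 (by rw [hI.supp r le_rfl _ (not_le.mp h), coeff_zero])

theorem one_le_relKey (hI : StageInv ux w r V D₀ δ₀ ρ D p) (hux : 0 < ux) (hp : p.2 ≠ r) :
    1 ≤ (ofLex (relKey ux w r (ρ r r).natDegree p)).1 := by
  have hkey := ((isLeadMon_iff hux).mp hI.diag).2 ((ρ r r).natDegree, r)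
    (leadingCoeff_ne_zero.mpr hI.diag_ne)
  simp only [monKey, Prod.Lex.toLex_le_toLex, (lt_of_le_of_ne hI.le_of_diag hp).not_ge, and_false,
    or_false] at hkey
  simp only [relKey, ofLex_toLex]
  omega

/-- The degree condition of the invariant `cross` is exactly what makes the first summand of the new
diagonal entry dominate. -/
theorem diag_reduceRows {P : ℕ} {s : Fin N} (hux : 0 < ux)
    (hI : StageInv ux w r V D₀ δ₀ ρ D (P, s)) (hsr : s < r) (c : K) :
    reduceRows ρ r s P (D s) c r r ≠ 0 ∧
      (reduceRows ρ r s P (D s) c r r).natDegree = (ρ r r).natDegree + (D s - P) := by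
  have hlead : (X ^ (D s - P) * ρ r r).degree =
      (((ρ r r).natDegree + (D s - P) : ℕ) : WithBot ℕ) := by
    rw [degree_mul, degree_X_pow, degree_eq_natDegree hI.diag_ne, add_comm]
    rfl
  have hlow : (C c * X ^ (P - D s) * ρ s r).degree <
      (((ρ r r).natDegree + (D s - P) : ℕ) : WithBot ℕ) := by
    rw [degree_lt_iff_coeff_zero]
    intro e he
    by_contra hne
    rw [mul_assoc, coeff_C_mul, coeff_X_pow_mul', mul_ite, mul_zero, ← ne_eq,
      ite_ne_right_iff] at hne
    have := add_lt_add_of_relKey_lt hux (hI.cross s hsr _ (right_ne_zero_of_mul hne.2))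
    omega
  have hdeg : (reduceRows ρ r s P (D s) c r r).degree =
      (((ρ r r).natDegree + (D s - P) : ℕ) : WithBot ℕ) := by
    rw [reduceRows_self, Pi.sub_apply, Pi.smul_apply, Pi.smul_apply, smul_eq_mul, smul_eq_mul,
      degree_sub_eq_left_of_degree_lt (hlow.trans_eq hlead.symm), hlead]
  refine ⟨fun h => ?_, natDegree_eq_of_degree_eq_some hdeg⟩
  rw [h, degree_zero] at hdeg
  exact WithBot.bot_ne_coe hdeg

theorem monKey_lt_of_isLeadMon_reduceRows {P : ℕ} {s : Fin N} (hux : 0 < ux)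
    (hI : StageInv ux w r V D₀ δ₀ ρ D (P, s)) (hsr : s < r) {c : K} (hc : c ≠ 0)
    (hcoeff : c * (ρ s s).coeff (D s) = (ρ r s).coeff P) {p : ℕ × Fin N}
    (hp : IsLeadMon ux w (reduceRows ρ r s P (D s) c r) p) :
    monKey ux w p < monKey ux w (P + (D s - P), s) := by
  have hr := hI.diag.smul hux (pow_ne_zero (D s - P) (X_ne_zero (R := K)))
  have hs := (hI.lead s hsr).smul hux
    (mul_ne_zero (C_ne_zero.mpr hc) (pow_ne_zero (P - D s) (X_ne_zero (R := K))))
  rw [natDegree_X_pow] at hr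
  rw [natDegree_C_mul_X_pow _ _ hc, show D s + (P - D s) = P + (D s - P) by omega] at hs
  rw [reduceRows_self] at hp
  refine hr.monKey_lt_of_sub hux hs ?_ hp.1
  simp only [Pi.smul_apply, smul_eq_mul, mul_assoc, coeff_C_mul, coeff_X_pow_mul]
  rw [show P + (D s - P) = D s + (P - D s) by omega, coeff_X_pow_mul, hcoeff]

theorem exists_reduceRows {P : ℕ} {s : Fin N} (hux : 0 < ux)
    (hI : StageInv ux w r V D₀ δ₀ ρ D (P, s)) (hsr : s < r) {c : K} (hc : c ≠ 0)
    (hcoeff : c * (ρ s s).coeff (D s) = (ρ r s).coeff P) :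
    ∃ p, StageInv ux w r V D₀ δ₀ (reduceRows ρ r s P (D s) c)
        (Function.update D s (min P (D s))) p ∧
      relKey ux w r (reduceRows ρ r s P (D s) c r r).natDegree p <
        relKey ux w r (ρ r r).natDegree (P, s) := by
  obtain ⟨hdiag, hdeg⟩ := hI.diag_reduceRows hux hsr c
  obtain ⟨p, hp⟩ := exists_isLeadMon hux w (v := reduceRows ρ r s P (D s) c r)
    fun h => hdiag (congrFun h r)
  have hkey : relKey ux w r (reduceRows ρ r s P (D s) c r r).natDegree p <
      relKey ux w r (ρ r r).natDegree (P, s) := by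
    rw [hdeg, ← relKey_add_add r s _ P (D s - P), relKey_lt_relKey_iff]
    exact hI.monKey_lt_of_isLeadMon_reduceRows hux hsr hc hcoeff hp
  refine ⟨p, ⟨fun i hi => ?_, fun i hi j hj => ?_, by rw [span_reduceRows ρ hsr P _ hc, hI.span_eq],
    hdiag, hp, fun i hi d hd => hkey.trans_le ?_, fun i hi => ?_, ?_⟩, hkey⟩
  · obtain ⟨hrow, hD⟩ | ⟨rfl, -, hrow, hD⟩ := reduceRows_eq_or (s := s) ρ D P c hi.ne <;>
      rw [hrow, hD]
    exacts [hI.lead i hi, hI.diag]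
  · obtain rfl | hir := eq_or_ne i r
    · simp [reduceRows_self, hI.supp i le_rfl j hj, hI.supp s hsr.le j hj]
    · obtain ⟨hrow, -⟩ | ⟨-, -, hrow, -⟩ := reduceRows_eq_or (s := s) ρ D P c hir <;>
        rw [hrow]
      exacts [hI.supp i hi j hj, hI.supp r le_rfl j hj]
  · obtain ⟨hrow, hD⟩ | ⟨rfl, hlt, hrow, hD⟩ := reduceRows_eq_or (s := s) ρ D P c hi.ne <;>
      rw [hrow] at hd <;> rw [hD]
    · exact (hI.cross i hi d hd).le
    · exact relKey_antitone hux r (P, i) (le_natDegree_of_ne_zero hd)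
  · obtain ⟨hrow, hD⟩ | ⟨rfl, hlt, -, hD⟩ := reduceRows_eq_or (s := s) ρ D P c hi.ne
    · rw [hrow, hD]
      exact hI.drop i hi
    · rw [hD]
      have := hlt.trans_le (hI.drop i hi).1
      exact ⟨this.le, fun _ => this⟩
  · have hs := Finset.mem_Iio.mpr hsr
    rw [hdeg, ← hI.degree, Finset.sum_update_of_mem hs, ← Finset.add_sum_erase _ D hs,
      Finset.sdiff_singleton_eq_erase]
    omega

theorem weight_add_two_le (hI : StageInv ux w r V D₀ δ₀ ρ D p) (hux : 0 < ux) (hp : p.2 ≠ r)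
    {d : ℕ} (hd : (ρ p.2 r).coeff d ≠ 0) :
    monWeight ux w (d, r) + 2 ≤ monWeight ux w (D p.2, p.2) := by
  have hone := hI.one_le_relKey hux hp
  have hcross := hI.cross p.2 (lt_of_le_of_ne hI.le_of_diag hp) d hd
  simp only [relKey, ofLex_toLex, Prod.Lex.toLex_lt_toLex, lt_irrefl, and_false,
    or_false] at hone hcross
  omega

end StageInv

/-- Along an iteration with strictly decreasing keys every key in `L` is charged at most once. -/
theorem exists_iterate_of_decreasing_key {α κ : Type*} [LinearOrder κ] {f : α → α}
    {I : α → κ → Prop} {done : α → Prop} {mults : α → ℕ} {L : Finset κ} {cost : κ → ℕ}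
    (hstep : ∀ σ k, I σ k → ¬ done σ →
      k ∈ L ∧ mults (f σ) ≤ mults σ + cost k ∧ ∃ k' < k, I (f σ) k') (σ : α) (k : κ) (hI : I σ k) :
    ∃ T, (∃ k', I (f^[T] σ) k') ∧ done (f^[T] σ) ∧
      mults (f^[T] σ) ≤ mults σ + ∑ k' ∈ L with k' ≤ k, cost k' := by
  induction hc : (L.filter (· ≤ k)).card using Nat.strong_induction_on generalizing σ k with
  | _ c ih =>
    by_cases hdone : done σ
    · exact ⟨0, ⟨k, hI⟩, hdone, Nat.le_add_right _ _⟩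
    obtain ⟨hkL, hmults, k', hk', hI'⟩ := hstep σ k hI hdone
    have hk : k ∈ L.filter (· ≤ k) := Finset.mem_filter.mpr ⟨hkL, le_rfl⟩
    have hsub : L.filter (· ≤ k') ⊆ (L.filter (· ≤ k)).erase k := fun l hl => by
      rw [Finset.mem_filter] at hl
      have := hl.2.trans_lt hk'
      exact Finset.mem_erase.mpr ⟨this.ne, Finset.mem_filter.mpr ⟨hl.1, this.le⟩⟩
    have hcard := (Finset.card_le_card hsub).trans_lt (Finset.card_erase_lt_of_mem hk)
    obtain ⟨T, hT, hdoneT, hmultsT⟩ := ih _ (hc ▸ hcard) (f σ) k' hI' rfl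
    refine ⟨T + 1, hT, hdoneT, hmultsT.trans ?_⟩
    have hsum := Finset.sum_le_sum_of_subset (f := cost) hsub
    have := Finset.add_sum_erase _ cost hk
    omega

/-- The relative keys of the monomials of coordinates `s < r` and relative weight in
`(0, q * ux]`. -/
noncomputable def stageKeys (ux : ℤ) (w : Fin N → ℤ) (r : Fin N) (q : ℕ) : Finset (ℤ ×ₗ Fin N) :=
  (Finset.Iio r).biUnion fun s =>
    ((Finset.Ioc 0 (q * ux)).filter (· ≡ w s - w r [ZMOD ux])).image
      fun ε => toLex (ε, s)

theorem mem_stageKeys {r : Fin N} {q : ℕ} {k : ℤ ×ₗ Fin N} :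
    k ∈ stageKeys ux w r q ↔ ((ofLex k).2 < r ∧ 0 < (ofLex k).1 ∧ (ofLex k).1 ≤ q * ux) ∧
      (ofLex k).1 ≡ w (ofLex k).2 - w r [ZMOD ux] := by
  obtain ⟨k, rfl⟩ := toLex.surjective k
  simp only [stageKeys, Finset.mem_biUnion, Finset.mem_Iio, Finset.mem_image, Finset.mem_filter,
    Finset.mem_Ioc, toLex_inj, ofLex_toLex]
  constructor
  · rintro ⟨s, hs, ε, ⟨hε, hmod⟩, rfl⟩
    exact ⟨⟨hs, hε⟩, hmod⟩
  · rintro ⟨⟨hs, hε⟩, hmod⟩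
    exact ⟨k.2, hs, k.1, ⟨hε, hmod⟩, rfl⟩

theorem sum_stageKeys (hux : 0 < ux) (r : Fin N) (q : ℕ) (cost : Fin N → ℕ) :
    ∑ k ∈ stageKeys ux w r q, cost (ofLex k).2 = q * ∑ s ∈ Finset.Iio r, cost s := by
  have hcard (v : ℤ) : ((Finset.Ioc 0 (q * ux)).filter (· ≡ v [ZMOD ux])).card = q := by
    have hux' : (ux : ℚ) ≠ 0 := by exact_mod_cast hux.ne'
    have hfloor : ⌊((q * ux : ℤ) - v) / (ux : ℚ)⌋ = q + ⌊((0 : ℤ) - v) / (ux : ℚ)⌋ := by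
      rw [← Int.floor_natCast_add]
      congr 1
      push_cast
      field_simp
      ring
    zify
    rw [Int.Ioc_filter_modEq_card _ _ hux, hfloor, add_sub_cancel_right,
      max_eq_left (Int.natCast_nonneg q)]
  rw [stageKeys, Finset.sum_biUnion, Finset.mul_sum]
  · refine Finset.sum_congr rfl fun s _ => ?_
    rw [Finset.sum_image fun _ _ _ _ h => congrArg Prod.fst (toLex_inj.mp h)]
    simp only [ofLex_toLex, Finset.sum_const, smul_eq_mul, hcard]
  · intro s _ s' _ hss'
    refine Finset.disjoint_left.mpr fun k hk hk' => hss' ?_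
    obtain ⟨ε, -, rfl⟩ := Finset.mem_image.mp hk
    obtain ⟨ε', -, h⟩ := Finset.mem_image.mp hk'
    exact (congrArg Prod.snd (toLex_inj.mp h)).symm

/-- One step of the stage `r` with the pivot row `s` takes at most `c` multiplications, `D₀` being
the degree of the leading monomial of the pivot row at the beginning of the stage. The pivot row
`v` is subject to the constraints of `StageInv`. -/
def BoundsStepCost (K : Type*) [Field K] (ux : ℤ) (w : Fin N → ℤ) (r s : Fin N) (D₀ c : ℕ) :
    Prop :=
  ∀ (v : Fin N → K[X]) (D : ℕ), IsLeadMon ux w v (D, s) → D ≤ D₀ → (v r ≠ 0 → D < D₀) →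
    (∀ j, r < j → v j = 0) →
    (∀ d, (v r).coeff d ≠ 0 → monWeight ux w (d, r) + 2 ≤ monWeight ux w (D, s)) →
    1 + scaleCost v ≤ c

/-- The states of Algorithm G during the stage that treats row `r`, indexed by the relative key of
the leading monomial of row `r`. -/
def InStage (ux : ℤ) (w : Fin N → ℤ) (g : Fin N → Fin N → K[X]) (r : Fin N)
    (V : Submodule K[X] (Fin N → K[X])) (D₀ : Fin N → ℕ) (δ₀ q : ℕ) (σ : GState K N)
    (k : ℤ ×ₗ Fin N) : Prop :=
  σ.idx = r ∧ (∀ i, r < i → σ.rows i = g i) ∧ (ofLex k).1 ≤ q * ux ∧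
    ∃ D p, StageInv ux w r V D₀ δ₀ σ.rows D p ∧ relKey ux w r (σ.rows r r).natDegree p = k

theorem InStage.step (hux : 0 < ux) {g : Fin N → Fin N → K[X]} {r : Fin N}
    {V : Submodule K[X] (Fin N → K[X])} {D₀ : Fin N → ℕ} {δ₀ q : ℕ} {cost : Fin N → ℕ}
    (hcost : ∀ s < r, BoundsStepCost K ux w r s (D₀ s) (cost s))
    {σ : GState K N} {k : ℤ ×ₗ Fin N} (hσ : InStage ux w g r V D₀ δ₀ q σ k)
    (hdone : ¬ ∃ d, IsLeadMon ux w (σ.rows r) (d, r)) :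
    k ∈ stageKeys ux w r q ∧ (algGStep ux w σ).mults ≤ σ.mults + cost (ofLex k).2 ∧
      ∃ k' < k, InStage ux w g r V D₀ δ₀ q (algGStep ux w σ) k' := by
  obtain ⟨ρ, idx, μ⟩ := σ
  obtain ⟨rfl, hrest, hbound, D, ⟨P, s⟩, hI, rfl⟩ := hσ
  have hsr : s ≠ r := fun h => hdone ⟨P, h ▸ hI.diag⟩
  have hlt : s < r := lt_of_le_of_ne hI.le_of_diag hsr
  obtain ⟨c, hc, hcoeff, hstep⟩ := algGStep_of_lead_ne (μ := μ) hux hI.diag hsr (hI.lead s hlt)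
  obtain ⟨p, hI', hkey⟩ := hI.exists_reduceRows hux hlt hc hcoeff
  rw [hstep]
  refine ⟨mem_stageKeys.mpr ⟨⟨hlt, hI.one_le_relKey hux hsr, hbound⟩, ?_⟩,
    Nat.add_le_add_left (hcost s hlt _ _ (hI.lead s hlt) (hI.drop s hlt).1 (hI.drop s hlt).2
      (hI.supp s hlt.le) fun d => hI.weight_add_two_le hux hsr) μ,
    _, hkey, rfl, fun i hi => ?_, ?_, _, p, hI', rfl⟩
  · simp only [relKey, ofLex_toLex, monWeight, Int.modEq_iff_dvd]
    exact ⟨((ρ r r).natDegree : ℤ) - P, by ring⟩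
  · exact (reduceRows_of_ne ρ hi.ne' (hlt.trans hi).ne' P (D s) c).trans (hrest i hi)
  · exact (Prod.Lex.monotone_fst_ofLex hkey.le).trans hbound

theorem InStage.exists_iterate (hux : 0 < ux) {g : Fin N → Fin N → K[X]} {r : Fin N}
    {V : Submodule K[X] (Fin N → K[X])} {D₀ : Fin N → ℕ} {δ₀ q : ℕ} {cost : Fin N → ℕ}
    (hcost : ∀ s < r, BoundsStepCost K ux w r s (D₀ s) (cost s))
    {σ : GState K N} {k : ℤ ×ₗ Fin N} (hσ : InStage ux w g r V D₀ δ₀ q σ k) :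
    ∃ T ρ μ D d, (algGStep ux w)^[T] σ = ⟨ρ, r + 1, μ⟩ ∧
      StageInv ux w r V D₀ δ₀ ρ D (d, r) ∧ (∀ i, r < i → ρ i = g i) ∧
      μ ≤ σ.mults + q * ∑ s ∈ Finset.Iio r, cost s := by
  obtain ⟨T, ⟨k', hk'⟩, ⟨d, hd⟩, hmults⟩ := exists_iterate_of_decreasing_key
    (fun σ k hI hdone => InStage.step hux hcost hI hdone) σ k hσ
  obtain ⟨hidx, hrest, -, D, p, hI, -⟩ := hk'
  refine ⟨T + 1, _, _, D, d, ?_, hI.diag.unique hux hd ▸ hI, hrest, hmults.trans ?_⟩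
  · rw [Function.iterate_succ_apply', ← algGStep_of_lead_eq hux hd, ← hidx]
  · rw [← sum_stageKeys (w := w) hux]
    exact Nat.add_le_add_left (Finset.sum_le_sum_of_subset (Finset.filter_subset _ _)) _

/-- What holds before Algorithm G treats row `r`, after it has been started on the rows `g`. -/
structure RunInv (ux : ℤ) (w : Fin N → ℤ) (g : Fin N → Fin N → K[X]) (r : ℕ)
    (ρ : Fin N → Fin N → K[X]) (D : Fin N → ℕ) : Prop where
  lead : ∀ i : Fin N, (i : ℕ) < r → IsLeadMon ux w (ρ i) (D i, i)
  supp : ∀ i : Fin N, (i : ℕ) < r → ∀ j : Fin N, r ≤ j → ρ i j = 0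
  rest : ∀ i : Fin N, r ≤ i → ρ i = g i
  span_eq : Submodule.span K[X] (ρ '' {i | (i : ℕ) < r}) =
    Submodule.span K[X] (g '' {i | (i : ℕ) < r})
  degree : ∑ i with Fin.val i < r, D i = ∑ i with Fin.val i < r, (g i i).natDegree

namespace RunInv

variable {g ρ : Fin N → Fin N → K[X]} {D : Fin N → ℕ} {r : Fin N}

theorem setOf_val_lt (r : Fin N) : {i : Fin N | (i : ℕ) < r} = Set.Iio r := rfl

theorem setOf_val_lt_succ (r : Fin N) : {i : Fin N | (i : ℕ) < (r : ℕ) + 1} = Set.Iic r :=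
  Set.ext fun _ => Nat.lt_succ_iff

theorem stageInv (hI : RunInv ux w g r ρ D) (hind : ∀ s, HasInd (g s) s) {p : ℕ × Fin N}
    (hp : IsLeadMon ux w (g r) p) :
    StageInv ux w r (Submodule.span K[X] (g '' Set.Iic r)) D (g r r).natDegree ρ D p := by
  have hr : ρ r = g r := hI.rest r le_rfl
  have hzero : ∀ i < r, ρ i r = 0 := fun i hi => hI.supp i hi r le_rfl
  refine ⟨hI.lead, fun i hi j hj => ?_, ?_, hr ▸ (hind r).1, hr ▸ hp,
    fun i hi d hd => absurd (by rw [hzero i hi, coeff_zero]) hd,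
    fun i hi => ⟨le_rfl, fun h => absurd (hzero i hi) h⟩, by rw [hr]⟩
  · obtain hlt | rfl := hi.lt_or_eq
    · exact hI.supp i hlt j hj.le
    · exact hr ▸ (hind i).2 j hj
  · have hspan := hI.span_eq
    rw [setOf_val_lt] at hspan
    rw [← Set.Iio_insert, Set.image_insert_eq, Set.image_insert_eq, Submodule.span_insert,
      Submodule.span_insert, hspan, hr]

theorem succ (hI : RunInv ux w g r ρ D) {ρ' : Fin N → Fin N → K[X]} {D' : Fin N → ℕ} {d : ℕ}
    (hI' : StageInv ux w r (Submodule.span K[X] (g '' Set.Iic r)) D (g r r).natDegree ρ' D' (d, r))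
    (hrest : ∀ i, r < i → ρ' i = g i) (hux : 0 < ux) :
    RunInv ux w g (r + 1) ρ' (Function.update D' r d) := by
  have hdeg := hI'.degree
  have hIio : Finset.univ.filter (fun i : Fin N => (i : ℕ) < r) = Finset.Iio r := by ext; simp
  have hIic : Finset.univ.filter (fun i : Fin N => (i : ℕ) < r + 1) =
      insert r (Finset.Iio r) := by
    ext i; simp [le_iff_eq_or_lt, Fin.ext_iff]
  refine ⟨fun i hi => ?_, fun i hi j hj => hI'.supp i (Nat.lt_succ_iff.mp hi) j hj,
    fun i hi => hrest i hi, by rw [setOf_val_lt_succ, hI'.span_eq], ?_⟩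
  · obtain hlt | heq := (Nat.lt_succ_iff.mp hi).lt_or_eq
    · rw [Function.update_of_ne (Fin.ne_of_lt hlt)]
      exact hI'.lead i hlt
    · rw [Fin.ext heq, Function.update_self]
      exact hI'.diag
  · have hD := hI.degree
    rw [hIio] at hD
    rw [hIic, Finset.sum_insert Finset.notMem_Iio_self, Finset.sum_insert Finset.notMem_Iio_self,
      Function.update_self, Finset.sum_update_of_notMem Finset.notMem_Iio_self, ← hD]
    rw [show (ρ' r r).natDegree = d from hI'.diag.natDegree_eq hux] at hdeg
    omega

end RunInv

/-- Stage `r` of Algorithm G; `D` holds the degrees of the leading monomials before the stage. -/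
theorem RunInv.exists_iterate (hux : 0 < ux) {g ρ : Fin N → Fin N → K[X]} {D : Fin N → ℕ}
    {r : Fin N} (hI : RunInv ux w g r ρ D) (hind : ∀ s, HasInd (g s) s) {q : ℕ}
    (hq : ∀ p, (g r p.2).coeff p.1 ≠ 0 →
      monWeight ux w p ≤ monWeight ux w ((g r r).natDegree, r) + q * ux) {cost : Fin N → ℕ}
    (hcost : ∀ s < r, BoundsStepCost K ux w r s (D s) (cost s)) (μ : ℕ) :
    ∃ T ρ' D' μ', (algGStep ux w)^[T] ⟨ρ, r, μ⟩ = ⟨ρ', r + 1, μ'⟩ ∧ RunInv ux w g (r + 1) ρ' D' ∧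
      μ' ≤ μ + q * ∑ s ∈ Finset.Iio r, cost s := by
  obtain ⟨p, hp⟩ := exists_isLeadMon hux w (v := g r) fun h => (hind r).1 (congrFun h r)
  have hr : ρ r = g r := hI.rest r le_rfl
  have hσ : InStage ux w g r (Submodule.span K[X] (g '' Set.Iic r)) D (g r r).natDegree q
      ⟨ρ, r, μ⟩ (relKey ux w r (ρ r r).natDegree p) :=
    ⟨rfl, fun i hi => hI.rest i hi.le, by
      have := hq p hp.1
      rw [hr, relKey, ofLex_toLex]
      linarith, D, p, hI.stageInv hind hp, rfl⟩
  obtain ⟨T, ρ', μ', D', d, hT, hI', hrest, hμ'⟩ := hσ.exists_iterate hux hcost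
  exact ⟨T, ρ', _, μ', hT, hI.succ hI' hrest hux, hμ'⟩

theorem RunInv.le_of_isLeadMon (hux : 0 < ux) {g ρ : Fin N → Fin N → K[X]} {D : Fin N → ℕ}
    {r : Fin N} (hI : RunInv ux w g r ρ D) {v : Fin N → K[X]}
    (hv : v ∈ Submodule.span K[X] (g '' Set.Iio r)) {e : ℕ} {s : Fin N}
    (hlead : IsLeadMon ux w v (e, s)) : D s ≤ e := by
  rw [← setOf_val_lt, ← hI.span_eq] at hv
  obtain ⟨i, -, e', he', hlead'⟩ := exists_isLeadMon_of_mem_span hux hI.lead hv hlead.ne_zero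
  obtain ⟨rfl, rfl⟩ := Prod.ext_iff.mp (hlead.unique hux hlead')
  exact he'

theorem exists_iterate_runInv (hux : 0 < ux) {g : Fin N → Fin N → K[X]}
    (hind : ∀ s, HasInd (g s) s) {q : Fin N → ℕ}
    (hq : ∀ r p, (g r p.2).coeff p.1 ≠ 0 →
      monWeight ux w p ≤ monWeight ux w ((g r r).natDegree, r) + q r * ux)
    {cost : Fin N → Fin N → ℕ → ℕ}
    (hcost : ∀ r, ∀ s < r, ∀ D, BoundsStepCost K ux w r s D (cost r s D)) (r : ℕ) (hr : r ≤ N) :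
    ∃ T ρ, ∃ D : ℕ → Fin N → ℕ, ∃ μ,
      (algGStep ux w)^[T] ⟨g, 0, 0⟩ = ⟨ρ, r, μ⟩ ∧ RunInv ux w g r ρ (D r) ∧
      (∀ i : Fin N, i < r → ∃ ρ, RunInv ux w g i ρ (D i)) ∧
      μ ≤ ∑ i with Fin.val i < r, q i * ∑ s ∈ Finset.Iio i, cost i s (D i s) := by
  induction r with
  | zero =>
    exact ⟨0, g, 0, 0, rfl, ⟨by simp, by simp, fun _ _ => rfl, rfl, by simp⟩, by simp,
      Nat.zero_le _⟩
  | succ r ih =>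
    obtain ⟨T, ρ, D, μ, hT, hI, hD, hμ⟩ := ih (Nat.le_of_succ_le hr)
    obtain ⟨T', ρ', D', μ', hT', hI', hμ'⟩ := hI.exists_iterate (r := ⟨r, hr⟩) hux hind (hq _)
      (fun s hs => hcost _ s hs _) μ
    have hne {i : ℕ} (hi : i < r + 1) : Function.update D (r + 1) D' i = D i :=
      Function.update_of_ne hi.ne ..
    refine ⟨T' + T, ρ', Function.update D (r + 1) D', μ', ?_, ?_, fun i hi => ?_, ?_⟩
    · rw [Function.iterate_add_apply, hT, hT']
    · rwa [Function.update_self]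
    · rw [hne hi]
      obtain hlt | heq := (Nat.lt_succ_iff.mp hi).lt_or_eq
      · exact hD i hlt
      · exact heq ▸ ⟨ρ, hI⟩
    · have hIic : Finset.univ.filter (fun i : Fin N => (i : ℕ) < r + 1) =
          insert ⟨r, hr⟩ (Finset.univ.filter fun i : Fin N => (i : ℕ) < r) := by
        ext i; simp [le_iff_eq_or_lt, Fin.ext_iff]
      have hsum : ∑ i with Fin.val i < r, q i * ∑ s ∈ Finset.Iio i,
          cost i s (Function.update D (r + 1) D' i s) =
          ∑ i with Fin.val i < r, q i * ∑ s ∈ Finset.Iio i, cost i s (D i s) :=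
        Finset.sum_congr rfl fun i hi => by
          rw [hne (Nat.lt_succ_of_lt (Finset.mem_filter.mp hi).2)]
      rw [hIic, Finset.sum_insert (by simp), hsum, hne r.lt_succ_self, add_comm]
      exact hμ'.trans (Nat.add_le_add_right hμ _)

/-- The degrees `D r s` are those of the leading monomials at the beginning of stage `r`; the first
two properties are what bounds them. -/
theorem exists_algGHaltsWith (hux : 0 < ux) {g : Fin N → Fin N → K[X]}
    (hind : ∀ s, HasInd (g s) s) {q : Fin N → ℕ}
    (hq : ∀ r p, (g r p.2).coeff p.1 ≠ 0 →
      monWeight ux w p ≤ monWeight ux w ((g r r).natDegree, r) + q r * ux)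
    {cost : Fin N → Fin N → ℕ → ℕ}
    (hcost : ∀ r, ∀ s < r, ∀ D, BoundsStepCost K ux w r s D (cost r s D)) :
    ∃ τ, AlgGHaltsWith ux w g τ ∧
      IsMinimalGroebnerBasis ux w (Submodule.span K[X] (Set.range g) : Set (Fin N → K[X])) τ.rows ∧
      ∃ D : Fin N → Fin N → ℕ,
        (∀ r, ∑ s ∈ Finset.Iio r, D r s = ∑ s ∈ Finset.Iio r, (g s s).natDegree) ∧
        (∀ r, ∀ s < r, ∀ v ∈ Submodule.span K[X] (g '' Set.Iio r), ∀ e,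
          IsLeadMon ux w v (e, s) → D r s ≤ e) ∧
        τ.mults ≤ ∑ r, q r * ∑ s ∈ Finset.Iio r, cost r s (D r s) := by
  obtain ⟨T, ρ, D, μ, hT, hI, hD, hμ⟩ :=
    exists_iterate_runInv hux hind hq hcost N le_rfl
  refine ⟨⟨ρ, N, μ⟩, ⟨le_rfl, T, hT⟩, ?_, fun i => D i, fun r => ?_, fun r s _ v hv e he => ?_, ?_⟩
  · have huniv : {i : Fin N | (i : ℕ) < N} = Set.univ := Set.eq_univ_of_forall Fin.is_lt
    have hspan := hI.span_eq
    rw [huniv, Set.image_univ, Set.image_univ] at hspan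
    exact hspan ▸ isMinimalGroebnerBasis_span_range hux fun i => hI.lead i i.2
  · obtain ⟨ρ', hI'⟩ := hD r r.2
    have hdegree := hI'.degree
    have hIio : Finset.univ.filter (fun i : Fin N => (i : ℕ) < r) = Finset.Iio r := by ext; simp
    rwa [hIio] at hdegree
  · obtain ⟨ρ', hI'⟩ := hD r r.2
    exact hI'.le_of_isLeadMon hux hv he
  · simpa only [Fin.is_lt, Finset.filter_true] using hμ

theorem mem_span_of_hasInd {g : Fin N → Fin N → K[X]} {S : Submodule K[X] (Fin N → K[X])}
    (hg : ∀ s, g s ∈ S) (hind : ∀ s, HasInd (g s) s)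
    (hdvd : ∀ v ∈ S, ∀ s, HasInd v s → g s s ∣ v s) (r : ℕ) {v : Fin N → K[X]} (hvS : v ∈ S)
    (hv : ∀ j : Fin N, r ≤ j → v j = 0) :
    v ∈ Submodule.span K[X] (g '' {i : Fin N | (i : ℕ) < r}) := by
  induction r generalizing v with
  | zero => exact (funext fun j => hv j (Nat.zero_le _) : v = 0) ▸ Submodule.zero_mem _
  | succ r ih =>
    have hmono : Submodule.span K[X] (g '' {i : Fin N | (i : ℕ) < r}) ≤
        Submodule.span K[X] (g '' {i : Fin N | (i : ℕ) < r + 1}) :=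
      Submodule.span_mono (Set.image_mono fun i hi => Nat.lt_succ_of_lt hi)
    by_cases h0 : ∀ j : Fin N, r ≤ j → v j = 0
    · exact hmono (ih hvS h0)
    push Not at h0
    obtain ⟨s, hs, hs0⟩ := h0
    obtain rfl : (s : ℕ) = r := le_antisymm (not_lt.mp fun h => hs0 (hv s h)) hs
    obtain ⟨a, ha⟩ := hdvd v hvS s ⟨hs0, hv⟩
    have hsub : v - a • g s ∈ Submodule.span K[X] (g '' {i : Fin N | (i : ℕ) < s}) := by
      refine ih (S.sub_mem hvS (S.smul_mem _ (hg s))) fun j hj => ?_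
      obtain rfl | hjs := eq_or_ne s j
      · rw [Pi.sub_apply, Pi.smul_apply, smul_eq_mul, ha, mul_comm, sub_self]
      · have hlt : s < j := lt_of_le_of_ne hj hjs
        rw [Pi.sub_apply, Pi.smul_apply, hv j hlt, (hind s).2 j hlt, smul_zero, sub_zero]
    have hgs : g s ∈ Submodule.span K[X] (g '' {i : Fin N | (i : ℕ) < s + 1}) :=
      Submodule.subset_span ⟨s, Nat.lt_succ_self _, rfl⟩
    exact (Submodule.sub_mem_iff_left _ (Submodule.smul_mem _ a hgs)).mp (hmono hsub)

theorem span_range_eq_of_hasInd {g : Fin N → Fin N → K[X]} {S : Submodule K[X] (Fin N → K[X])}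
    (hg : ∀ s, g s ∈ S) (hind : ∀ s, HasInd (g s) s)
    (hdvd : ∀ v ∈ S, ∀ s, HasInd v s → g s s ∣ v s) :
    Submodule.span K[X] (Set.range g) = S :=
  le_antisymm (Submodule.span_le.mpr (Set.range_subset_iff.mpr hg)) fun _ hv =>
    Submodule.span_mono (Set.image_subset_range _ _)
      (mem_span_of_hasInd hg hind hdvd N hv fun j hj => absurd j.2 hj.not_gt)

end AlgorithmG

section Curves

variable {K F : Type*} [Field K] [Field F] [Algebra K F]

section Valuations

variable {v : AddValuation F (WithTop ℤ)} {x y z : F} {a b : ℤ}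

theorem exists_val_eq (v : AddValuation F (WithTop ℤ)) (hz : z ≠ 0) :
    ∃ k : ℤ, v z = (k : WithTop ℤ) := by
  obtain ⟨k, hk⟩ := WithTop.ne_top_iff_exists.mp (v.ne_top_iff.mpr hz)
  exact ⟨k, hk.symm⟩

theorem ne_zero_of_val_eq (h : v z = (a : WithTop ℤ)) : z ≠ 0 := by
  rintro rfl
  simp at h

theorem le_val_mul (hx : (a : WithTop ℤ) ≤ v x) (hy : (b : WithTop ℤ) ≤ v y) :
    ((a + b : ℤ) : WithTop ℤ) ≤ v (x * y) := by
  rw [v.map_mul, WithTop.coe_add]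
  exact add_le_add hx hy

theorem val_mul_eq (hx : v x = (a : WithTop ℤ)) (hy : v y = (b : WithTop ℤ)) :
    v (x * y) = ((a + b : ℤ) : WithTop ℤ) := by
  rw [v.map_mul, hx, hy, WithTop.coe_add]

theorem le_val_pow (hx : (a : WithTop ℤ) ≤ v x) (n : ℕ) :
    ((n * a : ℤ) : WithTop ℤ) ≤ v (x ^ n) := by
  rw [v.map_pow, ← nsmul_eq_mul, WithTop.coe_nsmul]
  exact nsmul_le_nsmul_right hx n

theorem val_pow_eq (hx : v x = (a : WithTop ℤ)) (n : ℕ) :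
    v (x ^ n) = ((n * a : ℤ) : WithTop ℤ) := by
  rw [v.map_pow, hx, ← nsmul_eq_mul, WithTop.coe_nsmul]

theorem val_prod_eq {ι : Type*} {s : Finset ι} {f : ι → F} {k : ι → ℤ}
    (h : ∀ i ∈ s, v (f i) = (k i : WithTop ℤ)) :
    v (∏ i ∈ s, f i) = ((∑ i ∈ s, k i : ℤ) : WithTop ℤ) := by
  classical
  induction s using Finset.induction_on with
  | empty => simp
  | insert i s hi ih =>
    rw [Finset.prod_insert hi, Finset.sum_insert hi]
    exact val_mul_eq (h i (Finset.mem_insert_self _ _))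
      (ih fun j hj => h j (Finset.mem_insert_of_mem hj))

theorem le_val_div (hx : (a : WithTop ℤ) ≤ v x) (hy : v y = (b : WithTop ℤ)) :
    ((a - b : ℤ) : WithTop ℤ) ≤ v (x / y) := by
  rcases eq_or_ne x 0 with rfl | hx0
  · simp
  obtain ⟨k, hk⟩ := exists_val_eq v hx0
  rw [hk, WithTop.coe_le_coe] at hx
  rw [v.map_div, hk, hy, ← WithTop.LinearOrderedAddCommGroup.coe_sub, WithTop.coe_le_coe]
  exact sub_le_sub_right hx b

theorem val_sum_eq_inf {ι : Type*} {s : Finset ι} {f : ι → F}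
    (hf : Set.InjOn (fun i => v (f i)) s) : v (∑ i ∈ s, f i) = s.inf fun i => v (f i) := by
  classical
  induction s using Finset.induction_on with
  | empty => simp
  | insert i s hi ih =>
    rw [Finset.coe_insert, Set.injOn_insert (by exact_mod_cast hi)] at hf
    rw [Finset.sum_insert hi, Finset.inf_insert, ← ih hf.1]
    rcases s.eq_empty_or_nonempty with rfl | hs
    · simp
    · refine v.map_add_of_distinct_val fun heq => hf.2 ?_
      obtain ⟨j, hj, hinf⟩ := Finset.exists_mem_eq_inf s hs fun i => v (f i)
      exact ⟨j, hj, hinf.symm.trans ((ih hf.1).symm.trans heq.symm)⟩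

end Valuations

theorem Place.val_algebraMap_mul (P : Place K F) {c : K} (hc : c ≠ 0) (z : F) :
    P.val (algebraMap K F c * z) = P.val z := by
  rw [AddValuation.map_mul, P.val_const c hc, zero_add]

theorem linearIndependent_of_injective_val {ι : Type*} {P : Place K F} {f : ι → F}
    (h0 : ∀ i, f i ≠ 0) (hinj : Function.Injective fun i => P.val (f i)) :
    LinearIndependent K f := by
  rw [linearIndependent_iff]
  intro c hc
  have hval : ∀ i ∈ c.support, P.val (c i • f i) = P.val (f i) := fun i hi => by
    rw [Algebra.smul_def, P.val_algebraMap_mul (Finsupp.mem_support_iff.mp hi)]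
  have hinf := val_sum_eq_inf (v := P.val) (s := c.support) (f := fun i => c i • f i)
    fun i hi j hj hij => hinj (by simpa only [hval i hi, hval j hj] using hij)
  rw [Finsupp.linearCombination_apply, Finsupp.sum] at hc
  rw [hc, AddValuation.map_zero] at hinf
  rw [← Finsupp.support_eq_empty, Finset.eq_empty_iff_forall_notMem]
  intro i hi
  have htop := hinf.le.trans (Finset.inf_le hi)
  rw [hval i hi, top_le_iff, AddValuation.top_iff] at htop
  exact h0 i htop

section PoleSpaces

variable {G : Divisor K F} {Q : Place K F} {z : F}

theorem mem_poleSpace :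
    z ∈ poleSpace G Q ↔ ∀ P ≠ Q, ((-(G P) : ℤ) : WithTop ℤ) ≤ P.val z := by
  classical
  rw [poleSpace, Set.mem_iUnion]
  constructor
  · rintro ⟨i, hi⟩ P hP
    simpa only [Finsupp.add_apply, Finsupp.single_eq_of_ne hP, add_zero] using hi P
  · intro h
    obtain ⟨i, hi⟩ : ∃ i : ℕ, ((-(G Q + i) : ℤ) : WithTop ℤ) ≤ Q.val z := by
      rcases eq_or_ne z 0 with rfl | hz
      · exact ⟨0, by simp⟩
      obtain ⟨k, hk⟩ := exists_val_eq Q.val hz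
      refine ⟨(-k - G Q).toNat, ?_⟩
      rw [hk, WithTop.coe_le_coe]
      have := Int.self_le_toNat (-k - G Q)
      omega
    refine ⟨i, fun P => ?_⟩
    rcases eq_or_ne P Q with rfl | hP
    · rwa [Finsupp.add_apply, Finsupp.single_eq_same]
    · rw [Finsupp.add_apply, Finsupp.single_eq_of_ne hP, add_zero]
      exact h P hP

theorem mem_regularAway : z ∈ regularAway Q ↔ ∀ P ≠ Q, 0 ≤ P.val z := by
  simp only [regularAway, mem_poleSpace, Finsupp.zero_apply, neg_zero, WithTop.coe_zero]

/-- The ring `L(∞Q)` of the functions that are regular away from `Q`, as a `K`-algebra. -/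
def regularRing (Q : Place K F) : Subalgebra K F where
  carrier := regularAway Q
  mul_mem' := by
    intro x y hx hy
    rw [mem_regularAway] at *
    intro P hP
    rw [AddValuation.map_mul]
    exact add_nonneg (hx P hP) (hy P hP)
  add_mem' := by
    intro x y hx hy
    rw [mem_regularAway] at *
    exact fun P hP => (le_min (hx P hP) (hy P hP)).trans (P.val.map_add x y)
  algebraMap_mem' c := mem_regularAway.mpr fun P _ => P.val_const_nonneg c

theorem mem_regularRing : z ∈ regularRing Q ↔ ∀ P ≠ Q, 0 ≤ P.val z := mem_regularAway

theorem mem_rrSpace_single {i : ℤ} :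
    z ∈ rrSpace (Finsupp.single Q i) ↔
      z ∈ regularRing Q ∧ ((-i : ℤ) : WithTop ℤ) ≤ Q.val z := by
  classical
  rw [mem_regularRing]
  constructor
  · intro h
    refine ⟨fun P hP => ?_, by simpa only [Finsupp.single_eq_same] using h Q⟩
    simpa only [Finsupp.single_eq_of_ne hP, neg_zero, WithTop.coe_zero] using h P
  · rintro ⟨hreg, hQ⟩ P
    rcases eq_or_ne P Q with rfl | hP
    · rwa [Finsupp.single_eq_same]
    · rw [Finsupp.single_eq_of_ne hP, neg_zero]
      exact hreg P hP

theorem rrSpace_single_mono (Q : Place K F) :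
    Monotone fun i : ℤ => rrSpace (Finsupp.single Q i) := by
  intro i j hij z hz
  rw [mem_rrSpace_single] at *
  exact ⟨hz.1, le_trans (WithTop.coe_le_coe.mpr (neg_le_neg hij)) hz.2⟩

theorem mem_rrSpace_single_sub_one {i : ℤ} :
    z ∈ rrSpace (Finsupp.single Q (i - 1)) ↔
      z ∈ regularRing Q ∧ ((-i : ℤ) : WithTop ℤ) < Q.val z := by
  rw [mem_rrSpace_single, and_congr_right_iff]
  intro _
  rcases eq_or_ne z 0 with rfl | hz
  · simp only [AddValuation.map_zero, le_top, WithTop.coe_lt_top]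
  obtain ⟨k, hk⟩ := exists_val_eq Q.val hz
  rw [hk, WithTop.coe_le_coe, WithTop.coe_lt_coe]
  omega

end PoleSpaces

section DegreeOne

variable {P : Place K F} {x z : F}

theorem exists_const_of_degree_one (hP : P.degree = 1) (hz : 0 ≤ P.val z) :
    ∃ c : K, 0 < P.val (z - algebraMap K F c) := by
  let residue (w : P.valRing) : P.valRing ⧸ P.maxIdeal.submoduleOf P.valRing :=
    Submodule.Quotient.mk w
  have one_mem : (1 : F) ∈ P.valRing := (P.val.map_one).ge
  have residue_one_ne_zero : residue ⟨1, one_mem⟩ ≠ 0 := by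
    rw [Ne, Submodule.Quotient.mk_eq_zero]
    change ¬ 0 < P.val 1
    simp
  obtain ⟨c, hc⟩ :=
    (finrank_eq_one_iff_of_nonzero' _ residue_one_ne_zero).mp hP (residue ⟨z, hz⟩)
  rw [← Submodule.Quotient.mk_smul, eq_comm, Submodule.Quotient.eq] at hc
  have hpos : 0 < P.val (z - c • (1 : F)) := hc
  exact ⟨c, by rwa [Algebra.smul_def, mul_one] at hpos⟩

theorem exists_lt_val_sub_const_mul (hP : P.degree = 1) (hz : z ≠ 0) (hxz : P.val z ≤ P.val x) :
    ∃ c : K, P.val z < P.val (x - algebraMap K F c * z) := by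
  obtain ⟨k, hk⟩ := exists_val_eq P.val hz
  have hdiv : 0 ≤ P.val (x / z) := by
    have := le_val_div (hk ▸ hxz) hk
    rwa [sub_self] at this
  obtain ⟨c, hc⟩ := exists_const_of_degree_one hP hdiv
  have hfactor : x - algebraMap K F c * z = (x / z - algebraMap K F c) * z := by
    rw [sub_mul, div_mul_cancel₀ _ hz]
  refine ⟨c, ?_⟩
  rw [hfactor, AddValuation.map_mul]
  simpa only [zero_add] using
    WithTop.add_lt_add_right (P.val.ne_top_iff.mpr hz) hc

end DegreeOne

section Genus

theorem divDegree_single (Q : Place K F) (i : ℤ) :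
    divDegree (Finsupp.single Q i) = i * Q.degree :=
  Finsupp.sum_single_index (zero_mul _)

theorem divDegree_add (A B : Divisor K F) : divDegree (A + B) = divDegree A + divDegree B := by
  classical
  exact Finsupp.sum_add_index (fun _ _ => zero_mul _) fun _ _ _ _ => add_mul _ _ _

theorem divDegree_sum {ι : Type*} (s : Finset ι) (A : ι → Divisor K F) :
    divDegree (∑ i ∈ s, A i) = ∑ i ∈ s, divDegree (A i) := by
  classical
  induction s using Finset.induction_on with
  | empty => rfl
  | insert a s ha ih => rw [Finset.sum_insert ha, Finset.sum_insert ha, divDegree_add, ih]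

variable {g : ℕ} {Q : Place K F}

theorem divDegree_sub_finrank_le_genus (hg : genus K F = (g : ℕ∞)) (A : Divisor K F) :
    divDegree A - (Module.finrank K (rrSpace A) : ℤ) + 1 ≤ g := by
  have hle : (((divDegree A - (Module.finrank K (rrSpace A) : ℤ) + 1).toNat : ℕ) : ℕ∞) ≤ g :=
    hg ▸ le_iSup (fun A : Divisor K F =>
      (((divDegree A - (Module.finrank K (rrSpace A) : ℤ) + 1).toNat : ℕ) : ℕ∞)) A
  exact (Int.self_le_toNat _).trans (Int.ofNat_le.mpr (Nat.cast_le.mp hle))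

theorem finiteDimensional_rrSpace_single (hg : genus K F = (g : ℕ∞)) (hQ : Q.degree = 1)
    (i : ℤ) : FiniteDimensional K (rrSpace (Finsupp.single Q i)) := by
  have : FiniteDimensional K (rrSpace (Finsupp.single Q (max i g))) := by
    refine Module.finite_of_finrank_pos ?_
    have := divDegree_sub_finrank_le_genus hg (Finsupp.single Q (max i g))
    rw [divDegree_single, hQ] at this
    omega
  exact Submodule.finiteDimensional_of_le (rrSpace_single_mono Q (le_max_left i g))

theorem val_nonpos_of_mem_regularRing (hg : genus K F = (g : ℕ∞)) (hQ : Q.degree = 1)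
    {z : F} (hz : z ∈ regularRing Q) (hz0 : z ≠ 0) : Q.val z ≤ 0 := by
  by_contra hpos
  obtain ⟨k, hk⟩ := exists_val_eq Q.val hz0
  have hk0 : 0 < k := by
    rw [not_le, hk] at hpos
    exact_mod_cast hpos
  -- otherwise the powers of `z` are independent elements of the finite-dimensional `L(0)`
  have pow_mem : ∀ e : ℕ, z ^ e ∈ rrSpace (Finsupp.single Q 0) := fun e => by
    rw [mem_rrSpace_single, val_pow_eq hk, neg_zero]
    exact ⟨pow_mem hz e, by exact_mod_cast mul_nonneg e.cast_nonneg hk0.le⟩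
  have pow_independent : LinearIndependent K fun e : ℕ => z ^ e := by
    refine linearIndependent_of_injective_val (P := Q) (fun e => pow_ne_zero e hz0) ?_
    intro d e hde
    simp only [val_pow_eq hk, WithTop.coe_inj] at hde
    exact_mod_cast mul_right_cancel₀ hk0.ne' hde
  have := finiteDimensional_rrSpace_single hg hQ 0
  have pow_independent' : LinearIndependent K
      fun e : ℕ => (⟨z ^ e, pow_mem e⟩ : rrSpace (Finsupp.single Q 0)) :=
    LinearIndependent.of_comp (rrSpace (Finsupp.single Q 0)).subtype pow_independent
  have hfinite := pow_independent'.finite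
  exact not_finite ℕ

theorem exists_mem_weierstrass_val_eq (hg : genus K F = (g : ℕ∞)) (hQ : Q.degree = 1)
    {z : F} (hz : z ∈ regularRing Q) (hz0 : z ≠ 0) :
    ∃ s ∈ weierstrass Q, Q.val z = ((-(s : ℤ) : ℤ) : WithTop ℤ) := by
  obtain ⟨k, hk⟩ := exists_val_eq Q.val hz0
  have hk0 : k ≤ 0 := by
    have := val_nonpos_of_mem_regularRing hg hQ hz hz0
    rw [hk] at this
    exact_mod_cast this
  obtain ⟨s, rfl⟩ : ∃ s : ℕ, k = -(s : ℤ) := ⟨(-k).toNat, by omega⟩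
  exact ⟨s, ⟨z, hz, hk⟩, hk⟩

theorem rrSpace_single_le_of_notMem_weierstrass {i : ℕ} (hi : i ∉ weierstrass Q) :
    rrSpace (Finsupp.single Q (i : ℤ)) ≤ rrSpace (Finsupp.single Q ((i : ℤ) - 1)) := by
  intro z hz
  rw [mem_rrSpace_single] at hz
  rw [mem_rrSpace_single_sub_one]
  exact ⟨hz.1, hz.2.lt_of_ne fun h => hi ⟨z, hz.1, h.symm⟩⟩

theorem rrSpace_single_le_sup_span (hQ : Q.degree = 1) {i : ℤ} {x : F} (hx : x ∈ regularRing Q)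
    (hxi : Q.val x = ((-i : ℤ) : WithTop ℤ)) :
    rrSpace (Finsupp.single Q i) ≤
      rrSpace (Finsupp.single Q (i - 1)) ⊔ Submodule.span K {x} := by
  intro z hz
  rw [mem_rrSpace_single, ← hxi] at hz
  obtain ⟨c, hc⟩ := exists_lt_val_sub_const_mul hQ (ne_zero_of_val_eq hxi) hz.2
  rw [hxi, ← Algebra.smul_def] at hc
  have hsub : z - c • x ∈ rrSpace (Finsupp.single Q (i - 1)) :=
    mem_rrSpace_single_sub_one.mpr ⟨sub_mem hz.1 (Subalgebra.smul_mem _ hx c), hc⟩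
  have hmem := Submodule.add_mem_sup hsub
    (Submodule.smul_mem _ c (Submodule.mem_span_singleton_self x))
  rwa [sub_add_cancel] at hmem

theorem finrank_rrSpace_single_le (hQ : Q.degree = 1) {i : ℤ} {x : F} (hx : x ∈ regularRing Q)
    (hxi : Q.val x = ((-i : ℤ) : WithTop ℤ))
    [FiniteDimensional K (rrSpace (Finsupp.single Q (i - 1)))] :
    Module.finrank K (rrSpace (Finsupp.single Q i)) ≤
      Module.finrank K (rrSpace (Finsupp.single Q (i - 1))) + 1 :=
  calc Module.finrank K (rrSpace (Finsupp.single Q i))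
      ≤ Module.finrank K ↥(rrSpace (Finsupp.single Q (i - 1)) ⊔ Submodule.span K {x}) :=
        Submodule.finrank_mono (rrSpace_single_le_sup_span hQ hx hxi)
    _ ≤ Module.finrank K (rrSpace (Finsupp.single Q (i - 1))) +
          Module.finrank K (Submodule.span K {x}) :=
        Submodule.finrank_add_le_finrank_add_finrank _ _
    _ = _ := by rw [finrank_span_singleton (ne_zero_of_val_eq hxi)]

open Classical in
theorem finrank_rrSpace_single_le_count (hg : genus K F = (g : ℕ∞)) (hQ : Q.degree = 1) (i : ℕ) :
    Module.finrank K (rrSpace (Finsupp.single Q ((i : ℤ) - 1))) ≤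
      Nat.count (· ∈ weierstrass Q) i := by
  induction i with
  | zero =>
    have hbot : rrSpace (Finsupp.single Q (((0 : ℕ) : ℤ) - 1)) = ⊥ := by
      rw [eq_bot_iff]
      intro z hz
      rw [mem_rrSpace_single_sub_one] at hz
      by_contra hz0
      exact hz.2.not_ge (val_nonpos_of_mem_regularRing hg hQ hz.1 hz0)
    rw [hbot, finrank_bot]
    exact Nat.zero_le _
  | succ i ih =>
    have := finiteDimensional_rrSpace_single hg hQ ((i : ℤ) - 1)
    rw [Nat.count_succ, Nat.cast_succ, add_sub_cancel_right]
    split_ifs with hi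
    · obtain ⟨x, hx, hxi⟩ := hi
      exact (finrank_rrSpace_single_le hQ hx hxi).trans (Nat.add_le_add_right ih 1)
    · exact (Submodule.finrank_mono (rrSpace_single_le_of_notMem_weierstrass hi)).trans ih

theorem finite_compl_weierstrass (hg : genus K F = (g : ℕ∞)) (hQ : Q.degree = 1) :
    (weierstrass Q)ᶜ.Finite := by
  classical
  by_contra hinf
  obtain ⟨t, ht, hcard⟩ := (Set.not_finite.mp hinf).exists_subset_card_eq (g + 1)
  obtain ⟨i, hi⟩ := t.exists_nat_subset_range
  have hgaps : g + 1 ≤ Nat.count (· ∉ weierstrass Q) i := by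
    rw [← hcard, Nat.count_eq_card_filter_range]
    exact Finset.card_le_card fun s hs => Finset.mem_filter.mpr ⟨hi hs, ht hs⟩
  have hcount : Nat.count (· ∈ weierstrass Q) i + Nat.count (· ∉ weierstrass Q) i = i := by
    simp only [Nat.count_eq_card_filter_range, Finset.card_filter_add_card_filter_not,
      Finset.card_range]
  have hgenus := divDegree_sub_finrank_le_genus hg (Finsupp.single Q ((i : ℤ) - 1))
  have hdim := finrank_rrSpace_single_le_count hg hQ i
  rw [divDegree_single, hQ] at hgenus
  omega

theorem residueMin_spec (hg : genus K F = (g : ℕ∞)) (hQ : Q.degree = 1) {a : ℕ} (ha : 0 < a)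
    (j : ℕ) : residueMin Q a j ∈ weierstrass Q ∧ residueMin Q a j ≡ j [MOD a] := by
  suffices hne : {s | s ∈ weierstrass Q ∧ s ≡ j [MOD a]}.Nonempty from Nat.sInf_mem hne
  have hinj : Function.Injective fun k : ℕ => a * k + j := fun k l hkl =>
    Nat.eq_of_mul_eq_mul_left ha (Nat.add_right_cancel hkl)
  obtain ⟨_, ⟨k, rfl⟩, hk⟩ := (Set.infinite_range_of_injective hinj).exists_notMem_finite
    (finite_compl_weierstrass hg hQ)
  exact ⟨a * k + j, not_not.mp hk, by simp [Nat.ModEq]⟩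

theorem residueMin_le {a j s : ℕ} (hs : s ∈ weierstrass Q) (hsj : s ≡ j [MOD a]) :
    residueMin Q a j ≤ s :=
  Nat.sInf_le ⟨hs, hsj⟩

end Genus

end Curves

section MinExponent

variable {t : ℕ} {a : Fin t → ℕ} {s : ℕ}

theorem finite_setOf_wdeg_eq (ha : ∀ i, 0 < a i) (s : ℕ) : {e | wdeg a e = s}.Finite := by
  refine (Set.finite_Iic fun _ => s).subset fun e he i => ?_
  calc e i ≤ a i * e i := Nat.le_mul_of_pos_left _ (ha i)
    _ ≤ wdeg a e :=
      Finset.single_le_sum (f := fun i => a i * e i) (fun _ _ => Nat.zero_le _) (Finset.mem_univ i)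
    _ = s := he

theorem exists_wdeg_eq (hs : s ∈ AddSubmonoid.closure (Set.range a)) : ∃ e, wdeg a e = s := by
  classical
  induction hs using AddSubmonoid.closure_induction with
  | mem x hx =>
    obtain ⟨i, rfl⟩ := hx
    exact ⟨Pi.single i 1, by simp [wdeg, Pi.single_apply]⟩
  | zero => exact ⟨0, by simp [wdeg]⟩
  | add x y _ _ hx hy =>
    obtain ⟨e, rfl⟩ := hx
    obtain ⟨e', rfl⟩ := hy
    exact ⟨e + e', by simp [wdeg, mul_add, Finset.sum_add_distrib]⟩

theorem exists_isMinExponent (ha : ∀ i, 0 < a i) (hs : ∃ e, wdeg a e = s) :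
    ∃ e, IsMinExponent a s e := by
  obtain ⟨e, he, hmax⟩ := (finite_setOf_wdeg_eq ha s).exists_maximalFor
    (fun e => (toLex e : Lex (Fin t → ℕ))) _ hs
  rw [Set.mem_ofPred_eq] at he
  refine ⟨e, he, fun e' he' => ?_⟩
  rcases lt_or_ge (toLex e') (toLex e) with ⟨i, heq, hlt⟩ | hle
  · exact Or.inr (Or.inr ⟨he.trans he'.symm, i, fun j hj => (heq j hj).symm, hlt⟩)
  · exact Or.inl (toLex.injective (le_antisymm (hmax he' hle) hle))

theorem wdeg_minExponent (ha : ∀ i, 0 < a i) (hs : s ∈ AddSubmonoid.closure (Set.range a)) :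
    wdeg a (minExponent a s) = s := by
  have h := exists_isMinExponent ha (exists_wdeg_eq hs)
  rw [minExponent, dif_pos h]
  exact h.choose_spec.1

end MinExponent

section Curves

variable {K F : Type*} [Field K] [Field F] [Algebra K F]

theorem Place.val_aeval {P : Place K F} {x : F} {a : ℕ} (ha : 0 < a)
    (hx : P.val x = ((-(a : ℤ) : ℤ) : WithTop ℤ)) {p : K[X]} (hp : p ≠ 0) :
    P.val (aeval x p) = ((-((a : ℤ) * p.natDegree) : ℤ) : WithTop ℤ) := by
  have hterm : ∀ e ∈ p.support, P.val (algebraMap K F (p.coeff e) * x ^ e) =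
      ((-((a : ℤ) * e) : ℤ) : WithTop ℤ) := fun e he => by
    rw [P.val_algebraMap_mul (mem_support_iff.mp he), val_pow_eq hx, mul_neg, mul_comm]
  have hinj : Set.InjOn (fun e => P.val (algebraMap K F (p.coeff e) * x ^ e)) p.support := by
    intro i hi j hj hij
    simp only [hterm i hi, hterm j hj, WithTop.coe_inj, neg_inj] at hij
    exact_mod_cast mul_left_cancel₀ (by exact_mod_cast ha.ne') hij
  rw [aeval_def, eval₂_eq_sum, Polynomial.sum, val_sum_eq_inf hinj]
  have hdeg := natDegree_mem_support_of_nonzero hp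
  refine le_antisymm ((Finset.inf_le hdeg).trans (hterm _ hdeg).le) (Finset.le_inf fun e he => ?_)
  rw [hterm e he, WithTop.coe_le_coe, neg_le_neg_iff]
  exact mul_le_mul_of_nonneg_left (by exact_mod_cast le_natDegree_of_mem_supp e he) a.cast_nonneg

theorem aeval_mem_regularRing {Q : Place K F} {x : F} (hx : x ∈ regularRing Q) (p : K[X]) :
    aeval x p ∈ regularRing Q :=
  Algebra.adjoin_le (Set.singleton_subset_iff.mpr hx) (aeval_mem_adjoin_singleton K x)

namespace HasPoleDivisor

variable {Q : Place K F} {z : F} {a : ℕ}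

theorem mem_regularRing (h : HasPoleDivisor z (Finsupp.single Q (a : ℤ))) :
    z ∈ regularRing Q := by
  classical
  refine AGInterp.mem_regularRing.mpr fun P hP => ?_
  have := h P
  rwa [Finsupp.single_eq_of_ne hP, neg_zero, WithTop.coe_zero, min_eq_right_iff] at this

theorem val_eq (ha : 0 < a) (h : HasPoleDivisor z (Finsupp.single Q (a : ℤ))) :
    Q.val z = ((-(a : ℤ) : ℤ) : WithTop ℤ) := by
  classical
  have hmin := h Q
  rw [Finsupp.single_eq_same] at hmin
  rcases min_choice (Q.val z) 0 with hz | hz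
  · rw [← hmin, hz]
  · rw [hz] at hmin
    norm_cast at hmin
    omega

end HasPoleDivisor

theorem poleOrder_eq {Q : Place K F} {z : F} {k : ℤ} (h : Q.val z = ((-k : ℤ) : WithTop ℤ)) :
    poleOrder Q z = k := by
  rw [poleOrder, h, WithTop.untopD_coe, neg_neg]

/-- Functions `x₁` and `y_0, …, y_{a-1}` in `L(∞Q)`, with pole orders `a` and `b_j`, where `b_j` is
the least pole order that is congruent to `j` modulo `a`. This is what makes the `y_j` a basis of
`L(∞Q)` over `K[x₁]`. The index `j` may be any natural number. -/
structure IsPoleBasis (Q : Place K F) (a : ℕ) (x₁ : F) (y : ℕ → F) (b : ℕ → ℕ) : Prop where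
  deg : Q.degree = 1
  pole : ∀ z ∈ regularRing Q, z ≠ 0 →
    ∃ s ∈ weierstrass Q, Q.val z = ((-(s : ℤ) : ℤ) : WithTop ℤ)
  pos : 0 < a
  x_mem : x₁ ∈ regularRing Q
  x_val : Q.val x₁ = ((-(a : ℤ) : ℤ) : WithTop ℤ)
  y_mem : ∀ j, y j ∈ regularRing Q
  y_val : ∀ j, Q.val (y j) = ((-(b j : ℤ) : ℤ) : WithTop ℤ)
  b_mod : ∀ j, b j ≡ j [MOD a]
  b_min : ∀ j, ∀ s ∈ weierstrass Q, s ≡ j [MOD a] → b j ≤ s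

theorem isPoleBasis_basisElt {g : ℕ} {Q : Place K F} (hg : genus K F = (g : ℕ∞))
    (hQ : Q.degree = 1) {t : ℕ} {a : Fin (t + 1) → ℕ} (ha : ∀ i, 0 < a i)
    (hgen : (AddSubmonoid.closure (Set.range a) : Set ℕ) = weierstrass Q)
    {x : Fin (t + 1) → F} (hx : ∀ i, HasPoleDivisor (x i) (Finsupp.single Q (a i : ℤ))) :
    IsPoleBasis Q (a 0) (x 0) (basisElt Q a x) (residueMin Q (a 0)) where
  deg := hQ
  pole _ := exists_mem_weierstrass_val_eq hg hQ
  pos := ha 0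
  x_mem := (hx 0).mem_regularRing
  x_val := (hx 0).val_eq (ha 0)
  y_mem _ := prod_mem fun i _ => pow_mem (hx i).mem_regularRing _
  y_val j := by
    have hmem : residueMin Q (a 0) j ∈ AddSubmonoid.closure (Set.range a) := by
      rw [← SetLike.mem_coe, hgen]
      exact (residueMin_spec hg hQ (ha 0) j).1
    rw [basisElt, val_prod_eq fun i _ => val_pow_eq ((hx i).val_eq (ha i)) _, WithTop.coe_inj]
    conv_rhs => rw [← wdeg_minExponent ha hmem, wdeg]
    push_cast
    rw [← Finset.sum_neg_distrib]
    exact Finset.sum_congr rfl fun i _ => by ring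
  b_mod j := (residueMin_spec hg hQ (ha 0) j).2
  b_min _ _ := residueMin_le

/-- The combination `∑ p_j(x₁) y_j`, as a linear function of its coordinates `p_j`. -/
noncomputable def comb (a : ℕ) (x₁ : F) (y : ℕ → F) : (Fin a → K[X]) →ₗ[K] F where
  toFun p := ∑ j : Fin a, aeval x₁ (p j) * y j
  map_add' p q := by simp only [Pi.add_apply, map_add, add_mul, Finset.sum_add_distrib]
  map_smul' c p := by
    simp only [Pi.smul_apply, map_smul, smul_mul_assoc, Finset.smul_sum, RingHom.id_apply]

theorem comb_apply (a : ℕ) (x₁ : F) (y : ℕ → F) (p : Fin a → K[X]) :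
    comb a x₁ y p = ∑ j : Fin a, aeval x₁ (p j) * y j :=
  rfl

theorem comb_single {a : ℕ} (x₁ : F) (y : ℕ → F) (j : Fin a) (p : K[X]) :
    comb a x₁ y (Pi.single j p) = aeval x₁ p * y j := by
  rw [comb_apply, Finset.sum_eq_single_of_mem j (Finset.mem_univ j), Pi.single_eq_same]
  intro k _ hk
  rw [Pi.single_eq_of_ne hk, map_zero, zero_mul]

namespace IsPoleBasis

variable {Q : Place K F} {a : ℕ} {x₁ : F} {y : ℕ → F} {b : ℕ → ℕ}

theorem val_aeval_mul (h : IsPoleBasis Q a x₁ y b) {p : K[X]} (hp : p ≠ 0) (j : ℕ) :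
    Q.val (aeval x₁ p * y j) = ((-((a : ℤ) * p.natDegree + b j) : ℤ) : WithTop ℤ) := by
  rw [val_mul_eq (Place.val_aeval h.pos h.x_val hp) (h.y_val j), neg_add]

theorem eq_of_add_eq (h : IsPoleBasis Q a x₁ y b) {i j : Fin a} {d e : ℕ}
    (hij : a * d + b i = a * e + b j) : i = j := by
  have hmod : b i ≡ b j [MOD a] := by
    simpa only [Nat.ModEq, Nat.mul_add_mod] using congrArg (· % a) hij
  have := ((h.b_mod i).symm.trans hmod).trans (h.b_mod j)
  rw [Nat.ModEq, Nat.mod_eq_of_lt i.2, Nat.mod_eq_of_lt j.2] at this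
  exact Fin.ext this

theorem val_comb_le (h : IsPoleBasis Q a x₁ y b) {p : Fin a → K[X]} {j : Fin a} (hj : p j ≠ 0) :
    Q.val (comb a x₁ y p) ≤ ((-((a : ℤ) * (p j).natDegree + b j) : ℤ) : WithTop ℤ) := by
  classical
  have hinj : Set.InjOn (fun i : Fin a => Q.val (aeval x₁ (p i) * y i))
      (Finset.univ.filter fun i => p i ≠ 0) := by
    intro i hi k hk hik
    simp only [Finset.coe_filter, Finset.mem_univ, true_and, Set.mem_ofPred_eq] at hi hk
    simp only [h.val_aeval_mul hi, h.val_aeval_mul hk, WithTop.coe_inj, neg_inj] at hik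
    exact h.eq_of_add_eq (by exact_mod_cast hik)
  rw [comb_apply, ← Finset.sum_filter_of_ne (p := fun i => p i ≠ 0), val_sum_eq_inf hinj]
  · exact (Finset.inf_le (Finset.mem_filter.mpr ⟨Finset.mem_univ j, hj⟩)).trans
      (h.val_aeval_mul hj j).le
  · intro i _ hi hpi
    rw [hpi, map_zero, zero_mul] at hi
    exact hi rfl

theorem comb_injective (h : IsPoleBasis Q a x₁ y b) :
    Function.Injective (comb (K := K) a x₁ y) := by
  rw [injective_iff_map_eq_zero]
  intro p hp
  funext j
  by_contra hj
  have := h.val_comb_le hj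
  rw [hp, AddValuation.map_zero, top_le_iff] at this
  exact WithTop.coe_ne_top this

theorem exists_val_pow_mul_eq (h : IsPoleBasis Q a x₁ y b) {s : ℕ} (hs : s ∈ weierstrass Q) :
    ∃ (e : ℕ) (j : Fin a), Q.val (x₁ ^ e * y j) = ((-(s : ℤ) : ℤ) : WithTop ℤ) := by
  have hle : b (s % a) ≤ s := h.b_min _ s hs (Nat.mod_modEq s a).symm
  obtain ⟨e, he⟩ := (Nat.modEq_iff_dvd' hle).mp ((h.b_mod _).trans (Nat.mod_modEq s a))
  refine ⟨e, ⟨s % a, Nat.mod_lt s h.pos⟩, ?_⟩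
  rw [val_mul_eq (val_pow_eq h.x_val e) (h.y_val _), WithTop.coe_inj]
  have : (s : ℤ) - b (s % a) = a * e := by
    rw [← Nat.cast_sub hle, he, Nat.cast_mul]
  linarith

theorem exists_comb_eq (h : IsPoleBasis Q a x₁ y b) {z : F} (hz : z ∈ regularRing Q) :
    ∃ p : Fin a → K[X], comb a x₁ y p = z := by
  rcases eq_or_ne z 0 with rfl | hz0
  · exact ⟨0, map_zero _⟩
  obtain ⟨s, hs, hsz⟩ := h.pole z hz hz0
  induction s using Nat.strong_induction_on generalizing z with | _ s ih =>
  obtain ⟨e, j, hej⟩ := h.exists_val_pow_mul_eq hs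
  obtain ⟨c, hc⟩ :=
    exists_lt_val_sub_const_mul h.deg (ne_zero_of_val_eq hej) (hej.trans hsz.symm).le
  obtain ⟨p, hp⟩ :
      ∃ p : Fin a → K[X], comb a x₁ y p = z - algebraMap K F c * (x₁ ^ e * y j) := by
    rcases eq_or_ne (z - algebraMap K F c * (x₁ ^ e * y j)) 0 with h0 | h0
    · exact ⟨0, by rw [map_zero, h0]⟩
    have hmem : z - algebraMap K F c * (x₁ ^ e * y j) ∈ regularRing Q :=
      sub_mem hz (mul_mem (Subalgebra.algebraMap_mem _ c)
        (mul_mem (pow_mem h.x_mem e) (h.y_mem j)))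
    obtain ⟨s', hs', hval⟩ := h.pole _ hmem h0
    refine ih s' ?_ hmem h0 hs' hval
    rw [hej, hval, WithTop.coe_lt_coe] at hc
    omega
  refine ⟨p + Pi.single j (C c * X ^ e), ?_⟩
  rw [map_add, hp, comb_single, map_mul, map_pow, aeval_C, aeval_X, mul_assoc, sub_add_cancel]

end IsPoleBasis

section SimpleZeros

variable {n : ℕ} {P : Fin n → Place K F}

theorem sum_single_apply_self (hP : Function.Injective P) (k : Fin n) :
    (∑ i, Finsupp.single (P i) (1 : ℤ)) (P k) = 1 := by
  classical
  rw [Finsupp.finsetSum_apply, Finset.sum_eq_single_of_mem k (Finset.mem_univ k),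
    Finsupp.single_eq_same]
  exact fun i _ hi => Finsupp.single_eq_of_ne fun h => hi (hP h.symm)

theorem sum_single_apply_of_ne {P' : Place K F} (hP' : ∀ i, P i ≠ P') :
    (∑ i, Finsupp.single (P i) (1 : ℤ)) P' = 0 := by
  classical
  rw [Finsupp.finsetSum_apply]
  exact Finset.sum_eq_zero fun i _ => Finsupp.single_eq_of_ne (hP' i).symm

theorem divDegree_smul_sum_single (hP : ∀ i, (P i).degree = 1) (e : ℤ) :
    divDegree (e • ∑ i, Finsupp.single (P i) (1 : ℤ)) = e * n := by
  simp only [Finset.smul_sum, divDegree_sum, Finsupp.smul_single, divDegree_single, hP,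
    smul_eq_mul, mul_one, Nat.cast_one, Finset.sum_const, Finset.card_univ, Fintype.card_fin,
    nsmul_eq_mul, mul_comm]

variable {Q : Place K F} {f z : F}

theorem mem_poleSpace_neg_smul_sum (hP : Function.Injective P) (hPQ : ∀ i, P i ≠ Q) {i : ℕ} :
    z ∈ poleSpace (-((i : ℤ) • ∑ k, Finsupp.single (P k) (1 : ℤ))) Q ↔
      z ∈ regularRing Q ∧ ∀ k, ((i : ℤ) : WithTop ℤ) ≤ (P k).val z := by
  simp only [mem_poleSpace, mem_regularRing, Finsupp.neg_apply, neg_neg, Finsupp.smul_apply,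
    smul_eq_mul]
  constructor
  · intro h
    have hzeros : ∀ k, ((i : ℤ) : WithTop ℤ) ≤ (P k).val z := fun k => by
      simpa only [sum_single_apply_self hP, mul_one] using h (P k) (hPQ k)
    refine ⟨fun P' hP' => ?_, hzeros⟩
    by_cases hk : ∃ k, P k = P'
    · obtain ⟨k, rfl⟩ := hk
      exact le_trans (by exact_mod_cast i.cast_nonneg) (hzeros k)
    · push Not at hk
      simpa only [sum_single_apply_of_ne hk, mul_zero, WithTop.coe_zero] using h P' hP'
  · rintro ⟨hreg, hzeros⟩ P' hP'
    by_cases hk : ∃ k, P k = P'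
    · obtain ⟨k, rfl⟩ := hk
      simpa only [sum_single_apply_self hP, mul_one] using hzeros k
    · push Not at hk
      simpa only [sum_single_apply_of_ne hk, mul_zero, WithTop.coe_zero] using hreg P' hP'

/-- `f` is regular away from `Q` and has the zero divisor `P_1 + ⋯ + P_n` away from `Q`. -/
structure HasSimpleZeros (Q : Place K F) {n : ℕ} (P : Fin n → Place K F) (f : F) : Prop where
  mem : f ∈ regularRing Q
  val_one : ∀ i, (P i).val f = ((1 : ℤ) : WithTop ℤ)
  val_zero : ∀ P' ≠ Q, (∀ i, P i ≠ P') → P'.val f = ((0 : ℤ) : WithTop ℤ)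
  ne_zero : f ≠ 0

theorem hasSimpleZeros_of_hasZeroDivisor (hP : Function.Injective P) (hPQ : ∀ i, P i ≠ Q)
    (hf : f ∈ regularRing Q) (hfD : HasZeroDivisor f (∑ i, Finsupp.single (P i) (1 : ℤ))) :
    HasSimpleZeros Q P f where
  mem := hf
  val_one i := by
    rw [← sum_single_apply_self hP i, ← hfD (P i),
      max_eq_left (mem_regularRing.mp hf _ (hPQ i))]
  val_zero P' hP' hne := by
    rw [← sum_single_apply_of_ne hne, ← hfD P', max_eq_left (mem_regularRing.mp hf _ hP')]
  ne_zero := by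
    rintro rfl
    have h := hfD Q
    rw [AddValuation.map_zero, max_eq_left le_top] at h
    exact WithTop.top_ne_coe h

namespace HasSimpleZeros

theorem le_val_pow_mul (hf : HasSimpleZeros Q P f) (hPQ : ∀ i, P i ≠ Q) (hz : z ∈ regularRing Q)
    (i : ℕ) (k : Fin n) : ((i : ℤ) : WithTop ℤ) ≤ (P k).val (f ^ i * z) := by
  have hz' : ((0 : ℤ) : WithTop ℤ) ≤ (P k).val z := mem_regularRing.mp hz _ (hPQ k)
  simpa only [mul_one, add_zero] using le_val_mul (val_pow_eq (hf.val_one k) i).ge hz'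

theorem div_pow_mem (hf : HasSimpleZeros Q P f) {i : ℕ} (hz : z ∈ regularRing Q)
    (hzP : ∀ k, ((i : ℤ) : WithTop ℤ) ≤ (P k).val z) : z / f ^ i ∈ regularRing Q := by
  rw [mem_regularRing] at *
  intro P' hP'
  by_cases hk : ∃ k, P k = P'
  · obtain ⟨k, rfl⟩ := hk
    simpa only [mul_one, sub_self, WithTop.coe_zero] using
      le_val_div (hzP k) (val_pow_eq (hf.val_one k) i)
  · push Not at hk
    have hz' : ((0 : ℤ) : WithTop ℤ) ≤ P'.val z := hz P' hP'
    simpa only [mul_zero, sub_self, WithTop.coe_zero] using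
      le_val_div hz' (val_pow_eq (hf.val_zero P' hP' hk) i)

variable {g : ℕ} {p : ℤ}

/-- Division by `f ^ e` embeds the space into `L(0) = K`. -/
theorem finrank_rrSpace_le_one (hf : HasSimpleZeros Q P f) (hP : Function.Injective P)
    (hPQ : ∀ i, P i ≠ Q) (hg : genus K F = (g : ℕ∞)) (hQ : Q.degree = 1)
    (hp : Q.val f = ((-p : ℤ) : WithTop ℤ)) (e : ℕ) :
    Module.finrank K (rrSpace (-((e : ℤ) • ∑ i, Finsupp.single (P i) (1 : ℤ)) +
      Finsupp.single Q (e * p))) ≤ 1 := by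
  classical
  have := finiteDimensional_rrSpace_single hg hQ 0
  calc Module.finrank K (rrSpace _)
      ≤ Module.finrank K
          ((rrSpace (Finsupp.single Q 0)).map (LinearMap.mulLeft K (f ^ e))) :=
        Submodule.finrank_mono fun z hz => ?_
    _ ≤ Module.finrank K (rrSpace (Finsupp.single Q (0 : ℤ))) := Submodule.finrank_map_le _ _
    _ ≤ 1 := by
      simpa using (finrank_rrSpace_single_le_count hg hQ 1).trans (Nat.count_le (p := _))
  have hpole : z ∈ poleSpace (-((e : ℤ) • ∑ k, Finsupp.single (P k) (1 : ℤ))) Q :=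
    mem_poleSpace.mpr fun P' hP' => by
      simpa only [Finsupp.add_apply, Finsupp.single_eq_of_ne hP', add_zero] using hz P'
  rw [mem_poleSpace_neg_smul_sum hP hPQ] at hpole
  refine ⟨z / f ^ e, mem_rrSpace_single.mpr ⟨hf.div_pow_mem hpole.1 hpole.2, ?_⟩,
    mul_div_cancel₀ z (pow_ne_zero e hf.ne_zero)⟩
  have hzQ := hz Q
  simp only [Finsupp.add_apply, Finsupp.single_eq_same, Finsupp.neg_apply, Finsupp.smul_apply,
    sum_single_apply_of_ne hPQ, smul_zero, neg_zero, zero_add] at hzQ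
  have hdiv := le_val_div hzQ (val_pow_eq hp e)
  rwa [mul_neg, sub_self, ← neg_zero] at hdiv

theorem poleOrder_le (hf : HasSimpleZeros Q P f) (hP : Function.Injective P)
    (hPQ : ∀ i, P i ≠ Q) (hPdeg : ∀ i, (P i).degree = 1) (hg : genus K F = (g : ℕ∞))
    (hQ : Q.degree = 1) (hp : Q.val f = ((-p : ℤ) : WithTop ℤ)) : p ≤ n := by
  by_contra! hlt
  obtain ⟨e, he⟩ : ∃ e : ℕ, e = g + 1 := ⟨_, rfl⟩
  have hdim := hf.finrank_rrSpace_le_one hP hPQ hg hQ hp e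
  have hgenus := divDegree_sub_finrank_le_genus hg
    (-((e : ℤ) • ∑ i, Finsupp.single (P i) (1 : ℤ)) + Finsupp.single Q (e * p))
  have hdeg : divDegree (-((e : ℤ) • ∑ i, Finsupp.single (P i) (1 : ℤ)) +
      Finsupp.single Q (e * p)) = e * (p - n) := by
    rw [divDegree_add, divDegree_single, hQ, ← neg_smul, divDegree_smul_sum_single hPdeg]
    push_cast
    ring
  have hle : (e : ℤ) * 1 ≤ e * (p - n) := mul_le_mul_of_nonneg_left (by omega) e.cast_nonneg
  omega

end HasSimpleZeros

theorem IsPoleBasis.isMinPole {a : ℕ} {x₁ : F} {y : ℕ → F} {b : ℕ → ℕ}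
    (hB : IsPoleBasis Q a x₁ y b) (hP : Function.Injective P) (hPQ : ∀ i, P i ≠ Q)
    (hf : HasSimpleZeros Q P f) {d : ℕ} (hfd : Q.val f = ((-(a * d : ℤ) : ℤ) : WithTop ℤ))
    (i j : ℕ) :
    IsMinPole (-((i : ℤ) • ∑ k, Finsupp.single (P k) (1 : ℤ))) Q a j (f ^ i * y j) := by
  have val_pow_mul {z : F} {s : ℕ} (hz : Q.val z = ((-(s : ℤ) : ℤ) : WithTop ℤ)) :
      Q.val (f ^ i * z) = ((-(a * (i * d) + s : ℤ) : ℤ) : WithTop ℤ) := by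
    rw [val_mul_eq (val_pow_eq hfd i) hz, WithTop.coe_inj]
    ring
  have add_modEq (s : ℕ) : (a * (i * d) + s : ℤ) ≡ s [ZMOD a] := Int.modEq_iff_dvd.mpr
    ⟨-(i * d), by ring⟩
  refine ⟨(mem_poleSpace_neg_smul_sum hP hPQ).mpr ⟨mul_mem (pow_mem hf.mem i) (hB.y_mem j),
    hf.le_val_pow_mul hPQ (hB.y_mem j) i⟩, ne_zero_of_val_eq (val_pow_mul (hB.y_val j)), ?_,
    fun ζ hζ hζ0 hζj => ?_⟩
  · rw [poleOrder_eq (val_pow_mul (hB.y_val j))]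
    exact (add_modEq _).trans (Int.natCast_modEq_iff.mpr (hB.b_mod j))
  · rw [mem_poleSpace_neg_smul_sum hP hPQ] at hζ
    have hfi : f ^ i ≠ 0 := pow_ne_zero i hf.ne_zero
    obtain ⟨s, hs, hsv⟩ := hB.pole _ (hf.div_pow_mem hζ.1 hζ.2) (div_ne_zero hζ0 hfi)
    have hζv := val_pow_mul hsv
    rw [mul_div_cancel₀ _ hfi] at hζv
    rw [poleOrder_eq hζv] at hζj ⊢
    rw [poleOrder_eq (val_pow_mul (hB.y_val j))]
    have hsj : s ≡ j [MOD a] := Int.natCast_modEq_iff.mp ((add_modEq s).symm.trans hζj)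
    have := hB.b_min j s hs hsj
    omega

end SimpleZeros

section Coordinates

variable {a N : ℕ}

/-- The coordinates of `v` that belong to the power `Z ^ k`, in the numbering of `ofCoords`. -/
noncomputable def block (a : ℕ) (v : Fin N → K[X]) (k : ℕ) (j : Fin a) : K[X] :=
  if h : (j : ℕ) + a * k < N then v ⟨j + a * k, h⟩ else 0

theorem block_div_mod (ha : 0 < a) (v : Fin N → K[X]) (i : Fin N) :
    block a v (i / a) ⟨i % a, Nat.mod_lt _ ha⟩ = v i := by
  have h : (i : ℕ) % a + a * (i / a) = i := Nat.mod_add_div _ _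
  simp only [block, h, i.2, dif_pos, Fin.eta]

theorem coeff_ofCoords (ha : 0 < a) (x₁ : F) (y : ℕ → F) (v : Fin N → K[X]) (k : ℕ) :
    (ofCoords a x₁ y v).coeff k = comb a x₁ y (block a v k) := by
  classical
  simp only [ofCoords, finsetSum_coeff, coeff_C_mul_X_pow]
  rw [comb_apply, ← Finset.sum_filter,
    ← Finset.sum_filter_of_ne (p := fun j : Fin a => (j : ℕ) + a * k < N)]
  · refine Finset.sum_bij' (fun i _ => ⟨i % a, Nat.mod_lt _ ha⟩)
      (fun j hj => ⟨j + a * k, (Finset.mem_filter.mp hj).2⟩) ?_ ?_ ?_ ?_ ?_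
    · rintro i hi
      obtain rfl := (Finset.mem_filter.mp hi).2
      simp only [Finset.mem_filter, Finset.mem_univ, true_and, Nat.mod_add_div, i.2]
    · rintro j -
      simp only [Finset.mem_filter, Finset.mem_univ, true_and, Nat.add_mul_div_left _ _ ha,
        Nat.div_eq_of_lt j.2, zero_add]
    · rintro i hi
      obtain rfl := (Finset.mem_filter.mp hi).2
      simp only [Nat.mod_add_div, Fin.eta]
    · rintro j -
      simp only [Nat.add_mul_mod_self_left, Nat.mod_eq_of_lt j.2, Fin.eta]
    · rintro i hi
      obtain rfl := (Finset.mem_filter.mp hi).2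
      rw [block_div_mod ha]
  · intro j _ hj
    by_contra hlt
    rw [block, dif_neg hlt, map_zero, zero_mul] at hj
    exact hj rfl

theorem ofCoords_zero (a : ℕ) (x₁ : F) (y : ℕ → F) :
    ofCoords a x₁ y (0 : Fin N → K[X]) = 0 := by
  simp only [ofCoords, Pi.zero_apply, map_zero, zero_mul, Finset.sum_const_zero]

theorem ofCoords_add (a : ℕ) (x₁ : F) (y : ℕ → F) (v v' : Fin N → K[X]) :
    ofCoords a x₁ y (v + v') = ofCoords a x₁ y v + ofCoords a x₁ y v' := by
  simp only [ofCoords, Pi.add_apply, map_add, add_mul, Finset.sum_add_distrib]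

theorem ofCoords_smul (a : ℕ) (x₁ : F) (y : ℕ → F) (p : K[X]) (v : Fin N → K[X]) :
    ofCoords a x₁ y (p • v) = C (aeval x₁ p) * ofCoords a x₁ y v := by
  simp only [ofCoords, Pi.smul_apply, smul_eq_mul, map_mul, Finset.mul_sum, mul_assoc]

theorem ofCoords_single (a : ℕ) (x₁ : F) (y : ℕ → F) (s : Fin N) (p : K[X]) :
    ofCoords a x₁ y (Pi.single s p) = C (aeval x₁ p * y (s % a)) * X ^ ((s : ℕ) / a) := by
  rw [ofCoords, Finset.sum_eq_single_of_mem s (Finset.mem_univ s), Pi.single_eq_same]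
  intro i _ hi
  rw [Pi.single_eq_of_ne hi, map_zero, zero_mul, C_0, zero_mul]

theorem natDegree_ofCoords_le (x₁ : F) (y : ℕ → F) {v : Fin N → K[X]} {k : ℕ}
    (hv : ∀ i : Fin N, k < (i : ℕ) / a → v i = 0) : (ofCoords a x₁ y v).natDegree ≤ k := by
  refine natDegree_sum_le_of_forall_le _ _ fun i _ => ?_
  rcases le_or_gt ((i : ℕ) / a) k with hi | hi
  · exact (natDegree_C_mul_X_pow_le _ _).trans hi
  · rw [hv i hi, map_zero, zero_mul, C_0, zero_mul, natDegree_zero]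
    exact Nat.zero_le k

end Coordinates

namespace IsPoleBasis

variable {Q : Place K F} {a : ℕ} {x₁ : F} {y : ℕ → F} {b : ℕ → ℕ}

theorem block_eq (hB : IsPoleBasis Q a x₁ y b) {N : ℕ} {v : Fin N → K[X]} {k : ℕ}
    {p : Fin a → K[X]} (h : (ofCoords a x₁ y v).coeff k = comb a x₁ y p) : block a v k = p :=
  hB.comb_injective (by rw [← coeff_ofCoords hB.pos, h])

theorem ofCoords_injective (hB : IsPoleBasis Q a x₁ y b) {N : ℕ} :
    Function.Injective (ofCoords a x₁ y : (Fin N → K[X]) → F[X]) := by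
  intro v v' h
  funext i
  have hblock : block a v (i / a) = block a v' (i / a) :=
    hB.block_eq (by rw [← coeff_ofCoords hB.pos, h])
  rw [← block_div_mod hB.pos v i, hblock, block_div_mod hB.pos]

theorem div_le (hB : IsPoleBasis Q a x₁ y b) {ℓ : ℕ} (s : Fin (a * (ℓ + 1))) :
    (s : ℕ) / a ≤ ℓ :=
  Nat.lt_succ_iff.mp ((Nat.div_lt_iff_lt_mul hB.pos).mpr (s.2.trans_eq (mul_comm _ _)))

theorem exists_ofCoords_eq (hB : IsPoleBasis Q a x₁ y b) {ℓ : ℕ} {q : F[X]} (hq : q.natDegree ≤ ℓ)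
    (hqR : ∀ t, q.coeff t ∈ regularRing Q) :
    ∃ v : Fin (a * (ℓ + 1)) → K[X], ofCoords a x₁ y v = q := by
  choose p hp using fun t => hB.exists_comb_eq (hqR t)
  let v : Fin (a * (ℓ + 1)) → K[X] := fun i => p (i / a) ⟨i % a, Nat.mod_lt _ hB.pos⟩
  have hv : (ofCoords a x₁ y v).natDegree ≤ ℓ :=
    natDegree_ofCoords_le _ _ fun i hi => absurd (hB.div_le i) hi.not_ge
  refine ⟨v, ext_iff_natDegree_le hv hq |>.mpr fun k hk => ?_⟩
  rw [coeff_ofCoords hB.pos, ← hp k]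
  congr 1
  funext j
  have hlt : (j : ℕ) + a * k < a * (ℓ + 1) :=
    calc (j : ℕ) + a * k < a + a * k := Nat.add_lt_add_right j.2 _
      _ = a * (k + 1) := by ring
      _ ≤ a * (ℓ + 1) := Nat.mul_le_mul_left a (Nat.add_le_add_right hk 1)
  simp only [block, v, dif_pos hlt, Nat.add_mul_mod_self_left, Nat.mod_eq_of_lt j.2,
    Nat.add_mul_div_left _ _ hB.pos, Nat.div_eq_of_lt j.2, zero_add, Fin.eta]

end IsPoleBasis

section Multiplicity

variable {P : Place K F} {r : K} {q q' : F[X]} {m m' : ℕ} {z : F}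

theorem HasMultiplicity.mul (h : HasMultiplicity q P r m) (h' : HasMultiplicity q' P r m') :
    HasMultiplicity (q * q') P r (m + m') := by
  intro t
  rw [mul_comp, coeff_mul]
  refine P.val.map_le_sum fun x hx => le_trans ?_ (le_val_mul (h x.1) (h' x.2))
  rw [WithTop.coe_le_coe, ← Finset.HasAntidiagonal.mem_antidiagonal.mp hx]
  push_cast
  omega

theorem HasMultiplicity.add (h : HasMultiplicity q P r m) (h' : HasMultiplicity q' P r m) :
    HasMultiplicity (q + q') P r m := by
  intro t
  rw [add_comp, coeff_add]
  exact (le_min (h t) (h' t)).trans (P.val.map_add _ _)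

theorem hasMultiplicity_C (h : ((m : ℤ) : WithTop ℤ) ≤ P.val z) : HasMultiplicity (C z) P r m := by
  intro t
  rw [C_comp, coeff_C]
  split_ifs with ht
  · rwa [ht, Nat.cast_zero, sub_zero]
  · rw [AddValuation.map_zero]
    exact le_top

theorem hasMultiplicity_X_sub_C (h : 0 < P.val (z - algebraMap K F r)) :
    HasMultiplicity (X - C z) P r 1 := by
  intro t
  have hcomp : (X - C z).comp (X + C (algebraMap K F r)) = X + C (algebraMap K F r - z) := by
    simp only [sub_comp, X_comp, C_comp, C_sub]
    ring
  rw [hcomp, coeff_add, coeff_C, coeff_X]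
  rcases t with _ | _ | t
  · rw [if_neg one_ne_zero, if_pos rfl, zero_add, P.val.map_sub_swap]
    rcases eq_or_ne (z - algebraMap K F r) 0 with hz | hz
    · rw [hz, AddValuation.map_zero]
      exact le_top
    · obtain ⟨k, hk⟩ := exists_val_eq P.val hz
      rw [hk] at h ⊢
      norm_cast at *
  · simp
  · simp

theorem hasMultiplicity_X : HasMultiplicity (X : F[X]) P r 0 := by
  intro t
  rw [X_comp, coeff_add, coeff_C, coeff_X]
  rcases t with _ | _ | t
  · simpa using P.val_const_nonneg r
  · simp only [zero_add, if_true, one_ne_zero, if_false, add_zero, AddValuation.map_one]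
    norm_cast
  · simp

end Multiplicity

section Interpolation

variable {Q : Place K F} {n : ℕ} {P : Fin n → Place K F} {r : Fin n → K} {q q' : F[X]} {z : F}
  {m m' ℓ ℓ' : ℕ}

theorem mul_mem_interpolationModule (h : q ∈ interpolationModule Q P r m ℓ)
    (h' : q' ∈ interpolationModule Q P r m' ℓ') :
    q * q' ∈ interpolationModule Q P r (m + m') (ℓ + ℓ') := by
  refine ⟨natDegree_mul_le.trans (add_le_add h.1 h'.1), fun t => ?_,
    fun i => (h.2.2 i).mul (h'.2.2 i)⟩
  rw [coeff_mul]
  exact (regularRing Q).sum_mem fun x _ => (regularRing Q).mul_mem (h.2.1 _) (h'.2.1 _)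

theorem add_mem_interpolationModule (h : q ∈ interpolationModule Q P r m ℓ)
    (h' : q' ∈ interpolationModule Q P r m ℓ) : q + q' ∈ interpolationModule Q P r m ℓ := by
  refine ⟨natDegree_add_le_of_degree_le h.1 h'.1, fun t => ?_, fun i => (h.2.2 i).add (h'.2.2 i)⟩
  rw [coeff_add]
  exact (regularRing Q).add_mem (h.2.1 _) (h'.2.1 _)

theorem C_mem_interpolationModule (hz : z ∈ regularRing Q)
    (h : ∀ i, ((m : ℤ) : WithTop ℤ) ≤ (P i).val z) : C z ∈ interpolationModule Q P r m 0 := by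
  refine ⟨natDegree_C z |>.le, fun t => ?_, fun i => hasMultiplicity_C (h i)⟩
  rw [coeff_C]
  split_ifs
  · exact hz
  · exact (regularRing Q).zero_mem

theorem X_mem_interpolationModule : (X : F[X]) ∈ interpolationModule Q P r 0 1 := by
  refine ⟨natDegree_X_le, fun t => ?_, fun i => hasMultiplicity_X⟩
  rw [coeff_X]
  split_ifs
  · exact (regularRing Q).one_mem
  · exact (regularRing Q).zero_mem

theorem X_sub_C_mem_interpolationModule (hz : z ∈ regularRing Q)
    (hzr : ∀ i, 0 < (P i).val (z - algebraMap K F (r i))) :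
    X - C z ∈ interpolationModule Q P r 1 1 := by
  refine ⟨natDegree_X_sub_C_le _, fun t => ?_, fun i => hasMultiplicity_X_sub_C (hzr i)⟩
  rw [coeff_sub, coeff_C]
  refine (regularRing Q).sub_mem (X_mem_interpolationModule (P := P) (r := r) |>.2.1 t) ?_
  split_ifs
  · exact hz
  · exact (regularRing Q).zero_mem

theorem pow_mem_interpolationModule (h : q ∈ interpolationModule Q P r m ℓ) (e : ℕ) :
    q ^ e ∈ interpolationModule Q P r (e * m) (e * ℓ) := by
  induction e with
  | zero =>
    rw [pow_zero, Nat.zero_mul, Nat.zero_mul, ← C_1]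
    exact C_mem_interpolationModule (regularRing Q).one_mem fun i => by simp
  | succ e ih =>
    rw [pow_succ, Nat.succ_mul, Nat.succ_mul]
    exact mul_mem_interpolationModule ih h

theorem interpolationModule_mono (hℓ : ℓ ≤ ℓ') :
    interpolationModule Q P r m ℓ ⊆ interpolationModule Q P r m ℓ' :=
  fun _ h => ⟨h.1.trans hℓ, h.2⟩

/-- The interpolation module in coordinates, as a module over the polynomials in `x₁`. -/
def interpolationSubmodule (P : Fin n → Place K F) (r : Fin n → K) (hPQ : ∀ i, P i ≠ Q) (a : ℕ)
    {x₁ : F} (hx : x₁ ∈ regularRing Q) (y : ℕ → F) (N m ℓ : ℕ) :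
    Submodule K[X] (Fin N → K[X]) where
  carrier := {v | ofCoords a x₁ y v ∈ interpolationModule Q P r m ℓ}
  add_mem' hv hv' := by
    rw [Set.mem_ofPred_eq, ofCoords_add]
    exact add_mem_interpolationModule hv hv'
  zero_mem' := by
    rw [Set.mem_ofPred_eq, ofCoords_zero, ← C_0]
    exact interpolationModule_mono (Nat.zero_le ℓ)
      (C_mem_interpolationModule (regularRing Q).zero_mem fun i => by simp)
  smul_mem' p v hv := by
    have hp : aeval x₁ p ∈ regularRing Q := aeval_mem_regularRing hx p
    have hmem := mul_mem_interpolationModule (m := 0)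
      (C_mem_interpolationModule (r := r) hp fun i => mem_regularRing.mp hp _ (hPQ i)) hv
    rwa [Nat.zero_add, Nat.zero_add, ← ofCoords_smul] at hmem

theorem coeff_comp_X_add_C_of_natDegree_le {k : ℕ} (hq : q.natDegree ≤ k) (c : F) :
    (q.comp (X + C c)).coeff k = q.coeff k := by
  rcases hq.lt_or_eq with hlt | rfl
  · rw [coeff_eq_zero_of_natDegree_lt hlt, coeff_eq_zero_of_natDegree_lt]
    rwa [natDegree_comp, natDegree_X_add_C, mul_one]
  · rw [← taylor_apply, coeff_taylor_natDegree, leadingCoeff]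

theorem le_val_coeff_of_mem_interpolationModule (hPQ : ∀ i, P i ≠ Q)
    (hq : q ∈ interpolationModule Q P r m ℓ) {k : ℕ} (hk : q.natDegree ≤ k) (i : Fin n) :
    (((m - k : ℕ) : ℤ) : WithTop ℤ) ≤ (P i).val (q.coeff k) := by
  have hmult := hq.2.2 i k
  rw [coeff_comp_X_add_C_of_natDegree_le hk] at hmult
  rcases le_total k m with hkm | hkm
  · rwa [Nat.cast_sub hkm]
  · rw [Nat.sub_eq_zero_of_le hkm]
    exact mem_regularRing.mp (hq.2.1 k) _ (hPQ i)

end Interpolation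

end Curves

section Generators

variable {K F : Type*} [Field K] [Field F] [Algebra K F] {a m : ℕ} {f h : F} {y : ℕ → F}

theorem generator_eq (a m : ℕ) (f h : F) (y : ℕ → F) (s : ℕ) :
    generator a m (fun i j => f ^ i * y j) h s =
      X ^ (s / a - m) * (X - C h) ^ min (s / a) m * C (f ^ (m - s / a) * y (s % a)) := by
  unfold generator
  split_ifs with hk
  · rw [min_eq_left hk, Nat.sub_eq_zero_of_le hk, pow_zero, one_mul]
  · rw [min_eq_right (le_of_not_ge hk), Nat.sub_eq_zero_of_le (le_of_not_ge hk)]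

theorem coeff_generator (a m : ℕ) (f h : F) (y : ℕ → F) (s i : ℕ) :
    (generator a m (fun i j => f ^ i * y j) h s).coeff i =
      (if s / a - m ≤ i then
        (-h) ^ (s / a - i) * ((min (s / a) m).choose (i - (s / a - m)) : F) else 0) *
        (f ^ (m - s / a) * y (s % a)) := by
  rw [generator_eq, coeff_mul_C, coeff_X_pow_mul']
  congr 1
  split_ifs with hi
  · rw [sub_eq_add_neg, ← C_neg, coeff_X_add_C_pow]
    congr 2
    omega
  · rfl

theorem coeff_generator_div (a m : ℕ) (f h : F) (y : ℕ → F) (s : ℕ) :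
    (generator a m (fun i j => f ^ i * y j) h s).coeff (s / a) =
      f ^ (m - s / a) * y (s % a) := by
  rw [coeff_generator, if_pos (Nat.sub_le _ _), Nat.sub_self, pow_zero, one_mul,
    tsub_tsub_eq_min, Nat.choose_self, Nat.cast_one, one_mul]

theorem le_of_coeff_generator_ne_zero {s i : ℕ}
    (hi : (generator a m (fun i j => f ^ i * y j) h s).coeff i ≠ 0) :
    s / a - m ≤ i ∧ i ≤ s / a := by
  rw [coeff_generator] at hi
  split_ifs at hi with hsi
  · refine ⟨hsi, le_of_not_gt fun hlt => hi ?_⟩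
    rw [Nat.choose_eq_zero_of_lt (by omega), Nat.cast_zero, mul_zero, zero_mul]
  · exact absurd (zero_mul _) hi

theorem le_val_coeff_generator {Q : Place K F} {b : ℕ → ℕ}
    (hy : ∀ j, Q.val (y j) = ((-(b j : ℤ) : ℤ) : WithTop ℤ)) {H e : ℤ}
    (hh : ((-H : ℤ) : WithTop ℤ) ≤ Q.val h) (hf : ((-e : ℤ) : WithTop ℤ) ≤ Q.val f) {s i : ℕ}
    (hi : (generator a m (fun i j => f ^ i * y j) h s).coeff i ≠ 0) :
    ((-(((s / a : ℕ) - i : ℤ) * H + (m - s / a : ℕ) * e + b (s % a)) : ℤ) : WithTop ℤ) ≤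
      Q.val ((generator a m (fun i j => f ^ i * y j) h s).coeff i) := by
  obtain ⟨hsi, his⟩ := le_of_coeff_generator_ne_zero hi
  have hchoose : ((0 : ℤ) : WithTop ℤ) ≤
      Q.val ((min (s / a) m).choose (i - (s / a - m)) : F) := by
    simpa only [map_natCast, WithTop.coe_zero] using
      Q.val_const_nonneg ((min (s / a) m).choose (i - (s / a - m)) : K)
  rw [← Q.val.map_neg] at hh
  rw [coeff_generator, if_pos hsi]
  refine le_of_eq_of_le ?_ (le_val_mul (le_val_mul (le_val_pow hh (s / a - i)) hchoose)
    (le_val_mul (le_val_pow hf (m - s / a)) (hy (s % a)).ge))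
  rw [WithTop.coe_inj, Nat.cast_sub his]
  ring

theorem generator_mem_interpolationModule {Q : Place K F} {n : ℕ} {P : Fin n → Place K F}
    {r : Fin n → K} (hPQ : ∀ i, P i ≠ Q) (hf : HasSimpleZeros Q P f) (hh : h ∈ regularRing Q)
    (hhr : ∀ i, 0 < (P i).val (h - algebraMap K F (r i))) (hy : ∀ j, y j ∈ regularRing Q)
    (a m s : ℕ) :
    generator a m (fun i j => f ^ i * y j) h s ∈ interpolationModule Q P r m (s / a) := by
  have hX := pow_mem_interpolationModule (X_mem_interpolationModule (Q := Q) (P := P) (r := r))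
    (s / a - m)
  have hXh := pow_mem_interpolationModule (X_sub_C_mem_interpolationModule hh hhr) (min (s / a) m)
  have hC := C_mem_interpolationModule (r := r)
    ((regularRing Q).mul_mem ((regularRing Q).pow_mem hf.mem (m - s / a)) (hy (s % a)))
    (hf.le_val_pow_mul hPQ (hy _) _)
  have hmem := mul_mem_interpolationModule (mul_mem_interpolationModule hX hXh) hC
  rw [generator_eq]
  generalize s / a = k at hmem ⊢
  rwa [show (k - m) * 0 + min k m * 1 + (m - k) = m by omega,
    show (k - m) * 1 + min k m * 1 + 0 = k by omega] at hmem

end Generators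

/-- The rows of `G` are the coordinate vectors of the generators of the interpolation module, where
`f` is the polynomial `φ` in `x₁`. -/
structure IsGenSystem {K F : Type*} [Field K] [Field F] [Algebra K F] (Q : Place K F) {n : ℕ}
    (P : Fin n → Place K F) (r : Fin n → K) (a : ℕ) (x₁ : F) (y : ℕ → F) (b : ℕ → ℕ) (f : F)
    (φ : K[X]) (h : F) (m ℓ : ℕ) (G : Fin (a * (ℓ + 1)) → Fin (a * (ℓ + 1)) → K[X]) : Prop where
  basis : IsPoleBasis Q a x₁ y b
  ne : ∀ i, P i ≠ Q
  zeros : HasSimpleZeros Q P f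
  aeval_eq : aeval x₁ φ = f
  h_mem : h ∈ regularRing Q
  h_val : ∀ i, 0 < (P i).val (h - algebraMap K F (r i))
  gen : ∀ s, ofCoords a x₁ y (G s) = generator a m (fun i j => f ^ i * y j) h s

section GenSystem

variable {K F : Type*} [Field K] [Field F] [Algebra K F] {Q : Place K F} {n : ℕ}
  {P : Fin n → Place K F} {r : Fin n → K} {a : ℕ} {x₁ : F} {y : ℕ → F} {b : ℕ → ℕ} {f : F}
  {φ : K[X]} {h : F} {m ℓ : ℕ} {G : Fin (a * (ℓ + 1)) → Fin (a * (ℓ + 1)) → K[X]}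

theorem IsPoleBasis.exists_isGenSystem (hB : IsPoleBasis Q a x₁ y b) (hPQ : ∀ i, P i ≠ Q)
    (hf : HasSimpleZeros Q P f) (hφ : aeval x₁ φ = f) (hh : h ∈ regularRing Q)
    (hhr : ∀ i, 0 < (P i).val (h - algebraMap K F (r i))) (m ℓ : ℕ) :
    ∃ G, IsGenSystem Q P r a x₁ y b f φ h m ℓ G := by
  have hmem := generator_mem_interpolationModule hPQ hf hh hhr hB.y_mem a m
  choose G hG using fun s : Fin (a * (ℓ + 1)) =>
    hB.exists_ofCoords_eq ((hmem s).1.trans (hB.div_le s)) (hmem s).2.1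
  exact ⟨G, hB, hPQ, hf, hφ, hh, hhr, hG⟩

namespace IsGenSystem

theorem forall_ofCoords_eq_iff (hG : IsGenSystem Q P r a x₁ y b f φ h m ℓ G)
    (G' : Fin (a * (ℓ + 1)) → Fin (a * (ℓ + 1)) → K[X]) :
    (∀ s, ofCoords a x₁ y (G' s) = generator a m (fun i j => f ^ i * y j) h s) ↔ G' = G := by
  refine ⟨fun hG' => funext fun s => hG.basis.ofCoords_injective ?_, ?_⟩
  · rw [hG' s, hG.gen s]
  · rintro rfl
    exact hG.gen

theorem phi_ne_zero (hG : IsGenSystem Q P r a x₁ y b f φ h m ℓ G) : φ ≠ 0 := by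
  rintro rfl
  exact hG.zeros.ne_zero (by rw [← hG.aeval_eq, map_zero])

theorem val_f (hG : IsGenSystem Q P r a x₁ y b f φ h m ℓ G) :
    Q.val f = ((-(a * φ.natDegree : ℤ) : ℤ) : WithTop ℤ) := by
  rw [← hG.aeval_eq, Place.val_aeval hG.basis.pos hG.basis.x_val hG.phi_ne_zero]

theorem generator_mem (hG : IsGenSystem Q P r a x₁ y b f φ h m ℓ G) (s : Fin (a * (ℓ + 1))) :
    ofCoords a x₁ y (G s) ∈ interpolationModule Q P r m (s / a) := by
  rw [hG.gen]
  exact generator_mem_interpolationModule hG.ne hG.zeros hG.h_mem hG.h_val hG.basis.y_mem a m s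

theorem block_div (hG : IsGenSystem Q P r a x₁ y b f φ h m ℓ G) (s : Fin (a * (ℓ + 1))) :
    block a (G s) (s / a) =
      Pi.single ⟨s % a, Nat.mod_lt _ hG.basis.pos⟩ (φ ^ (m - (s : ℕ) / a)) :=
  hG.basis.block_eq (by
    rw [hG.gen, coeff_generator_div, comb_single, map_pow, hG.aeval_eq])

theorem apply_self (hG : IsGenSystem Q P r a x₁ y b f φ h m ℓ G) (s : Fin (a * (ℓ + 1))) :
    G s s = φ ^ (m - (s : ℕ) / a) := by
  rw [← block_div_mod hG.basis.pos (G s) s, hG.block_div, Pi.single_eq_same]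

theorem coeff_generator_ne_zero (hG : IsGenSystem Q P r a x₁ y b f φ h m ℓ G)
    {s i : Fin (a * (ℓ + 1))} (hi : G s i ≠ 0) :
    (generator a m (fun i j => f ^ i * y j) h s).coeff (i / a) ≠ 0 := by
  intro h0
  have hblock : block a (G s) (i / a) = 0 := hG.basis.block_eq (by rw [hG.gen, h0, map_zero])
  rw [← block_div_mod hG.basis.pos (G s) i, hblock] at hi
  exact hi rfl

theorem hasInd (hG : IsGenSystem Q P r a x₁ y b f φ h m ℓ G) (s : Fin (a * (ℓ + 1))) :
    HasInd (G s) s := by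
  refine ⟨hG.apply_self s ▸ pow_ne_zero _ hG.phi_ne_zero, fun i hi => ?_⟩
  by_contra hne
  have hdiv : (i : ℕ) / a = s / a :=
    (le_of_coeff_generator_ne_zero (hG.coeff_generator_ne_zero hne)).2.antisymm
      (Nat.div_le_div_right (Fin.le_def.mp hi.le))
  rw [← block_div_mod hG.basis.pos (G s) i, hdiv, hG.block_div] at hne
  refine hne (Pi.single_eq_of_ne (fun hmod => hi.ne (Fin.ext ?_)) _)
  rw [← Nat.mod_add_div s a, ← Nat.mod_add_div i a, hdiv, Fin.mk.inj hmod]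

theorem dvd_of_hasInd (hG : IsGenSystem Q P r a x₁ y b f φ h m ℓ G)
    {v : Fin (a * (ℓ + 1)) → K[X]} (hv : ofCoords a x₁ y v ∈ interpolationModule Q P r m ℓ)
    {s : Fin (a * (ℓ + 1))} (hs : HasInd v s) : G s s ∣ v s := by
  have hdeg : (ofCoords a x₁ y v).natDegree ≤ (s : ℕ) / a :=
    natDegree_ofCoords_le _ _ fun i hi =>
      hs.2 i (Fin.lt_def.mpr (lt_of_not_ge fun hle => hi.not_ge (Nat.div_le_div_right hle)))
  obtain ⟨p, hp⟩ := hG.basis.exists_comb_eq (hG.zeros.div_pow_mem (hv.2.1 (s / a))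
    (le_val_coeff_of_mem_interpolationModule hG.ne hv hdeg))
  have hblock : block a v (s / a) = φ ^ (m - (s : ℕ) / a) • p := by
    refine hG.basis.block_eq ?_
    rw [eq_div_iff (pow_ne_zero _ hG.zeros.ne_zero)] at hp
    simp only [← hp, comb_apply, Finset.sum_mul, Pi.smul_apply, smul_eq_mul, map_mul, map_pow,
      hG.aeval_eq]
    exact Finset.sum_congr rfl fun j _ => by ring
  rw [hG.apply_self, ← block_div_mod hG.basis.pos v s, hblock]
  exact dvd_mul_right _ _

theorem mem_interpolationSubmodule (hG : IsGenSystem Q P r a x₁ y b f φ h m ℓ G)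
    (s : Fin (a * (ℓ + 1))) :
    G s ∈ interpolationSubmodule P r hG.ne a hG.basis.x_mem y (a * (ℓ + 1)) m ℓ :=
  interpolationModule_mono (hG.basis.div_le s) (hG.generator_mem s)

theorem span_range_eq (hG : IsGenSystem Q P r a x₁ y b f φ h m ℓ G) :
    Submodule.span K[X] (Set.range G) =
      interpolationSubmodule P r hG.ne a hG.basis.x_mem y (a * (ℓ + 1)) m ℓ :=
  span_range_eq_of_hasInd hG.mem_interpolationSubmodule hG.hasInd
    fun _ hv _ hs => hG.dvd_of_hasInd hv hs

theorem weight_le_of_coeff_ne_zero (hG : IsGenSystem Q P r a x₁ y b f φ h m ℓ G) {H : ℤ}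
    (hh : ((-H : ℤ) : WithTop ℤ) ≤ Q.val h) {s i : Fin (a * (ℓ + 1))} {d : ℕ}
    (hd : (G s i).coeff d ≠ 0) :
    (s : ℕ) / a - m ≤ (i : ℕ) / a ∧ (i : ℕ) / a ≤ (s : ℕ) / a ∧
      (a : ℤ) * d + b (i % a) ≤ ((s / a : ℕ) - (i / a : ℕ) : ℤ) * H +
        (m - (s : ℕ) / a : ℕ) * (a * φ.natDegree : ℕ) + b (s % a) := by
  have hne : G s i ≠ 0 := fun h0 => hd (by rw [h0, coeff_zero])
  have hcoeff := hG.coeff_generator_ne_zero hne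
  obtain ⟨hsi, his⟩ := le_of_coeff_generator_ne_zero hcoeff
  refine ⟨hsi, his, ?_⟩
  have hpole := le_val_coeff_generator hG.basis.y_val hh hG.val_f.ge hcoeff
  have hblock := block_div_mod hG.basis.pos (G s) i
  rw [← hG.gen, coeff_ofCoords hG.basis.pos] at hpole
  have hweight := WithTop.coe_le_coe.mp (hpole.trans (hG.basis.val_comb_le (hblock ▸ hne)))
  rw [hblock, neg_le_neg_iff] at hweight
  refine le_trans ?_ hweight
  gcongr
  exact le_natDegree_of_ne_zero hd

end IsGenSystem

end GenSystem

section StageBounds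

-- In the application `k = r / a` is the power of `Z` belonging to row `r`, `e = min k m`,
-- `H = n + 2g - 1`, `β = max b_j`, `d = deg φ`, `S` is the sum of the degrees of the pivots and `T`
-- the cost of using each pivot once.
variable {a r k e m u H d β S T : ℤ}

theorem pivotDegreeSum_le (ha : 2 ≤ a) (har : a ≤ r) (hm : 1 ≤ m) (hH : 1 ≤ H) (hd : d ≤ H)
    (hβ : a ≤ β + 1) (hS : S + d * r ≤ d * (r * m + a)) :
    r * β + a * (r + 1) + a * S ≤ a * (β + m * H) * (r + 1) := by
  have hrm : 0 ≤ r * (m - 1) := mul_nonneg (by linarith) (by linarith)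
  have hSH : S ≤ H * (r * (m - 1) + a) := by
    have : d * (r * (m - 1) + a) ≤ H * (r * (m - 1) + a) :=
      mul_le_mul_of_nonneg_right hd (by linarith)
    linarith
  have haS : a * S ≤ a * (H * (r * (m - 1) + a)) := mul_le_mul_of_nonneg_left hSH (by linarith)
  have hβr : (a - 1) * (a * a) ≤ β * (a * (r + 1) - r) :=
    mul_le_mul (by linarith) (by nlinarith) (by nlinarith) (by linarith)
  have hmH : 1 * 1 ≤ m * H := mul_le_mul hm hH (by norm_num) (by linarith)
  have hHr : 0 ≤ a * ((H - 1) * (r - a)) :=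
    mul_nonneg (by linarith) (mul_nonneg (by linarith) (by linarith))
  nlinarith

theorem crudeStageCost_le (ha : 2 ≤ a) (har : a ≤ r) (he : 0 ≤ e) (hek : e ≤ k) (hm : 1 ≤ m)
    (hu : 0 ≤ u) (hH : 1 ≤ H) (hd : d ≤ H) (hβ : a ≤ β + 1) (hS : S + d * r ≤ d * (r * m + a))
    (hT : a * T ≤ a * r + (r + 1) * (a * S + r * (β + k * u) + a * r)) :
    T ≤ (β + m * H + u * (2 * k - e)) * (r + 1) ^ 2 := by
  have hsum := pivotDegreeSum_le ha har hm hH hd hβ hS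
  have hku : k * u * (1 * r) ≤ u * (2 * k - e) * (a * (r + 1)) :=
    mul_le_mul (by nlinarith) (mul_le_mul (by linarith) (by linarith) (by linarith)
      (by linarith)) (by linarith) (mul_nonneg hu (by linarith))
  refine le_of_mul_le_mul_left (hT.trans ?_) (by linarith : 0 < a)
  nlinarith

theorem mul_le_sq_of_crudeStageCost_le {c : ℤ} (he : 0 ≤ e) (hek : e ≤ k) (hem : e ≤ m)
    (hu : 0 ≤ u) (hc : 0 ≤ c) (ha : 1 ≤ a) (hβ : a ≤ β + 1)
    (hT : T ≤ (β + m * (u + c) + u * (2 * k - e)) * (r + 1) ^ 2) :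
    (e * c + a - 1) * T ≤ (β + m * (u + c) + u * (k - e)) ^ 2 * (r + 1) ^ 2 := by
  have hm : 0 ≤ (m - e) * (u + c) := mul_nonneg (by linarith) (by linarith)
  have hk : 0 ≤ u * (2 * k - e) := mul_nonneg hu (by linarith)
  have hec : 0 ≤ e * c := mul_nonneg he hc
  have heu : 0 ≤ e * u := mul_nonneg he hu
  calc (e * c + a - 1) * T
      ≤ (e * c + a - 1) * ((β + m * (u + c) + u * (2 * k - e)) * (r + 1) ^ 2) :=
        mul_le_mul_of_nonneg_left hT (by linarith)
    _ ≤ (β + m * (u + c) - u * e) * ((β + m * (u + c) + u * (2 * k - e)) * (r + 1) ^ 2) :=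
        mul_le_mul_of_nonneg_right (by linarith) (mul_nonneg (by linarith) (sq_nonneg _))
    _ = (β + m * (u + c) + u * (k - e)) ^ 2 * (r + 1) ^ 2 - (k * u * (r + 1)) ^ 2 := by ring
    _ ≤ _ := sub_le_self _ (sq_nonneg _)

end StageBounds

section LinearStageBounds

theorem mul_tsub_le_mul_tsub {D M : ℕ} (h : D ≤ M) (t : ℕ) : M * (D - t) ≤ D * (M - t) := by
  rw [Nat.mul_sub, Nat.mul_sub, mul_comm M D]
  exact Nat.sub_le_sub_left (Nat.mul_le_mul_right t h) _

theorem two_mul_sum_range_tsub (k m : ℕ) :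
    2 * ∑ s ∈ Finset.range k, (m - s) = min k m * (2 * m - min k m + 1) := by
  induction k with
  | zero => simp
  | succ k ih =>
    rw [Finset.sum_range_succ, mul_add, ih]
    rcases le_or_gt m k with h | h
    · rw [min_eq_right h, min_eq_right (by omega), Nat.sub_eq_zero_of_le h, mul_zero, add_zero]
    · obtain ⟨t, rfl⟩ := Nat.exists_eq_add_of_lt h
      rw [min_eq_left (by omega), min_eq_left (by omega), show k + t + 1 - k = t + 1 by omega,
        show 2 * (k + t + 1) - k = k + 2 * t + 2 by omega,
        show 2 * (k + t + 1) - (k + 1) = k + 2 * t + 1 by omega]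
      ring

-- Here `a = 1` and `r = k`, and `X` is the sum of the truncated differences `D s - (k + 2)`, where
-- `D s` is the degree of the pivot `s`.
variable {k m e H d S X : ℤ}

theorem sq_mul_le_sq_mul (he : 0 ≤ e) (hem : e ≤ m) :
    e * (e * (2 * m - e + 1)) ≤ m ^ 2 * (e + 1) := by
  nlinarith [mul_nonneg he (sq_nonneg (m - e))]

theorem mul_add_three_le (he : 1 ≤ e) (hek : e ≤ k) (hem : e ≤ m) (hor : e = k ∨ e = m) :
    e * (k * (k + 3)) ≤ 2 * m ^ 2 * (k * (k - e) + k + 1) := by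
  rcases hor with rfl | rfl
  · have hsq : e ^ 2 ≤ m ^ 2 := pow_le_pow_left₀ (by linarith) hem 2
    nlinarith [mul_nonneg (sub_nonneg.mpr hsq) (by linarith : 0 ≤ e + 1),
      mul_nonneg (sq_nonneg e) (sub_nonneg.mpr he)]
  · have hmk : k * (k + 3) ≤ 2 * e * (k * (k - e) + k + 1) := by
      rcases hek.eq_or_lt with rfl | hlt
      · nlinarith
      · have hprod : 0 ≤ (e - 1) * (k - e - 1) := mul_nonneg (by linarith) (by linarith)
        nlinarith [mul_nonneg (by linarith : 0 ≤ k) hprod,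
          mul_nonneg (by linarith : 0 ≤ k - 1) (by linarith : 0 ≤ k - 2)]
    nlinarith [mul_le_mul_of_nonneg_left hmk (by linarith : 0 ≤ e)]

theorem mul_add_three_sub_le (he : 1 ≤ e) (hek : e ≤ k) (hem : e ≤ m) (hor : e = k ∨ e = m) :
    m * k * (k + 3) - e * (2 * m - e + 1) * (k + 2) ≤ 2 * m ^ 2 * ((k + 1) * (k - e)) := by
  rcases hor with rfl | rfl
  · nlinarith [mul_nonneg (by linarith : 0 ≤ e)
      (mul_nonneg (sub_nonneg.mpr hem) (by linarith : 0 ≤ e + 1))]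
  · have hke : 0 ≤ e * ((k + 1) * (k - e)) :=
      mul_nonneg (by linarith) (mul_nonneg (by linarith) (by linarith))
    have hke' : 0 ≤ (e - 1) * (e * ((k + 1) * (k - e))) := mul_nonneg (by linarith) hke
    have hk : 0 ≤ e * (k * (k - e)) :=
      mul_nonneg (by linarith) (mul_nonneg (by linarith) (by linarith))
    nlinarith

theorem linearStageCost_le_of_le (he : 1 ≤ e) (hek : e ≤ k) (hem : e ≤ m) (hor : e = k ∨ e = m)
    (hH : 1 ≤ H) (hd : d ≤ 2 * H) (hS : 2 * S = d * (e * (2 * m - e + 1))) :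
    e * (2 * (k * S) + k * (k + 3)) ≤ 2 * m ^ 2 * H * (k + 1) ^ 2 := by
  have hkd : k * d * (e * (e * (2 * m - e + 1))) ≤ k * (2 * H) * (m ^ 2 * (e + 1)) :=
    mul_le_mul (mul_le_mul_of_nonneg_left hd (by linarith)) (sq_mul_le_sq_mul (by linarith) hem)
      (mul_nonneg (by linarith) (mul_nonneg (by linarith) (by linarith)))
      (mul_nonneg (by linarith) (by linarith))
  have hkH : 2 * m ^ 2 * (k * (k - e) + k + 1) ≤ 2 * m ^ 2 * (k * (k - e) + k + 1) * H :=
    le_mul_of_one_le_right (mul_nonneg (by positivity) (by nlinarith)) hH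
  calc e * (2 * (k * S) + k * (k + 3))
      = k * d * (e * (e * (2 * m - e + 1))) + e * (k * (k + 3)) := by
        linear_combination e * k * hS
    _ ≤ k * (2 * H) * (m ^ 2 * (e + 1)) + 2 * m ^ 2 * (k * (k - e) + k + 1) * H :=
        add_le_add hkd ((mul_add_three_le he hek hem hor).trans hkH)
    _ = _ := by ring

theorem linearStageCost_le (he : 1 ≤ e) (hek : e ≤ k) (hem : e ≤ m) (hor : e = k ∨ e = m)
    (hH : 1 ≤ H) (hd₁ : 1 ≤ d) (hd : d ≤ 2 * H) (hS : 2 * S = d * (e * (2 * m - e + 1)))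
    (hX : m * d * X ≤ S * (m * d - (k + 2))) :
    e * (2 * (k * S + X) + k * (k + 3)) ≤ 2 * m ^ 2 * H * (k + 1) ^ 2 := by
  have hX' : 2 * m * X ≤ e * (2 * m - e + 1) * (m * d - (k + 2)) := by
    refine le_of_mul_le_mul_left ?_ (by linarith : 0 < d)
    linear_combination 2 * hX + (m * d - (k + 2)) * hS
  have hkd : (k + 1) * d * (e * (e * (2 * m - e + 1))) ≤
      (k + 1) * (2 * H) * (m ^ 2 * (e + 1)) :=
    mul_le_mul (mul_le_mul_of_nonneg_left hd (by linarith)) (sq_mul_le_sq_mul (by linarith) hem)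
      (mul_nonneg (by linarith) (mul_nonneg (by linarith) (by linarith)))
      (mul_nonneg (by linarith) (by linarith))
  have hke : 0 ≤ 2 * m ^ 2 * ((k + 1) * (k - e)) :=
    mul_nonneg (by positivity) (mul_nonneg (by linarith) (by linarith))
  have hrest : e * (m * k * (k + 3) - e * (2 * m - e + 1) * (k + 2)) ≤
      m * (2 * m ^ 2 * ((k + 1) * (k - e)) * H) :=
    (mul_le_mul_of_nonneg_left (mul_add_three_sub_le he hek hem hor) (by linarith)).trans
      (mul_le_mul hem (le_mul_of_one_le_right hke hH) hke (by linarith))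
  refine le_of_mul_le_mul_left ?_ (by linarith : 0 < m)
  calc m * (e * (2 * (k * S + X) + k * (k + 3)))
      ≤ m * ((k + 1) * d * (e * (e * (2 * m - e + 1)))) +
          e * (m * k * (k + 3) - e * (2 * m - e + 1) * (k + 2)) := by
        linear_combination e * hX' + m * e * k * hS
    _ ≤ m * ((k + 1) * (2 * H) * (m ^ 2 * (e + 1))) +
          m * (2 * m ^ 2 * ((k + 1) * (k - e)) * H) :=
        add_le_add (mul_le_mul_of_nonneg_left hkd (by linarith)) hrest
    _ = _ := by ring

theorem mul_le_sq_of_linearStageCost_le {u c T T₀ : ℤ} (he : 0 ≤ e) (hek : e ≤ k) (hem : e ≤ m)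
    (hor : e = k ∨ e = m) (hu : 0 ≤ u) (hc : 0 ≤ c)
    (hT₀ : e * T₀ ≤ 2 * m ^ 2 * (u + c) * (k + 1) ^ 2) (hT : 2 * T ≤ T₀ + 2 * u * k ^ 3) :
    e * c * T ≤ (m * (u + c) + u * (k - e)) ^ 2 * (k + 1) ^ 2 := by
  have hk : 0 ≤ k := he.trans hek
  have hm : 0 ≤ m := he.trans hem
  have hek' : e * k ≤ m ^ 2 + 2 * m * (k - e) := by
    rcases hor with rfl | rfl <;> nlinarith
  have hk3 : e * k ^ 3 ≤ (m ^ 2 + 2 * m * (k - e)) * (k + 1) ^ 2 := by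
    nlinarith [mul_le_mul hek' (by nlinarith : k ^ 2 ≤ (k + 1) ^ 2) (sq_nonneg k) (by nlinarith)]
  have heT : e * T ≤ m ^ 2 * (u + c) * (k + 1) ^ 2 +
      u * ((m ^ 2 + 2 * m * (k - e)) * (k + 1) ^ 2) := by
    nlinarith [mul_le_mul_of_nonneg_left hT he, mul_le_mul_of_nonneg_left hk3 hu]
  calc e * c * T = c * (e * T) := by ring
    _ ≤ c * (m ^ 2 * (u + c) * (k + 1) ^ 2 + u * ((m ^ 2 + 2 * m * (k - e)) * (k + 1) ^ 2)) :=
        mul_le_mul_of_nonneg_left heT hc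
    _ = (m * (u + c) + u * (k - e)) ^ 2 * (k + 1) ^ 2 - (u * (m + (k - e)) * (k + 1)) ^ 2 := by
        ring
    _ ≤ _ := sub_le_self _ (sq_nonneg _)

end LinearStageBounds

section StepCost

variable {K : Type*} [Field K] {N : ℕ}

theorem sum_Iio_val {M : Type*} [AddCommMonoid M] (r : Fin N) (φ : ℕ → M) :
    ∑ s ∈ Finset.Iio r, φ s = ∑ s ∈ Finset.range r, φ s := by
  rw [← Nat.Iio_eq_range, ← Fin.map_valEmbedding_Iio, Finset.sum_map]
  rfl

theorem sum_Iio_ite_le {r s : Fin N} (hsr : s < r) (c : ℕ) :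
    ∑ i ∈ Finset.Iio r, (if i ≤ s then c else 0) = (s + 1) * c := by
  have hIic : (Finset.Iio r).filter (· ≤ s) = Finset.Iic s := by
    ext i
    simpa only [Finset.mem_filter, Finset.mem_Iio, Finset.mem_Iic, and_iff_right_iff_imp]
      using fun his => his.trans_lt hsr
  rw [← Finset.sum_filter, hIic, Finset.sum_const, Fin.card_Iic, smul_eq_mul]

theorem scaleCost_le_sum_Iio_add {v : Fin N → K[X]} {r : Fin N} {B : Fin N → ℕ} {e : ℕ}
    (hv : ∀ j, r < j → v j = 0) (hB : ∀ i < r, v i ≠ 0 → (v i).natDegree + 1 ≤ B i)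
    (he : v r ≠ 0 → (v r).natDegree + 1 ≤ e) : scaleCost v ≤ ∑ i ∈ Finset.Iio r, B i + e := by
  classical
  have hIic : scaleCost v =
      ∑ i ∈ Finset.Iic r, if v i = 0 then 0 else (v i).natDegree + 1 := by
    refine (Finset.sum_subset (Finset.subset_univ _) fun i _ hi => ?_).symm
    rw [if_pos (hv i (lt_of_not_ge fun hle => hi (Finset.mem_Iic.mpr hle)))]
  rw [hIic, ← Finset.sum_Iio_add_eq_sum_Iic]
  refine add_le_add (Finset.sum_le_sum fun i hi => ?_) ?_
  · split_ifs with h0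
    exacts [Nat.zero_le _, hB i (Finset.mem_Iio.mp hi) h0]
  · split_ifs with h0
    exacts [Nat.zero_le _, he h0]

theorem IsLeadMon.monKey_natDegree_le {ux : ℤ} {w : Fin N → ℤ} (hux : 0 < ux) {v : Fin N → K[X]}
    {p : ℕ × Fin N} (hp : IsLeadMon ux w v p) {i : Fin N} (hi : v i ≠ 0) :
    monKey ux w ((v i).natDegree, i) ≤ monKey ux w p :=
  ((isLeadMon_iff hux).mp hp).2 _ (leadingCoeff_ne_zero.mpr hi)

theorem boundsStepCost_div {a : ℕ} (ha : 0 < a) (w : Fin N → ℕ) (r s : Fin N) (D₀ : ℕ) :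
    BoundsStepCost K a (fun i => (w i : ℤ)) r s D₀ (1 + (r + 1) * (D₀ + w s / a + 1)) := by
  intro v D hv hD _ hzero _
  have hdegree : ∀ i, v i ≠ 0 → (v i).natDegree + 1 ≤ D₀ + w s / a + 1 := by
    intro i hi
    have hweight := (Prod.Lex.monotone_fst _ _ (hv.monKey_natDegree_le (by exact_mod_cast ha) hi))
    simp only [monKey, monWeight, ofLex_toLex] at hweight
    norm_cast at hweight
    have hdiv : (v i).natDegree ≤ (D * a + w s) / a :=
      (Nat.le_div_iff_mul_le ha).mpr (by omega)
    rw [mul_comm, Nat.mul_add_div ha] at hdiv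
    omega
  refine Nat.add_le_add_left
    ((scaleCost_le_sum_Iio_add hzero (fun i _ => hdegree i) (hdegree r)).trans_eq ?_) 1
  rw [Finset.sum_const, Fin.card_Iio, smul_eq_mul, add_one_mul]

theorem boundsStepCost_linear (u : ℕ) {r s : Fin N} (hsr : s < r) (D₀ : ℕ) :
    BoundsStepCost K 1 (fun i => ((i * u : ℕ) : ℤ)) r s D₀
      (r * D₀ + (D₀ - (r + 2)) + s + 2 + u * r ^ 2) := by
  intro v D hv hD hD_lt hzero hr
  have hdegree : ∀ i < r, v i ≠ 0 →
      (v i).natDegree + 1 ≤ D + if i ≤ s then 1 + s * u else 0 := by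
    intro i _ hi
    have hkey := hv.monKey_natDegree_le zero_lt_one hi
    simp only [monKey, monWeight, Prod.Lex.toLex_le_toLex] at hkey
    split_ifs with his
    · have hweight := hkey.elim le_of_lt fun h => h.1.le
      norm_cast at hweight
      omega
    · have hlt := hkey.resolve_right fun h => his h.2
      have hsi : (s : ℕ) * u ≤ i * u := Nat.mul_le_mul_right u (Fin.le_def.mp (le_of_not_ge his))
      norm_cast at hlt
      omega
  have hsum : ∑ i ∈ Finset.Iio r, (D + if i ≤ s then 1 + s * u else 0) =
      r * D + (s + 1) * (1 + s * u) := by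
    rw [Finset.sum_add_distrib, Finset.sum_const, Fin.card_Iio, sum_Iio_ite_le hsr, smul_eq_mul]
  have hur : (s + 1) * s * u ≤ r ^ 2 * u := by
    rw [sq]
    exact Nat.mul_le_mul_right u (Nat.mul_le_mul hsr (Fin.lt_def.mp hsr).le)
  by_cases hvr : v r = 0
  · have hcost := scaleCost_le_sum_Iio_add (e := 0) hzero hdegree (absurd hvr)
    rw [hsum] at hcost
    have : (r : ℕ) * D ≤ r * D₀ := Nat.mul_le_mul_left _ hD
    linarith [Nat.zero_le (D₀ - (r + 2))]
  · have hr_degree : (v r).natDegree + 1 ≤ D - 1 := by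
      have hweight := hr _ (leadingCoeff_ne_zero.mpr hvr)
      have hsr' : (s : ℕ) * u ≤ r * u := Nat.mul_le_mul_right u (Fin.lt_def.mp hsr).le
      simp only [monWeight] at hweight
      norm_cast at hweight
      omega
    have hcost := scaleCost_le_sum_Iio_add hzero hdegree fun _ => hr_degree
    rw [hsum] at hcost
    have hD' : (r : ℕ) * (D + 1) ≤ r * D₀ := Nat.mul_le_mul_left _ (hD_lt hvr)
    have : D - 1 ≤ r + (D₀ - (r + 2)) := by have := hD_lt hvr; omega
    linarith

end StepCost

/-- The weight of the basis vector number `s` (counting from zero), where the functions `y j` have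
pole orders `b j`. -/
def rowWeight (a : ℕ) (b : ℕ → ℕ) (u s : ℕ) : ℕ := b (s % a) + s / a * u

theorem isLeadMon_single {K : Type*} [Field K] {N : ℕ} {ux : ℤ} (hux : 0 < ux) (w : Fin N → ℤ)
    (s : Fin N) {p : K[X]} (hp : p ≠ 0) : IsLeadMon ux w (Pi.single s p) (p.natDegree, s) := by
  refine (isLeadMon_iff hux).mpr ⟨?_, fun q hq => ?_⟩
  · rw [Pi.single_eq_same]
    exact leadingCoeff_ne_zero.mpr hp
  · obtain ⟨d, i⟩ := q
    obtain rfl : i = s := by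
      by_contra hi
      rw [Pi.single_eq_of_ne hi, coeff_zero] at hq
      exact hq rfl
    rw [Pi.single_eq_same] at hq
    have hd : (d : ℤ) * ux ≤ p.natDegree * ux := by
      gcongr
      exact le_natDegree_of_ne_zero hq
    exact Prod.Lex.toLex_mono ⟨add_le_add_left hd _, le_rfl⟩

namespace IsGenSystem

variable {K F : Type*} [Field K] [Field F] [Algebra K F] {Q : Place K F} {n : ℕ}
  {P : Fin n → Place K F} {r : Fin n → K} {a : ℕ} {x₁ : F} {y : ℕ → F} {b : ℕ → ℕ} {f : F}
  {φ : K[X]} {h : F} {m ℓ : ℕ} {G : Fin (a * (ℓ + 1)) → Fin (a * (ℓ + 1)) → K[X]}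

theorem natDegree_apply_self (hG : IsGenSystem Q P r a x₁ y b f φ h m ℓ G)
    (s : Fin (a * (ℓ + 1))) : (G s s).natDegree = (m - (s : ℕ) / a) * φ.natDegree := by
  rw [hG.apply_self, natDegree_pow]

theorem monWeight_le_of_coeff_ne_zero (hG : IsGenSystem Q P r a x₁ y b f φ h m ℓ G) {u c q : ℕ}
    (hh : ((-(u + c : ℤ) : ℤ) : WithTop ℤ) ≤ Q.val h) {s : Fin (a * (ℓ + 1))}
    (hq : min ((s : ℕ) / a) m * c ≤ q * a) {p : ℕ × Fin (a * (ℓ + 1))}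
    (hp : (G s p.2).coeff p.1 ≠ 0) :
    monWeight a (fun i => (rowWeight a b u i : ℤ)) p ≤
      monWeight a (fun i => (rowWeight a b u i : ℤ)) ((G s s).natDegree, s) + q * a := by
  obtain ⟨hsi, his, hweight⟩ := hG.weight_le_of_coeff_ne_zero hh hp
  have hexcess : ((s : ℕ) / a - (p.2 : ℕ) / a) * c ≤ q * a :=
    (Nat.mul_le_mul_right c (le_min (Nat.sub_le _ _) (by omega))).trans hq
  zify [his] at hexcess
  simp only [monWeight, rowWeight, hG.natDegree_apply_self]
  push_cast at hweight hexcess ⊢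
  linarith

theorem single_pow_mem_span (hG : IsGenSystem Q P r a x₁ y b f φ h m ℓ G)
    {s t : Fin (a * (ℓ + 1))} (hst : s < t) :
    Pi.single s (φ ^ m) ∈ Submodule.span K[X] (G '' Set.Iio t) := by
  refine mem_span_of_hasInd hG.mem_interpolationSubmodule hG.hasInd
    (fun _ hv _ hs => hG.dvd_of_hasInd hv hs) t ?_ fun j hj => Pi.single_eq_of_ne ?_ _
  · have hC := C_mem_interpolationModule (r := r)
      ((regularRing Q).mul_mem ((regularRing Q).pow_mem hG.zeros.mem m) (hG.basis.y_mem (s % a)))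
      (hG.zeros.le_val_pow_mul hG.ne (hG.basis.y_mem (s % a)) m)
    have hmem := mul_mem_interpolationModule hC
      (pow_mem_interpolationModule (X_mem_interpolationModule (Q := Q) (P := P) (r := r)) (s / a))
    rw [mul_zero, mul_one, add_zero, zero_add, ← hG.aeval_eq, ← map_pow,
      ← ofCoords_single] at hmem
    exact interpolationModule_mono (hG.basis.div_le s) hmem
  · exact (hst.trans_le hj).ne'

theorem exists_algGHaltsWith (hG : IsGenSystem Q P r a x₁ y b f φ h m ℓ G) {u c : ℕ}
    (hh : ((-(u + c : ℤ) : ℤ) : WithTop ℤ) ≤ Q.val h) {q : Fin (a * (ℓ + 1)) → ℕ}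
    (hq : ∀ s : Fin (a * (ℓ + 1)), min ((s : ℕ) / a) m * c ≤ q s * a)
    {cost : Fin (a * (ℓ + 1)) → Fin (a * (ℓ + 1)) → ℕ → ℕ}
    (hcost : ∀ k, ∀ s < k, ∀ D,
      BoundsStepCost K a (fun i => (rowWeight a b u i : ℤ)) k s D (cost k s D)) :
    ∃ τ, AlgGHaltsWith a (fun i => (rowWeight a b u i : ℤ)) G τ ∧
      IsMinimalGroebnerBasis a (fun i => (rowWeight a b u i : ℤ))
        {v | ofCoords a x₁ y v ∈ interpolationModule Q P r m ℓ} τ.rows ∧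
      ∃ D : Fin (a * (ℓ + 1)) → Fin (a * (ℓ + 1)) → ℕ,
        (∀ k, ∑ s ∈ Finset.Iio k, D k s =
          φ.natDegree * ∑ s ∈ Finset.range k, (m - s / a)) ∧
        (∀ k, ∀ s < k, D k s ≤ m * φ.natDegree) ∧
        τ.mults ≤ ∑ k, q k * ∑ s ∈ Finset.Iio k, cost k s (D k s) := by
  have hux : 0 < (a : ℤ) := Int.natCast_pos.mpr hG.basis.pos
  obtain ⟨τ, hτ, hbasis, D, hsum, hmin, hmults⟩ := AGInterp.exists_algGHaltsWith hux hG.hasInd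
    (fun s _ hp => hG.monWeight_le_of_coeff_ne_zero hh (hq s) hp) hcost
  rw [hG.span_range_eq] at hbasis
  refine ⟨τ, hτ, hbasis, D, fun k => ?_, fun k s hs => ?_, hmults⟩
  · rw [hsum, Finset.mul_sum, ← sum_Iio_val k fun s => φ.natDegree * (m - s / a)]
    exact Finset.sum_congr rfl fun s _ => by rw [hG.natDegree_apply_self, mul_comm]
  · rw [← natDegree_pow]
    exact hmin k s hs _ (hG.single_pow_mem_span hs) _
      (isLeadMon_single hux _ s (pow_ne_zero m hG.phi_ne_zero))

end IsGenSystem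

section StageCost

variable {N a β u c m d : ℕ} {b : ℕ → ℕ}

theorem rowWeight_le (ha : 0 < a) (hb : ∀ j < a, b j ≤ β) {s k : ℕ} (hsk : s ≤ k) :
    rowWeight a b u s ≤ β + k / a * u :=
  add_le_add (hb _ (Nat.mod_lt s ha)) (Nat.mul_le_mul_right u (Nat.div_le_div_right hsk))

theorem sum_range_tsub_div_add_le (ha : 0 < a) (hm : 1 ≤ m) (k : ℕ) :
    ∑ s ∈ Finset.range k, (m - s / a) + k ≤ k * m + a := by
  have hcard : ∑ s ∈ Finset.range k, (if s < a then 1 else 0) ≤ a := by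
    rw [Finset.sum_boole, Nat.cast_id]
    exact (Finset.card_le_card fun s hs => Finset.mem_range.mpr (Finset.mem_filter.mp hs).2).trans
      (Finset.card_range a).le
  calc ∑ s ∈ Finset.range k, (m - s / a) + k = ∑ s ∈ Finset.range k, (m - s / a + 1) := by
        rw [Finset.sum_add_distrib, Finset.sum_const, Finset.card_range, smul_eq_mul, mul_one]
    _ ≤ ∑ s ∈ Finset.range k, (m + if s < a then 1 else 0) := by
        refine Finset.sum_le_sum fun s _ => ?_
        split_ifs with hs
        · exact Nat.add_le_add_right (Nat.sub_le _ _) 1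
        · have : 1 ≤ s / a := (Nat.one_le_div_iff ha).mpr (le_of_not_gt hs)
          omega
    _ ≤ k * m + a := by
        rw [Finset.sum_add_distrib, Finset.sum_const, Finset.card_range, smul_eq_mul]
        exact Nat.add_le_add_left hcard _

theorem mul_sum_crude_le (hb : ∀ j < a, b j ≤ β) (ha : 0 < a) (k : Fin N) (D : Fin N → ℕ) :
    a * ∑ s ∈ Finset.Iio k, (1 + (k + 1) * (D s + rowWeight a b u s / a + 1)) ≤
      a * k + (k + 1) * (a * ∑ s ∈ Finset.Iio k, D s + k * (β + k / a * u) + a * k) := by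
  calc a * ∑ s ∈ Finset.Iio k, (1 + (k + 1) * (D s + rowWeight a b u s / a + 1))
      = ∑ s ∈ Finset.Iio k,
          (a + (k + 1) * (a * D s + a * (rowWeight a b u s / a) + a)) := by
        rw [Finset.mul_sum]
        exact Finset.sum_congr rfl fun s _ => by ring
    _ ≤ ∑ s ∈ Finset.Iio k, (a + (k + 1) * (a * D s + (β + k / a * u) + a)) := by
        gcongr with s hs
        exact (Nat.mul_div_le _ a).trans
          (rowWeight_le ha hb (Fin.le_def.mp (Finset.mem_Iio.mp hs).le))
    _ = _ := by
        simp only [Finset.sum_add_distrib, ← Finset.mul_sum, Finset.sum_const, Fin.card_Iio,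
          smul_eq_mul]
        ring

theorem mul_le_sq_of_two_le {k r S T : ℕ} (ha : 2 ≤ a) (har : a ≤ r) (hβ : a ≤ β + 1) (hm : 1 ≤ m)
    (hc : 1 ≤ c) (hd : a * d ≤ u + c + 1) (hS : S + d * r ≤ d * (r * m + a))
    (hT : a * T ≤ a * r + (r + 1) * (a * S + r * (β + k * u) + a * r)) :
    (min k m * c + (a - 1)) * T ≤ (β + m * (u + c) + u * (k - m)) ^ 2 * (r + 1) ^ 2 := by
  have hdH : d ≤ u + c := by
    have := Nat.mul_le_mul_right d ha
    omega
  have hcu : 1 ≤ u + c := by omega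
  have hmin : k - m = k - min k m := by omega
  obtain ⟨e, he⟩ : ∃ e, e = min k m := ⟨_, rfl⟩
  have hek : e ≤ k := he.trans_le (min_le_left _ _)
  have hem : e ≤ m := he.trans_le (min_le_right _ _)
  rw [hmin, ← he]
  have hke : ((k - e : ℕ) : ℤ) = k - e := Nat.cast_sub hek
  have ha1 : ((a - 1 : ℕ) : ℤ) = a - 1 := Nat.cast_pred (by omega)
  zify at *
  rw [hke, ha1, ← add_sub_assoc]
  exact mul_le_sq_of_crudeStageCost_le (by positivity) hek hem (by positivity) (by positivity)
    (by linarith) hβ (crudeStageCost_le ha har (by positivity) hek hm (by positivity) hcu hdH hβ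
      hS hT)

theorem excess_mul_crude_le (ha : 2 ≤ a) (hb : ∀ j < a, b j ≤ β) (hβ : a ≤ β + 1)
    (hd : a * d ≤ u + c + 1) {k : Fin N} (hpos : 0 < min ((k : ℕ) / a) m * c) {D : Fin N → ℕ}
    (hD : ∑ s ∈ Finset.Iio k, D s = d * ∑ s ∈ Finset.range k, (m - s / a)) :
    (min ((k : ℕ) / a) m * c + (a - 1)) *
        ∑ s ∈ Finset.Iio k, (1 + (k + 1) * (D s + rowWeight a b u s / a + 1)) ≤
      (β + m * (u + c) + u * (k / a - m)) ^ 2 * (k + 1) ^ 2 := by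
  obtain ⟨hka, hm⟩ := lt_min_iff.mp (Nat.pos_of_mul_pos_right hpos)
  refine mul_le_sq_of_two_le ha ((Nat.one_le_div_iff (by omega)).mp hka) hβ hm
    (Nat.pos_of_mul_pos_left hpos) hd ?_ (mul_sum_crude_le hb (by omega) k D)
  rw [hD, ← mul_add]
  exact Nat.mul_le_mul_left d (sum_range_tsub_div_add_le (by omega) hm k)

theorem mul_le_sq_of_linear {k S X T : ℕ} (hk : 1 ≤ k) (hm : 1 ≤ m) (hc : 1 ≤ c)
    (hd : d ≤ u + c + 1) (hS : 2 * S = d * (min k m * (2 * m - min k m + 1)))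
    (hX : m * d * X ≤ S * (m * d - (k + 2))) (hX₀ : m * d ≤ k + 2 → X = 0)
    (hT : 2 * T ≤ 2 * (k * S + X) + k * (k + 3) + 2 * u * k ^ 3) :
    min k m * c * T ≤ (m * (u + c) + u * (k - m)) ^ 2 * (k + 1) ^ 2 := by
  have hmin : k - m = k - min k m := by omega
  have hor := min_choice k m
  obtain ⟨e, he⟩ : ∃ e, e = min k m := ⟨_, rfl⟩
  have he1 : 1 ≤ e := he.trans_ge (le_min hk hm)
  have hek : e ≤ k := he.trans_le (min_le_left _ _)
  have hem : e ≤ m := he.trans_le (min_le_right _ _)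
  have hcu : 1 ≤ u + c := by omega
  have hd2 : d ≤ 2 * (u + c) := by omega
  rw [hmin, ← he]
  rw [← he] at hS hor
  have hke : ((k - e : ℕ) : ℤ) = k - e := Nat.cast_sub hek
  have hme : ((2 * m - e : ℕ) : ℤ) = 2 * m - e := by
    rw [Nat.cast_sub (by omega), Nat.cast_mul, Nat.cast_ofNat]
  have hT₀ : (e : ℤ) * (2 * (k * S + X) + k * (k + 3)) ≤ 2 * m ^ 2 * (u + c) * (k + 1) ^ 2 := by
    rcases le_or_gt (m * d) (k + 2) with hmd | hmd
    · rw [hX₀ hmd]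
      zify at *
      rw [hme] at hS
      simpa only [Nat.cast_zero, add_zero] using
        linearStageCost_le_of_le he1 hek hem hor hcu hd2 hS
    · have hd1 : 1 ≤ d := Nat.pos_of_mul_pos_left (by omega : 0 < m * d)
      zify [hmd.le] at *
      rw [hme] at hS
      exact linearStageCost_le he1 hek hem hor hcu hd1 hd2 hS hX
  zify at *
  rw [hke]
  exact mul_le_sq_of_linearStageCost_le (by positivity) hek hem hor (by positivity)
    (by positivity) hT₀ hT

theorem excess_mul_linear_le (hd : d ≤ u + c + 1) {k : Fin N} (hpos : 0 < min (k : ℕ) m * c)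
    {D : Fin N → ℕ} (hD : ∑ s ∈ Finset.Iio k, D s = d * ∑ s ∈ Finset.range k, (m - s))
    (hDm : ∀ s < k, D s ≤ m * d) :
    min (k : ℕ) m * c * ∑ s ∈ Finset.Iio k, (k * D s + (D s - (k + 2)) + s + 2 + u * k ^ 2) ≤
      (m * (u + c) + u * (k - m)) ^ 2 * (k + 1) ^ 2 := by
  obtain ⟨hk, hm⟩ := lt_min_iff.mp (Nat.pos_of_mul_pos_right hpos)
  refine mul_le_sq_of_linear hk hm (Nat.pos_of_mul_pos_left hpos) hd
    (S := ∑ s ∈ Finset.Iio k, D s) (X := ∑ s ∈ Finset.Iio k, (D s - (k + 2))) ?_ ?_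
    (fun hmd => ?_) ?_
  · rw [hD, ← two_mul_sum_range_tsub]
    ring
  · rw [Finset.mul_sum, Finset.sum_mul]
    exact Finset.sum_le_sum fun s hs => mul_tsub_le_mul_tsub (hDm s (Finset.mem_Iio.mp hs)) _
  · exact Finset.sum_eq_zero fun s hs =>
      Nat.sub_eq_zero_of_le ((hDm s (Finset.mem_Iio.mp hs)).trans hmd)
  · have hid : 2 * ∑ s ∈ Finset.Iio k, (s : ℕ) + k = k * k := by
      rw [sum_Iio_val k fun s => s, mul_comm, Finset.sum_range_id_mul_two, Nat.mul_sub, mul_one,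
        Nat.sub_add_cancel (Nat.le_mul_self _)]
    simp only [Finset.sum_add_distrib, ← Finset.mul_sum, Finset.sum_const, Fin.card_Iio,
      smul_eq_mul]
    linarith

end StageCost

theorem mul_ceilDiv_mul_le {a e T B : ℕ} (ha : 0 < a) (h : (e + (a - 1)) * T ≤ B) :
    a * ((e ⌈/⌉ a) * T) ≤ B := by
  have hceil : a * (e ⌈/⌉ a) ≤ e + (a - 1) := by
    rw [Nat.ceilDiv_eq_add_pred_div, ← Nat.add_sub_assoc ha]
    exact Nat.mul_div_le _ a
  rw [← mul_assoc]
  exact (Nat.mul_le_mul_right _ hceil).trans h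

theorem exists_stageCost_le (K : Type*) [Field K] {N a β u c m d : ℕ} {b : ℕ → ℕ} (ha : 0 < a)
    (hb : ∀ j < a, b j ≤ β) (hβ : a ≤ β + 1) (hb₀ : b 0 = 0) (hd : a * d ≤ u + c + 1) :
    ∃ cost : Fin N → Fin N → ℕ → ℕ,
      (∀ k, ∀ s < k, ∀ D,
        BoundsStepCost K a (fun i => (rowWeight a b u i : ℤ)) k s D (cost k s D)) ∧
      ∀ (k : Fin N) (D : Fin N → ℕ), 0 < min ((k : ℕ) / a) m * c →
        ∑ s ∈ Finset.Iio k, D s = d * ∑ s ∈ Finset.range k, (m - s / a) →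
        (∀ s < k, D s ≤ m * d) →
        (min ((k : ℕ) / a) m * c + (a - 1)) * ∑ s ∈ Finset.Iio k, cost k s (D s) ≤
          (β + m * (u + c) + u * (k / a - m)) ^ 2 * (k + 1) ^ 2 := by
  obtain rfl | ha2 : a = 1 ∨ 2 ≤ a := by omega
  · have hrow : ∀ i, rowWeight 1 b u i = i * u := fun i => by
      rw [rowWeight, Nat.mod_one, hb₀, zero_add, Nat.div_one]
    simp only [hrow, Nat.div_one, Nat.cast_one, one_mul, tsub_self, add_zero] at hd ⊢
    refine ⟨fun k s D => k * D + (D - (k + 2)) + s + 2 + u * k ^ 2,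
      fun k s hs D => boundsStepCost_linear u hs D, fun k D hpos hD hDm => ?_⟩
    refine (excess_mul_linear_le hd hpos hD hDm).trans ?_
    gcongr
    omega
  · exact ⟨fun k s D => 1 + (k + 1) * (D + rowWeight a b u s / a + 1),
      fun k s _ D => boundsStepCost_div ha _ k s D,
      fun k D hpos hD _ => excess_mul_crude_le ha2 hb hβ hd hpos hD⟩

namespace IsPoleBasis

variable {K F : Type*} [Field K] [Field F] [Algebra K F] {Q : Place K F} {a : ℕ} {x₁ : F}
  {y : ℕ → F} {b : ℕ → ℕ}

theorem b_zero (hB : IsPoleBasis Q a x₁ y b) : b 0 = 0 := by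
  obtain ⟨s, hs, hval⟩ := hB.pole 1 (regularRing Q).one_mem one_ne_zero
  rw [AddValuation.map_one, ← WithTop.coe_zero, WithTop.coe_inj] at hval
  obtain rfl : s = 0 := by omega
  exact Nat.le_zero.mp (hB.b_min 0 0 hs rfl)

theorem le_bound_add_one (hB : IsPoleBasis Q a x₁ y b) {β : ℕ} (hβ : ∀ j < a, b j ≤ β) :
    a ≤ β + 1 := by
  have hlt : a - 1 < a := Nat.sub_lt hB.pos one_pos
  have hmod : a - 1 ≤ b (a - 1) := by
    conv_lhs => rw [← Nat.mod_eq_of_lt hlt, ← hB.b_mod (a - 1)]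
    exact Nat.mod_le _ _
  have := hβ _ hlt
  omega

end IsPoleBasis

namespace IsGenSystem

variable {K F : Type*} [Field K] [Field F] [Algebra K F] {Q : Place K F} {n : ℕ}
  {P : Fin n → Place K F} {r : Fin n → K} {a : ℕ} {x₁ : F} {y : ℕ → F} {b : ℕ → ℕ} {f : F}
  {φ : K[X]} {h : F} {m ℓ : ℕ} {G : Fin (a * (ℓ + 1)) → Fin (a * (ℓ + 1)) → K[X]}

theorem exists_algGHaltsWith_mults_le (hG : IsGenSystem Q P r a x₁ y b f φ h m ℓ G) {H : ℤ}
    (hh : ((-H : ℤ) : WithTop ℤ) ≤ Q.val h) (hd : (a * φ.natDegree : ℤ) ≤ H + 1) (hmℓ : m ≤ ℓ)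
    (u : ℕ) {β : ℕ} (hβ : ∀ j < a, b j ≤ β) :
    ∃ τ, AlgGHaltsWith a (fun i => (rowWeight a b u i : ℤ)) G τ ∧
      IsMinimalGroebnerBasis a (fun i => (rowWeight a b u i : ℤ))
        {v | ofCoords a x₁ y v ∈ interpolationModule Q P r m ℓ} τ.rows ∧
      a * (τ.mults : ℤ) ≤ (β + m * H + u * (ℓ - m)) ^ 2 *
        ∑ k : Fin (a * (ℓ + 1)), ((k : ℕ) + 1 : ℤ) ^ 2 := by
  have ha := hG.basis.pos
  obtain ⟨c, hc⟩ : ∃ c : ℕ, (c : ℤ) = max (H - u) 0 :=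
    ⟨_, Int.toNat_eq_max (H - u)⟩
  have hh' : ((-(u + c : ℤ) : ℤ) : WithTop ℤ) ≤ Q.val h :=
    (WithTop.coe_le_coe.mpr (by omega)).trans hh
  obtain ⟨cost, hcost, hstage⟩ := exists_stageCost_le K (N := a * (ℓ + 1)) (u := u) (c := c)
    (m := m) ha hβ (hG.basis.le_bound_add_one hβ) hG.basis.b_zero
    (by zify at hd ⊢; omega : a * φ.natDegree ≤ u + c + 1)
  have hq : ∀ s : Fin (a * (ℓ + 1)),
      min ((s : ℕ) / a) m * c ≤ (min ((s : ℕ) / a) m * c ⌈/⌉ a) * a := fun s => by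
    rw [mul_comm (_ ⌈/⌉ _)]
    exact le_smul_ceilDiv ha
  obtain ⟨τ, hτ, hbasis, D, hsum, hmax, hmults⟩ := hG.exists_algGHaltsWith hh' hq hcost
  refine ⟨τ, hτ, hbasis, ?_⟩
  have hstages : ∀ k : Fin (a * (ℓ + 1)),
      (a * ((min ((k : ℕ) / a) m * c ⌈/⌉ a) * ∑ s ∈ Finset.Iio k, cost k s (D k s)) : ℕ) ≤
        (β + m * H + u * (ℓ - m)) ^ 2 * ((k : ℕ) + 1 : ℤ) ^ 2 := by
    intro k
    rcases (Nat.zero_le (min ((k : ℕ) / a) m * c)).eq_or_lt with hzero | hpos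
    · rw [← hzero, zero_ceilDiv, zero_mul, mul_zero, Nat.cast_zero]
      positivity
    have hH : H = u + c := by
      have := Nat.pos_of_mul_pos_left hpos
      omega
    have hk : (k : ℕ) / a - m ≤ ℓ - m := Nat.sub_le_sub_right (hG.basis.div_le k) m
    have hbound := mul_ceilDiv_mul_le ha (hstage k (D k) hpos (hsum k) (hmax k))
    calc _ ≤ (((β + m * (u + c) + u * (ℓ - m)) ^ 2 * (k + 1) ^ 2 : ℕ) : ℤ) :=
          Nat.cast_le.mpr (hbound.trans (by gcongr))
      _ = _ := by rw [hH]; push_cast [hmℓ]; ring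
  rw [Finset.mul_sum]
  refine le_trans ?_ (Finset.sum_le_sum fun k _ => hstages k)
  rw [← Nat.cast_sum, ← Finset.mul_sum]
  exact_mod_cast Nat.mul_le_mul_left a hmults

end IsGenSystem

theorem exists_iSup_eq_natCast {a : ℕ} (ha : 0 < a) (b : ℕ → ℕ) :
    ∃ β : ℕ, ⨆ j : Fin a, (b j : ℤ) = β ∧ ∀ j < a, b j ≤ β := by
  have hle (j : ℕ) (hj : j < a) : (b j : ℤ) ≤ ⨆ j : Fin a, (b j : ℤ) :=
    le_ciSup (f := fun j : Fin a => (b j : ℤ)) (Set.finite_range _).bddAbove ⟨j, hj⟩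
  obtain ⟨β, hβ⟩ := Int.eq_ofNat_of_zero_le ((Int.natCast_nonneg _).trans (hle 0 ha))
  exact ⟨β, hβ, fun j hj => Int.ofNat_le.mp ((hle j hj).trans_eq hβ)⟩

theorem le_sq_mul_inv_mul_sum_sq {a N t : ℕ} {B : ℤ} (ha : 0 < a)
    (h : a * (t : ℤ) ≤ B ^ 2 * ∑ k : Fin N, ((k : ℕ) + 1 : ℤ) ^ 2) :
    (t : ℚ) ≤ (B : ℚ) ^ 2 * (a : ℚ)⁻¹ * ∑ i ∈ Finset.Icc 1 N, (i : ℚ) ^ 2 := by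
  have hsum : ∑ i ∈ Finset.Icc 1 N, (i : ℚ) ^ 2 = ∑ k : Fin N, ((k : ℕ) + 1 : ℚ) ^ 2 := by
    rw [Fin.sum_univ_eq_sum_range (fun k => (k + 1 : ℚ) ^ 2), ← Finset.Ico_add_one_right_eq_Icc,
      Finset.sum_Ico_eq_sum_range, add_tsub_cancel_right]
    simp only [Nat.cast_add, Nat.cast_one, add_comm]
  rw [hsum, mul_right_comm, ← div_eq_mul_inv, le_div_iff₀' (Nat.cast_pos.mpr ha)]
  exact_mod_cast h

end AGInterp

theorem mainTheorem5_general {K F : Type*} [Field K] [Field F] [Algebra K F]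
    (g : ℕ) (hg : AGInterp.genus K F = (g : ℕ∞))
    (n : ℕ) (Q : AGInterp.Place K F) (P : Fin n → AGInterp.Place K F)
    (hQdeg : Q.degree = 1) (hPdeg : ∀ i, (P i).degree = 1)
    (hPinj : Function.Injective P) (hPQ : ∀ i, P i ≠ Q)
    (t : ℕ) (a : Fin (t + 1) → ℕ) (ha : ∀ i, 0 < a i)
    (hgen : (AddSubmonoid.closure (Set.range a) : Set ℕ) = AGInterp.weierstrass Q)
    (x : Fin (t + 1) → F)
    (hx : ∀ i, AGInterp.HasPoleDivisor (x i) (Finsupp.single Q (a i : ℤ)))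
    (f : F) (hf : f ∈ AGInterp.regularAway Q)
    (hfD : AGInterp.HasZeroDivisor f (∑ i, Finsupp.single (P i) (1 : ℤ)))
    (hfx : f ∈ Algebra.adjoin K {x 0})
    (u m ℓ : ℕ) (hmℓ : m ≤ ℓ) (r : Fin n → K)
    (h : F) (hh : h ∈ AGInterp.regularAway Q)
    (hhr : ∀ i, 0 < (P i).val (h - algebraMap K F (r i)))
    (hhQ : ((-((n : ℤ) + 2 * (g : ℤ) - 1) : ℤ) : WithTop ℤ) ≤ Q.val h) :
    let y : ℕ → F := AGInterp.basisElt Q a x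
    let η : ℕ → ℕ → F := fun i j => f ^ i * y j
    let N : ℕ := a 0 * (ℓ + 1)
    let ux : ℤ := AGInterp.poleOrder Q (x 0)
    let w : Fin N → ℤ := fun s =>
      AGInterp.poleOrder Q (y (s.1 % a 0)) + ((s.1 / a 0 : ℕ) : ℤ) * (u : ℤ)
    let toPoly : (Fin N → Polynomial K) → Polynomial F := AGInterp.ofCoords (a 0) (x 0) y
    (∀ i ≤ m, ∀ j < a 0,
      AGInterp.IsMinPole (-((i : ℤ) • ∑ k, Finsupp.single (P k) (1 : ℤ))) Q (a 0) j (η i j)) ∧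
    ∃ G : Fin N → Fin N → Polynomial K,
      (∀ G' : Fin N → Fin N → Polynomial K,
        (∀ s : Fin N, toPoly (G' s) = AGInterp.generator (a 0) m η h s.1) ↔ G' = G) ∧
      (∀ s : Fin N, AGInterp.HasInd (G s) s) ∧
      ∃ τ : AGInterp.GState K N,
        AGInterp.AlgGHaltsWith ux w G τ ∧
        AGInterp.IsMinimalGroebnerBasis ux w
          {v | toPoly v ∈ AGInterp.interpolationModule Q P r m ℓ} τ.rows ∧
        (τ.mults : ℚ) ≤
          (((⨆ j : Fin (a 0), AGInterp.poleOrder Q (y j.1)) + (m : ℤ) * ((n : ℤ) + 2 * g - 1) +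
              (u : ℤ) * ((ℓ : ℤ) - m) : ℤ) : ℚ) ^ 2 * ((a 0 : ℕ) : ℚ)⁻¹ *
            ∑ i ∈ Finset.Icc 1 (a 0 * (ℓ + 1)), (i : ℚ) ^ 2 := by
  intro y η N ux w toPoly
  have hB := AGInterp.isPoleBasis_basisElt hg hQdeg ha hgen hx
  have hZ := AGInterp.hasSimpleZeros_of_hasZeroDivisor hPinj hPQ hf hfD
  rw [Algebra.adjoin_singleton_eq_range_aeval] at hfx
  obtain ⟨φ, hφ⟩ := hfx
  obtain ⟨G, hG⟩ := hB.exists_isGenSystem hPQ hZ hφ hh hhr m ℓ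
  have hdeg := hZ.poleOrder_le hPinj hPQ hPdeg hg hQdeg hG.val_f
  have hux : ux = a 0 := AGInterp.poleOrder_eq hB.x_val
  have hy (j : ℕ) : AGInterp.poleOrder Q (y j) = AGInterp.residueMin Q (a 0) j :=
    AGInterp.poleOrder_eq (hB.y_val j)
  have hw : w = fun s : Fin N =>
      (AGInterp.rowWeight (a 0) (AGInterp.residueMin Q (a 0)) u s : ℤ) := by
    simp only [w, hy, AGInterp.rowWeight, Nat.cast_add, Nat.cast_mul]
  obtain ⟨β, hsup, hβ⟩ := AGInterp.exists_iSup_eq_natCast (ha 0) (AGInterp.residueMin Q (a 0))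
  obtain ⟨τ, hτ, hbasis, hmults⟩ :=
    hG.exists_algGHaltsWith_mults_le hhQ (by omega) hmℓ u hβ
  refine ⟨fun i _ j _ => hB.isMinPole hPinj hPQ hZ hG.val_f i j, G, hG.forall_ofCoords_eq_iff,
    hG.hasInd, τ, ?_, ?_, ?_⟩
  · rwa [hux, hw]
  · rwa [hux, hw]
  · simp only [hy, hsup]
    exact AGInterp.le_sq_mul_inv_mul_sum_sq (ha 0) hmults

theorem mainTheorem5 {K F : Type*} [Field K] [Finite K] [Field F] [Algebra K F]
    (hF : AGInterp.IsFunctionField K F)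
    (g : ℕ) (hg : AGInterp.genus K F = (g : ℕ∞))
    -- the places of degree one
    (n : ℕ) (Q : AGInterp.Place K F) (P : Fin n → AGInterp.Place K F)
    (hQdeg : Q.degree = 1) (hPdeg : ∀ i, (P i).degree = 1)
    (hPinj : Function.Injective P) (hPQ : ∀ i, P i ≠ Q)
    -- generators of the Weierstrass semigroup and the functions that realize them
    (t : ℕ) (a : Fin (t + 1) → ℕ) (ha : ∀ i, 0 < a i)
    (hgen : (AddSubmonoid.closure (Set.range a) : Set ℕ) = AGInterp.weierstrass Q)
    (x : Fin (t + 1) → F)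
    (hx : ∀ i, AGInterp.HasPoleDivisor (x i) (Finsupp.single Q (a i : ℤ)))
    -- the assumption on `D = P_1 + ⋯ + P_n`
    (f : F) (hf : f ∈ AGInterp.regularAway Q)
    (hfD : AGInterp.HasZeroDivisor f (∑ i, Finsupp.single (P i) (1 : ℤ)))
    (hfx : f ∈ Algebra.adjoin K {x 0})
    -- the parameters, the received word, and its interpolating function
    (u m ℓ : ℕ) (hmℓ : m ≤ ℓ) (r : Fin n → K)
    (h : F) (hh : h ∈ AGInterp.regularAway Q)
    (hhr : ∀ i, 0 < (P i).val (h - algebraMap K F (r i)))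
    (hhQ : ((-((n : ℤ) + 2 * (g : ℤ) - 1) : ℤ) : WithTop ℤ) ≤ Q.val h) :
    let y : ℕ → F := AGInterp.basisElt Q a x
    let η : ℕ → ℕ → F := fun i j => f ^ i * y j
    let N : ℕ := a 0 * (ℓ + 1)
    let ux : ℤ := AGInterp.poleOrder Q (x 0)
    let w : Fin N → ℤ := fun s =>
      AGInterp.poleOrder Q (y (s.1 % a 0)) + ((s.1 / a 0 : ℕ) : ℤ) * (u : ℤ)
    let toPoly : (Fin N → Polynomial K) → Polynomial F := AGInterp.ofCoords (a 0) (x 0) y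
    (∀ i ≤ m, ∀ j < a 0,
      AGInterp.IsMinPole (-((i : ℤ) • ∑ k, Finsupp.single (P k) (1 : ℤ))) Q (a 0) j (η i j)) ∧
    ∃ G : Fin N → Fin N → Polynomial K,
      (∀ G' : Fin N → Fin N → Polynomial K,
        (∀ s : Fin N, toPoly (G' s) = AGInterp.generator (a 0) m η h s.1) ↔ G' = G) ∧
      (∀ s : Fin N, AGInterp.HasInd (G s) s) ∧
      ∃ τ : AGInterp.GState K N,
        AGInterp.AlgGHaltsWith ux w G τ ∧
        AGInterp.IsMinimalGroebnerBasis ux w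
          {v | toPoly v ∈ AGInterp.interpolationModule Q P r m ℓ} τ.rows ∧
        (τ.mults : ℚ) ≤
          (((⨆ j : Fin (a 0), AGInterp.poleOrder Q (y j.1)) + (m : ℤ) * ((n : ℤ) + 2 * g - 1) +
              (u : ℤ) * ((ℓ : ℤ) - m) : ℤ) : ℚ) ^ 2 * ((a 0 : ℕ) : ℚ)⁻¹ *
            ∑ i ∈ Finset.Icc 1 (a 0 * (ℓ + 1)), (i : ℚ) ^ 2 :=
  mainTheorem5_general g hg n Q P hQdeg hPdeg hPinj hPQ t a ha hgen x hx f hf hfD hfx u m ℓ hmℓ r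
    h hh hhr hhQ
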